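/- **Setting.** Let $\omega=(\alpha,\beta,\gamma)$, where $\alpha=(\alpha_i)_{i\ge1}$ and $\beta=(\beta_i)_{i\ge1}$ are nonincreasing summable sequences of nonnegative reals with $\beta_1\le 1$, and $\gamma\ge 0$. Let $E^\omega$ be the meromorphic function on $\mathbb C$ determined by $$E^\omega\Big(\tfrac{z+z^{-1}}2\Big)=e^{\frac\gamma2(z+z^{-1}-2)}\prod_{i\ge1}\frac{(1+\frac{\beta_i}2(z-1))(1+\frac{\beta_i}2(z^{-1}-1))}{(1-\frac{\alpha_i}2(z-1))(1-\frac{\alpha_i}2(z^{-1}-1))}.$$ For $n\ge1$ put $r_n=\lfloor (n+1)/2\rfloor$, and $\alpha_n=\frac12$ for $n$ even, $\alpha_n=-\frac12$ for $n$ odd (in exponents and indices of $J$, $\alpha_n$ always has this meaning). Let $J_{k,1/2}$ and $J_{k,-1/2}$ be the Chebyshev polynomials of the second and third kind: $J_{0,\pm1/2}=1$, $J_{1,1/2}=2x$, $J_{1,-1/2}=2x-1$, $J_{k+1,\cdot}=2xJ_{k,\cdot}-J_{k-1,\cdot}$. Let $\mathbb J_n$ be the set of partitions $\lambda=(\lambda_1\ge\dots\ge\lambda_{r_n}\ge0)$,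 put $\tilde\lambda_i=\lambda_i+r_n-i$, and for $\lambda\in\mathbb J_n,\mu\in\mathbb J_{n+1}$ write $\lambda\prec\mu$ if $\mu_1\ge\lambda_1\ge\mu_2\ge\dots\ge\mu_{r_n}\ge\lambda_{r_n}\ge\mu_{r_n+1}$ (with $\mu_{r_n+1}=0$ if $n$ is odd). For $\lambda\in\mathbb J_n$ let $$\dim_{n}\lambda=\prod_{1\le i<j\le r_n}\frac{l_i^2-l_j^2}{m_i^2-m_j^2}\prod_{i=1}^{r_n}\frac{l_i}{m_i},\quad l_i=\tilde\lambda_i+1,\ m_i=r_n-i+1\qquad(n\text{ even}),$$ $$\dim_{n}\lambda=\prod_{1\le i<j\le r_n}\frac{l_i^2-l_j^2}{m_i^2-m_j^2},\quad l_i=\tilde\lambda_i+\tfrac12,\ m_i=r_n-i+\tfrac12\qquad(n\text{ odd}).$$ For $n=2r$ let $\chi^\lambda_{2r}$ be the irreducible character of the compact group $Sp(2r)$ with highest weight $\lambda$, given at eigenvalues $z_j^{\pm1}$, $z_j=e^{i\theta_j}$, by Weyl's formula $\det[z_j^{\tilde\lambda_i+1}-z_j^{-\tilde\lambda_i-1}]/\det[z_j^{r-i+1}-z_j^{-(r-i+1)}]$,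 let $\chi^\omega=\prod_{j=1}^rE^\omega(\cos\theta_j)$, let $(\cdot,\cdot)_{2r}$ be the inner product of class functions with respect to normalized Haar measure (expressed through Weyl's integration formula), and put $$P^\omega_{2r}(\lambda)=(\chi^\omega,\chi^\lambda_{2r})_{2r}\,\dim_{2r}\lambda\quad(\lambda\in\mathbb J_{2r}),\qquad P^\omega_{2r-1}(\mu)=\sum_{\lambda\in\mathbb J_{2r},\,\lambda\succ\mu}P^\omega_{2r}(\lambda)\frac{\dim_{2r-1}\mu}{\dim_{2r}\lambda}\quad(\mu\in\mathbb J_{2r-1}).$$ Let $P^\omega$ denote a probability measure on the space of sequences $(u^1,u^2,\dots)$, $u^m\in\mathbb J_m$, such that for all $n\ge1$ and all $u$ $$P^\omega(\{t: t^1=u^1,\dots,t^n=u^n\})=1_{(u^1\prec u^2\prec\dots\prec u^n)}\frac{P_n^\omega(u^n)}{\dim_nu^n},$$ and let $\widetilde{\mathcal X}^\omega$ be the point process in $\mathbb Z_{\ge0}\times\mathbb Z_{>0}$ that is the random set $\{(\tilde u^m_k,m): m\ge1,\ 1\le k\le r_m\}$ under $P^\omega$ (the general symplectic Plancherel point process).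 **Theorem.** Call a loop admissible if it is a positively oriented, piecewise $C^1$, simple loop in $\mathbb C$ around $[-1,1]$ such that no zero of $E^\omega$ lies on it or is enclosed by it. If $\beta_1<1$, then there is an admissible loop. Whenever there is an admissible loop, the measure $P^\omega$ exists and is unique, and the correlation functions of $\widetilde{\mathcal X}^\omega$ are determinantal: for all pairwise distinct $z_1,\dots,z_k\in\mathbb Z_{\ge0}\times\mathbb Z_{>0}$, $$\mathbb P(\widetilde{\mathcal X}^\omega\supset\{z_1,\dots,z_k\})=\det[K^\omega(z_i,z_j)]_{i,j=1}^k,$$ where $$\begin{aligned}K^\omega((s,n),(t,m))={}&\frac{2^{\alpha_n+1/2}}{\pi}\frac1{2\pi i}\int_{-1}^1\oint\frac{E^\omega(x)}{E^\omega(u)}J_{s,\alpha_n}(x)J_{t,\alpha_m}(u)\frac{(1-x)^{r_n+\alpha_n}(1+x)^{1/2}}{(1-u)^{r_m}(x-u)}\,du\,dx\\&+1_{(n\ge m)}\frac{2^{\alpha_n+1/2}}{\pi}\int_{-1}^1J_{s,\alpha_n}(x)J_{t,\alpha_m}(x)(1-x)^{r_n-r_m+\alpha_n}(1+x)^{1/2}\,dx,\end{aligned}$$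 and the $u$-contour is any admissible loop. -/

import Mathlib

open MeasureTheory

noncomputable section

namespace SymplecticPlancherel

/-! ### Parameters and the function `E^ω` -/

/-- A triple `ω = (α, β, γ)`: nonincreasing summable sequences `α`, `β` of nonnegative reals with
`β ≤ 1`, and a real `γ ≥ 0`.  The first term of a sequence has index `0`. -/
structure Param where
  α : ℕ → ℝ
  β : ℕ → ℝ
  γ : ℝ
  α_antitone : Antitone α
  β_antitone : Antitone β
  α_nonneg : ∀ i, 0 ≤ α i
  β_nonneg : ∀ i, 0 ≤ β i
  β_le_one : ∀ i, β i ≤ 1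
  α_summable : Summable α
  β_summable : Summable β
  γ_nonneg : 0 ≤ γ

/-- The polynomial `x ↦ 1 + (b - b²/2)(x - 1)`; see `factor_joukowski`. -/
def factor (b : ℝ) (x : ℂ) : ℂ := 1 + ((b : ℂ) - (b : ℂ) ^ 2 / 2) * (x - 1)

/-- In the variable `x = (z + z⁻¹)/2` the polynomial `factor b` is
`(1 + (b/2)(z - 1))(1 + (b/2)(z⁻¹ - 1))`.  With `b = β i` and `b = -α i` these are the numerators
and the denominators of the product that defines `E^ω`. -/
theorem factor_joukowski (b : ℝ) (z : ℂ) (hz : z ≠ 0) :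
    factor b ((z + z⁻¹) / 2) =
      (1 + (b : ℂ) / 2 * (z - 1)) * (1 + (b : ℂ) / 2 * (z⁻¹ - 1)) := by
  unfold factor
  field_simp
  ring

/-- `E^ω(x) = e^{γ(x-1)} ∏ᵢ factor (βᵢ) x / factor (-αᵢ) x`, a meromorphic function on `ℂ`.
At a pole one denominator is `0`, and the value of this expression is then `0`; so `(E ω x)⁻¹`
is the holomorphic extension of `1 / E^ω` to the poles of `E^ω`. -/
def E (ω : Param) (x : ℂ) : ℂ :=
  Complex.exp (ω.γ * (x - 1)) * ∏' i, factor (ω.β i) x / factor (-ω.α i) x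

/-- `x` is a pole of `E^ω`. -/
def IsPole (ω : Param) (x : ℂ) : Prop := ∃ i, factor (-ω.α i) x = 0

/-- `x` is a zero of `E^ω`. -/
def IsZero (ω : Param) (x : ℂ) : Prop := ¬ IsPole ω x ∧ E ω x = 0

/-! ### Partitions, interlacing, Plancherel measures -/

/-- `r_n = ⌊(n + 1)/2⌋`. -/
def r (n : ℕ) : ℕ := (n + 1) / 2

/-- `𝕁_n`: partitions `λ_1 ≥ ⋯ ≥ λ_{r_n} ≥ 0`.  The indices are shifted to `0, …, r_n - 1`. -/
abbrev Part (n : ℕ) : Type := {l : Fin (r n) → ℕ // Antitone l}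

/-- The parts of `λ`, with parts of overflowing index set to `0`. -/
def part {n : ℕ} (l : Part n) (i : ℕ) : ℕ := if h : i < r n then l.1 ⟨i, h⟩ else 0

/-- `λ ≺ μ`: `μ_1 ≥ λ_1 ≥ μ_2 ≥ λ_2 ≥ ⋯ ≥ μ_{r_n} ≥ λ_{r_n} ≥ μ_{r_n + 1}`. -/
def Interlaces {n : ℕ} (l : Part n) (m : Part (n + 1)) : Prop :=
  ∀ i < r n, part l i ≤ part m i ∧ part m (i + 1) ≤ part l i

/-- `λ̃_i = λ_i + r_n - i` for `1 ≤ i ≤ r_n` (here with indices shifted to start at `0`). -/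
def tilde {n : ℕ} (l : Part n) (i : Fin (r n)) : ℕ := l.1 i + (r n - 1 - i)

/-- The dimension of the representation of `Sp(n)` with label `λ`: for even `n`, Weyl's formula
with `l_i = λ̃_i + 1` and `m_i = r_n - i + 1`; for odd `n`, the formula for the indecomposable
modules of the odd symplectic group, with `l_i = λ̃_i + 1/2` and `m_i = r_n - i + 1/2`. -/
def dim (n : ℕ) (l : Part n) : ℝ :=
  if Even n then
    (∏ i, ∏ j ∈ Finset.Ioi i,
      (((tilde l i : ℝ) + 1) ^ 2 - ((tilde l j : ℝ) + 1) ^ 2) /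
        (((r n : ℝ) - i) ^ 2 - ((r n : ℝ) - j) ^ 2)) *
      ∏ i : Fin (r n), ((tilde l i : ℝ) + 1) / ((r n : ℝ) - i)
  else
    ∏ i, ∏ j ∈ Finset.Ioi i,
      (((tilde l i : ℝ) + 1 / 2) ^ 2 - ((tilde l j : ℝ) + 1 / 2) ^ 2) /
        (((r n : ℝ) - i - 1 / 2) ^ 2 - ((r n : ℝ) - j - 1 / 2) ^ 2)

/-- Weyl's denominator `det[sin((r - i + 1) θ_j)]` for `Sp(2r)`, up to a constant factor. -/
def weylDenom (n : ℕ) (θ : Fin (r n) → ℝ) : ℝ :=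
  Matrix.det (Matrix.of fun i j : Fin (r n) => Real.sin (((r n : ℝ) - i) * θ j))

/-- For even `n`: the irreducible character of `Sp(n)` with highest weight `λ` at an element with
eigenvalues `e^{±iθ_1}, …, e^{±iθ_r}`, by Weyl's character formula
`det[z_j^{λ̃_i+1} - z_j^{-(λ̃_i+1)}] / det[z_j^{r-i+1} - z_j^{-(r-i+1)}]`, `z_j = e^{iθ_j}`. -/
def character (n : ℕ) (l : Part n) (θ : Fin (r n) → ℝ) : ℝ :=
  Matrix.det (Matrix.of fun i j : Fin (r n) => Real.sin (((tilde l i : ℝ) + 1) * θ j)) /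
    weylDenom n θ

/-- For even `n`: the inner product of real class functions on the compact group `Sp(n)`
with respect to normalized Haar measure, by Weyl's integration formula. -/
def charInner (n : ℕ) (f g : (Fin (r n) → ℝ) → ℝ) : ℝ :=
  (2 / Real.pi) ^ r n / (r n).factorial *
    ∫ θ in Set.Icc (0 : Fin (r n) → ℝ) (fun _ => Real.pi), f θ * g θ * weylDenom n θ ^ 2

/-- The extreme character `χ^ω` at an element with eigenvalues `e^{±iθ_j}`.
(`E^ω` takes real values on `[-1, 1]`.) -/
def extremeCharacter (n : ℕ) (ω : Param) (θ : Fin (r n) → ℝ) : ℝ :=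
  ∏ j, (E ω (Real.cos (θ j) : ℂ)).re

/-- For even `n`: the coefficient `P^ω_n(λ) = (χ^ω, χ^λ) · dim λ` in the expansion
`χ^ω = ∑_λ P^ω_n(λ) χ^λ / dim λ` of the restriction of `χ^ω` to `Sp(n)`. -/
def plancherelEven (ω : Param) (n : ℕ) (l : Part n) : ℝ :=
  charInner n (extremeCharacter n ω) (character n l) * dim n l

/-- The Plancherel measures `P^ω_n`.  For odd `n` they come from level `n + 1` by branching:
`P^ω_n(μ) = ∑_{λ ≻ μ} P^ω_{n+1}(λ) dim_n μ / dim_{n+1} λ`. -/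
def plancherel (ω : Param) (n : ℕ) (l : Part n) : ℝ :=
  if Even n then plancherelEven ω n l
  else ∑' m : {m : Part (n + 1) // Interlaces l m},
    plancherelEven ω (n + 1) m.1 * dim n l / dim (n + 1) m.1

/-! ### The Plancherel point process -/

/-- Infinite sequences `(u^1, u^2, …)` of partitions `u^m ∈ 𝕁_m`.  The level `m = 0` is a
one-point type and carries no information. -/
abbrev Seqs : Type := (m : ℕ) → Part m

/-- The cylinder set of the sequences that agree with `u` on the levels `1, …, n`. -/
def cylinder (n : ℕ) (u : Seqs) : Set Seqs := {t | ∀ m ≤ n, t m = u m}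

open Classical in
/-- The weight `1_{(u^1 ≺ u^2 ≺ ⋯ ≺ u^n)}`.  (The condition for `m = 0` is void.) -/
def weight (n : ℕ) (u : Seqs) : ℝ := if ∀ m < n, Interlaces (u m) (u (m + 1)) then 1 else 0

/-- `ℙ` is the central probability measure `P^ω` on sequences of partitions: cylinder sets have
probability `w_u P^ω_n(u^n) / dim_n u^n`. -/
structure IsPlancherelLaw (ω : Param) (ℙ : Measure Seqs) : Prop where
  isProbabilityMeasure : IsProbabilityMeasure ℙ
  cylinder_eq : ∀ n, 1 ≤ n → ∀ u : Seqs,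
    ℙ.real (cylinder n u) = weight n u * plancherel ω n (u n) / dim n (u n)

/-- The configuration `{(ũ^m_k, m) : m ≥ 1, 1 ≤ k ≤ r_m}` in `ℤ_{≥0} × ℤ_{>0}`. -/
def config (u : Seqs) : Set (ℕ × ℕ+) := {z | ∃ k : Fin (r z.2), tilde (u z.2) k = z.1}

/-- The correlation function `ρ_k(z_1, …, z_k)`: the probability that the random configuration
contains `{z_1, …, z_k}`. -/
def correlation (ℙ : Measure Seqs) {k : ℕ} (z : Fin k → ℕ × ℕ+) : ℝ :=
  (ℙ.map config).real {S | Set.range z ⊆ S}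

/-! ### Contours -/

/-- The integral of `f` along the curve `Γ : [0, 1] → ℂ`. -/
def contourIntegral (Γ : ℝ → ℂ) (f : ℂ → ℂ) : ℂ := ∫ t in (0 : ℝ)..1, f (Γ t) * deriv Γ t

/-- The winding number of `Γ` around a point `a` off the curve. -/
def winding (Γ : ℝ → ℂ) (a : ℂ) : ℂ :=
  1 / (2 * Real.pi * Complex.I) * contourIntegral Γ (fun u => 1 / (u - a))

/-- `Γ`, restricted to `[0, 1]`, is a piecewise continuously differentiable simple loop. -/
structure IsSimpleLoop (Γ : ℝ → ℂ) : Prop where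
  closed : Γ 0 = Γ 1
  injOn : Set.InjOn Γ (Set.Ico 0 1)
  piecewise : ∃ (N : ℕ) (τ : ℕ → ℝ), Monotone τ ∧ τ 0 = 0 ∧ τ N = 1 ∧
    ∀ i < N, ContDiffOn ℝ 1 Γ (Set.Icc (τ i) (τ (i + 1)))

/-- `Γ` is a positively oriented simple loop around `[-1, 1]` which neither encloses nor meets a
zero of `E^ω`.  (The points enclosed by a positively oriented simple loop are those off the loop
with winding number `1`; the points outside have winding number `0`.) -/
structure IsAdmissible (ω : Param) (Γ : ℝ → ℂ) : Prop where
  isSimpleLoop : IsSimpleLoop Γ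
  around : ∀ x ∈ Set.Icc (-1 : ℝ) 1, (x : ℂ) ∉ Γ '' Set.Icc 0 1 ∧ winding Γ x = 1
  zero_outside : ∀ a, IsZero ω a → a ∉ Γ '' Set.Icc 0 1 ∧ winding Γ a = 0

/-! ### Chebyshev polynomials and the kernel -/

/-- The Chebyshev polynomials of the third kind: `1, 2x - 1, …`. -/
def chebyshevV : ℕ → ℂ → ℂ
  | 0, _ => 1
  | 1, x => 2 * x - 1
  | k + 2, x => 2 * x * chebyshevV (k + 1) x - chebyshevV k x

/-- `α_n`, which is `1/2` for even `n` and `-1/2` for odd `n`. -/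
def expo (n : ℕ) : ℝ := if Even n then 1 / 2 else -1 / 2

/-- `J_{k,α_n}`: the Chebyshev polynomial of the second kind for even `n`, and of the third kind
for odd `n`. -/
def J (k n : ℕ) (x : ℂ) : ℂ :=
  if Even n then (Polynomial.Chebyshev.U ℂ k).eval x else chebyshevV k x

/-- The kernel `K^ω((s, n), (t, m))`, with the contour `Γ`. -/
def kernel (ω : Param) (Γ : ℝ → ℂ) (z w : ℕ × ℕ+) : ℂ :=
  let s := z.1
  let n : ℕ := z.2
  let t := w.1
  let m : ℕ := w.2
  (((2 : ℝ) ^ (expo n + 1 / 2) / Real.pi : ℝ) : ℂ) * (1 / (2 * Real.pi * Complex.I)) *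
      (∫ x in (-1 : ℝ)..1, contourIntegral Γ fun u =>
        E ω x / E ω u * J s n x * J t m u *
          (((1 - x) ^ ((r n : ℝ) + expo n) * (1 + x) ^ (1 / 2 : ℝ) : ℝ) : ℂ) /
          ((1 - u) ^ r m * (x - u))) +
    if m ≤ n then
      (((2 : ℝ) ^ (expo n + 1 / 2) / Real.pi : ℝ) : ℂ) *
        ∫ x in (-1 : ℝ)..1, J s n x * J t m x *
          (((1 - x) ^ ((r n : ℝ) - (r m : ℝ) + expo n) * (1 + x) ^ (1 / 2 : ℝ) : ℝ) : ℂ)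
    else 0

end SymplecticPlancherel

end

noncomputable section

namespace SymplecticPlancherel

/-! ### Determinants with independently summed rows -/

/-! For fixed distinct sites `z a`, the determinantal formula follows from the generating function 𝔼
∏ₐ (1 + t·1[zₐ ∈ config]) = det(1 + tK) for all t (`integral_prod_ite`): with s = 1/t it reads 𝔼 ∏ₐ
(s + 1[zₐ ∈ config]) = det(s + K), and s → 0 gives the correlation (`correlation_eq_det`). The
expectation is computed exactly by summing over the levels from an even top level N down to level 0.

At an even level n, P_n/dim_n is a determinant of Chebyshev coefficients of the functions
(2(x-1))^(r-1-j) E(x), by Weyl's formulas, Andréief's identity and a triangular change of columns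
(`charInner_eq_det`, `det_coef_mul_J_eq`). In the coordinates `tilde`, interlacing confines each
particle to an interval of its own, so a sum over level n + 1 acts on the rows of the determinant:
up to row operations each row becomes a tail sum (`hasSum_det_intervals`). Differences of Chebyshev
polynomials of one kind are polynomials of the other kind, so the tail sums telescope to
coefficients at level n, of the same function f if n is odd and of Q f = (f - f(1))/(2(x-1)) if n is
even. In the even case one particle disappears; it leaves the row of values f(1), which stays in the
determinant as a virtual row (`hasSum_geDet`).

A weight 1 + t at a site multiplies one possible row by 1 + t. By orthogonality this is the same as
adding to f_j the term t·B_{aj}·J_{zₐ}, where B_{aj} is the coefficient of f_j at that site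
(`coef_geFun`). The numbers B solve a linear system which is triangular with respect to the levels.
At level 0 only virtual rows remain, and their entries are Taylor coefficients at 1. The unperturbed
matrix is unitriangular because E(1) = 1, and multiplying by its inverse amounts to dividing by E.
Sylvester's identity then reduces the determinant to one indexed by the sites, with matrix 1 + tK,
where K is `coefKernel` (`exists_compatible_det_virtualRow`).

The contour enters last: for F = J/E, the integral of F(u)/((1-u)^m (x-u)) is a constant multiple of
Q^m F(x), since the Taylor polynomial at 1 contributes no residue (`contourIntegral_siteQuot`). Thus
the stated kernel is `coefKernel` conjugated by powers of -2. Only winding numbers, partial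
fractions and primitives on disks are used, so neither the Jordan curve theorem nor a homotopy is
needed.

For existence, the same summation without sites shows that the weights are coherent
(`hasSum_pathProb`). They are nonnegative because multiplication by each factor of E, or by the
inverse of a denominator, acts on coefficients through bidiagonal operators or their inverses, which
preserve nonnegative determinants (`coefDetNonneg_E`). So the levels form a Markov chain, and the
Ionescu-Tulcea theorem gives the law. -/

theorem hasSum_of_eq {ι : Type*} {f g : ι → ℂ} {a : ℂ} (hf : HasSum f a) (h : ∀ x, g x = f x) :
    HasSum g a := by
  rwa [funext h]

theorem hasSum_pi_prod {n : ℕ} (a : Fin n → ℕ → ℂ) (s : Fin n → ℂ)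
    (h : ∀ i, HasSum (a i) (s i)) (hs : ∀ i, Summable fun y => ‖a i y‖) :
    HasSum (fun y : Fin n → ℕ => ∏ i, a i (y i)) (∏ i, s i) ∧
      Summable fun y : Fin n → ℕ => ‖∏ i, a i (y i)‖ := by
  induction n with
  | zero => exact ⟨by simp, (hasSum_fintype _).summable⟩
  | succ n ih =>
    obtain ⟨h1, h2⟩ := ih (fun i => a i.succ) (fun i => s i.succ) (fun i => h _) (fun i => hs _)
    set g : (Fin n → ℕ) → ℂ := fun y => ∏ i : Fin n, a i.succ (y i)
    have hsum : Summable fun x : ℕ × (Fin n → ℕ) => ‖a 0 x.1 * g x.2‖ := (hs 0).mul_norm h2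
    have key : HasSum (fun x : ℕ × (Fin n → ℕ) => a 0 x.1 * g x.2) (s 0 * ∏ i : Fin n, s i.succ) :=
      HasSum.mul (h 0) h1 hsum.of_norm
    have hg : ∀ x : ℕ × (Fin n → ℕ), ∏ i, a i (Fin.consEquiv (fun _ => ℕ) x i) =
        a 0 x.1 * g x.2 := fun x => by simp [Fin.prod_univ_succ, g]
    rw [← (Fin.consEquiv fun _ => ℕ).hasSum_iff, ← (Fin.consEquiv fun _ => ℕ).summable_iff,
      Fin.prod_univ_succ]
    exact ⟨hasSum_of_eq key hg, (summable_congr fun x => by rw [Function.comp, hg]).2 hsum⟩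

/-- The matrix whose first rows are given by `a` and whose remaining rows are those of `w`. -/
def rowsMatrix {R m : ℕ} (a : Fin m → Fin R → ℂ) (w : Fin R → Fin R → ℂ) :
    Matrix (Fin R) (Fin R) ℂ :=
  Matrix.of fun i j => if h : (i : ℕ) < m then a ⟨i, h⟩ j else w i j

theorem prod_rows {R m : ℕ} (hm : m ≤ R) (f : Fin m → ℂ) (g : Fin R → ℂ) :
    ∏ i : Fin R, (if h : (i : ℕ) < m then f ⟨i, h⟩ else g i) =
      (∏ i, f i) * ∏ i : Fin R, if (i : ℕ) < m then 1 else g i := by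
  obtain ⟨d, rfl⟩ := Nat.exists_eq_add_of_le hm
  simp [Fin.prod_univ_add]

/-- Each Leibniz term contains exactly one factor from every row, so it is a product of summable
functions of separate variables. -/
theorem hasSum_det_rowsMatrix {R m : ℕ} (hm : m ≤ R) (a : Fin m → ℕ → Fin R → ℂ)
    (s : Fin m → Fin R → ℂ) (w : Fin R → Fin R → ℂ)
    (h : ∀ i j, HasSum (fun y => a i y j) (s i j)) (hs : ∀ i j, Summable fun y => ‖a i y j‖) :
    HasSum (fun y : Fin m → ℕ => (rowsMatrix (fun i => a i (y i)) w).det)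
      (rowsMatrix s w).det := by
  have key : ∀ b : Fin m → Fin R → ℂ, (rowsMatrix b w).det =
      ∑ σ : Equiv.Perm (Fin R), (Equiv.Perm.sign σ : ℂ) * ((∏ i : Fin m,
        b i (σ ⟨i, i.2.trans_le hm⟩)) * ∏ i : Fin R, if (i : ℕ) < m then 1 else w i (σ i)) := by
    intro b
    rw [← Matrix.det_transpose, Matrix.det_apply']
    refine Finset.sum_congr rfl fun σ _ => ?_
    rw [← prod_rows hm (fun i => b i (σ ⟨i, i.2.trans_le hm⟩)) (fun i => w i (σ i))]
    rfl
  simp only [key]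
  refine hasSum_sum fun σ _ => HasSum.mul_left _ (HasSum.mul_right _ ?_)
  exact (hasSum_pi_prod (fun i y => a i y (σ ⟨i, i.2.trans_le hm⟩)) _ (fun i => h _ _)
    (fun i => hs _ _)).1

theorem hasSum_ite_le {f : ℕ → ℂ} (hf : Summable f) (b : ℕ) :
    HasSum (fun y => if b ≤ y then f y else 0) (∑' y, f (b + y)) := by
  rw [← (add_right_injective b).hasSum_iff]
  · simp only [Function.comp_def, le_add_iff_nonneg_right, zero_le, if_true]
    exact (hf.comp_injective (add_right_injective b)).hasSum
  · intro y hy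
    rw [if_neg]
    exact fun hle => hy ⟨y - b, by simp; omega⟩

/-- A sum over an interval is a difference of two tail sums, and the subtracted tail is the tail
that belongs to the preceding row; row operations therefore leave pure tails. -/
theorem det_rowsMatrix_sub_pred {R m : ℕ} (A : ℕ → Fin R → ℂ) (w : Fin R → Fin R → ℂ) :
    (rowsMatrix (fun i : Fin m => if (i : ℕ) = 0 then A 0 else A i - A (i - 1)) w).det =
      (rowsMatrix (fun i : Fin m => A i) w).det := by
  rcases R with _ | R
  · simp
  symm
  refine Matrix.det_eq_of_forall_row_eq_smul_add_pred
    (fun i => if (i : ℕ) + 1 < m then 1 else 0) ?_ ?_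
  · intro j
    simp [rowsMatrix]
    rfl
  · intro i j
    simp only [rowsMatrix, Matrix.of_apply, Fin.val_succ, Fin.val_castSucc]
    by_cases h : (i : ℕ) + 1 < m
    · simp [h, Nat.lt_of_succ_lt h]
    · simp [h]

/-- Summation of a determinant over `y` with `b i ≤ y i` and `y (i + 1) < b i`. -/
theorem hasSum_det_intervals {R m : ℕ} (hm : m ≤ R) (h : ℕ → Fin R → ℂ)
    (hs : ∀ j, Summable fun y => ‖h y j‖) (b : ℕ → ℕ) (hb : Antitone b)
    (w : Fin R → Fin R → ℂ) :
    HasSum (fun y : Fin m → ℕ =>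
        if ∀ i : Fin m, b i ≤ y i ∧ ((i : ℕ) = 0 ∨ y i < b (i - 1)) then
          (rowsMatrix (fun i => h (y i)) w).det else 0)
      (rowsMatrix (fun i : Fin m => fun j => ∑' y, h (b i + y) j) w).det := by
  -- The constraints concern one coordinate each, so the joint indicator can be moved into the rows:
  -- if it fails for some coordinate, that row is zero.
  have key := hasSum_det_rowsMatrix hm
    (fun i y j => if b i ≤ y ∧ ((i : ℕ) = 0 ∨ y < b (i - 1)) then h y j else 0)
    (fun i => if (i : ℕ) = 0 then fun j => ∑' y, h (b 0 + y) j else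
      (fun j => ∑' y, h (b i + y) j) - (fun j => ∑' y, h (b (i - 1) + y) j)) w ?_ ?_
  · rw [det_rowsMatrix_sub_pred (fun i j => ∑' y, h (b i + y) j)] at key
    convert key using 2 with y
    split_ifs with hc
    · congr 2
      ext i j
      simp [hc i]
    · symm
      push Not at hc
      obtain ⟨i, hi⟩ := hc
      refine Matrix.det_eq_zero_of_row_eq_zero ⟨i, i.2.trans_le hm⟩ fun j => ?_
      simp only [rowsMatrix, Matrix.of_apply, Fin.is_lt, dite_true]
      rw [if_neg]
      rintro ⟨h1, h2⟩
      have := hi h1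
      simp only [Fin.eta] at h2
      omega
  · intro i j
    have hsj := (hs j).of_norm
    by_cases hi : (i : ℕ) = 0
    · simpa [hi] using hasSum_ite_le hsj (b 0)
    · simp only [hi, if_false, false_or, Pi.sub_apply]
      have h2 := (hasSum_ite_le hsj (b i)).sub (hasSum_ite_le hsj (b (i - 1)))
      have hle : b i ≤ b (i - 1) := hb (Nat.sub_le _ _)
      refine hasSum_of_eq h2 fun y => ?_
      split_ifs with h1 h2 h3 h4 h5 <;> first | omega | simp
  · intro i j
    refine Summable.of_nonneg_of_le (fun _ => norm_nonneg _) (fun y => ?_) (hs j)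
    split_ifs <;> simp

/-! ### Sums over interlacing partitions -/

/-- The lower ends of the intervals in which the coordinates `tilde m i` of the partitions `m`
with `Interlaces l m` vary. -/
def lowerEnd {n : ℕ} (l : Part n) (i : ℕ) : ℕ := part l i + (r (n + 1) - 1 - i)

theorem part_antitone {n : ℕ} (l : Part n) : Antitone (part l) := by
  intro i j hij
  unfold part
  split_ifs with h1 h2
  · exact l.2 (by simpa using hij)
  · omega
  · exact Nat.zero_le _
  · exact le_rfl

theorem lowerEnd_antitone {n : ℕ} (l : Part n) : Antitone (lowerEnd l) := fun i j hij =>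
  add_le_add (part_antitone l hij) (by omega)

theorem part_val {n : ℕ} (l : Part n) (i : Fin (r n)) : part l i = l.1 i := by
  simp [part]

theorem r_le_r_succ (n : ℕ) : r n ≤ r (n + 1) ∧ r (n + 1) ≤ r n + 1 := by
  unfold r; omega

theorem tilde_injective (n : ℕ) : Function.Injective (tilde (n := n)) := by
  intro l m h
  apply Subtype.ext
  funext i
  have := congrFun h i
  simp only [tilde] at this
  omega

theorem tilde_strictAnti {n : ℕ} (l : Part n) : StrictAnti (tilde l) := by
  intro i j hij
  have h1 := l.2 hij.le
  have : (i : ℕ) < j := hij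
  have := j.2
  simp only [tilde]
  omega

/-- The shift by `r (n + 1) - 1 - i` turns weak interlacing into membership in pairwise disjoint
intervals. For even `n` there is one more coordinate, whose lower end is 0. -/
theorem interlaces_iff {n : ℕ} (l : Part n) (m : Part (n + 1)) :
    Interlaces l m ↔ ∀ i : Fin (r (n + 1)), lowerEnd l i ≤ tilde m i ∧
      ((i : ℕ) = 0 ∨ tilde m i < lowerEnd l (i - 1)) := by
  have hr := r_le_r_succ n
  constructor
  · intro h i
    have hi := i.2
    simp only [lowerEnd, tilde, ← part_val]
    constructor
    · by_cases h1 : (i : ℕ) < r n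
      · have := (h i h1).1; omega
      · simp [part, h1]
    · by_cases h0 : (i : ℕ) = 0
      · exact Or.inl h0
      · right
        have := (h (i - 1) (by omega)).2
        rw [Nat.sub_add_cancel (by omega)] at this
        omega
  · intro h i hi
    have h1 := (h ⟨i, by omega⟩).1
    simp only [lowerEnd, tilde, ← part_val] at h1
    refine ⟨by omega, ?_⟩
    by_cases h2 : i + 1 < r (n + 1)
    · have h3 := (h ⟨i + 1, h2⟩).2
      simp only [lowerEnd, tilde, ← part_val] at h3
      simp at h3
      omega
    · simp [part, h2]

theorem exists_tilde_eq {n : ℕ} (y : Fin (r n) → ℕ) (hy : StrictAnti y) :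
    ∃ l : Part n, tilde l = y := by
  -- This makes the truncated subtraction in the definition of the partition a true one.
  have hlow : ∀ d (i : Fin (r n)), r n - 1 - i = d → d ≤ y i := by
    intro d
    induction d with
    | zero => intro i _; exact Nat.zero_le _
    | succ d ih =>
      intro i hi
      have hi2 : (i : ℕ) + 1 < r n := by omega
      have h1 := ih ⟨i + 1, hi2⟩ (by simp; omega)
      have h2 : y ⟨i + 1, hi2⟩ < y i := hy (by simp [Fin.lt_def])
      omega
  have hgap : ∀ d (i j : Fin (r n)), (j : ℕ) = i + d → y j + d ≤ y i := by
    intro d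
    induction d with
    | zero => intro i j h; have : i = j := Fin.ext (by omega); simp [this]
    | succ d ih =>
      intro i j h
      have hj := j.2
      have h1 := ih i ⟨i + d, by omega⟩ rfl
      have h2 : y j < y ⟨i + d, by omega⟩ := hy (by simp [Fin.lt_def]; omega)
      omega
  refine ⟨⟨fun i => y i - (r n - 1 - i), ?_⟩, ?_⟩
  · intro i j hij
    have hij' : (i : ℕ) ≤ j := hij
    have := hgap (j - i) i j (by omega)
    have := hlow _ j rfl
    have := j.2
    simp only
    omega
  · funext i
    have := hlow _ i rfl
    simp only [tilde]
    omega

/-- Points satisfying the interval constraints are automatically strictly decreasing, hence come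
from partitions; so no ordering condition is needed on the right. -/
theorem hasSum_interlaces_iff {n : ℕ} (l : Part n) (f : (Fin (r (n + 1)) → ℕ) → ℂ) (a : ℂ) :
    HasSum (fun m : {m : Part (n + 1) // Interlaces l m} => f (tilde m.1)) a ↔
      HasSum (fun y : Fin (r (n + 1)) → ℕ =>
        if ∀ i : Fin (r (n + 1)), lowerEnd l i ≤ y i ∧ ((i : ℕ) = 0 ∨ y i < lowerEnd l (i - 1))
        then f y else 0) a := by
  have hinj : Function.Injective
      (fun m : {m : Part (n + 1) // Interlaces l m} => tilde m.1) :=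
    (tilde_injective _).comp Subtype.val_injective
  rw [← hinj.hasSum_iff]
  · refine iff_of_eq (congrArg (fun g => HasSum g a) ?_)
    funext m
    have := (interlaces_iff l m.1).1 m.2
    simp only [Function.comp]
    rw [if_pos this]
  · intro y hy
    rw [if_neg]
    intro hc
    apply hy
    have hanti : StrictAnti y := by
      have hmono := lowerEnd_antitone l
      intro i j hij
      have hij' : (i : ℕ) < j := hij
      have h1 := (hc i).1
      have h2 := (hc j).2
      have h3 : lowerEnd l (j - 1) ≤ lowerEnd l i := hmono (by omega)
      omega
    obtain ⟨m, rfl⟩ := exists_tilde_eq y hanti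
    exact ⟨⟨m, (interlaces_iff l m).2 hc⟩, rfl⟩

theorem hasSum_det_interlaces {n R : ℕ} (hR : r (n + 1) ≤ R) (l : Part n) (h : ℕ → Fin R → ℂ)
    (hs : ∀ j, Summable fun y => ‖h y j‖) (w : Fin R → Fin R → ℂ) :
    HasSum (fun m : {m : Part (n + 1) // Interlaces l m} =>
        (rowsMatrix (fun i => h (tilde m.1 i)) w).det)
      (rowsMatrix (fun i : Fin (r (n + 1)) => fun j => ∑' y, h (lowerEnd l i + y) j) w).det :=
  (hasSum_interlaces_iff l (fun y => (rowsMatrix (fun i => h (y i)) w).det) _).2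
    (hasSum_det_intervals hR h hs _ (lowerEnd_antitone l) w)

/-! ### A perturbation formula for determinants -/

/-- Sylvester's identity det(1 + XY) = det(1 + YX) passes from size `R` to size `k`. By `hB`, `B'`
is `(1 - tW)⁻¹ B`, and multiplication by the unimodular `1 - tW` removes the inverse. -/
theorem det_add_smul_mul {R k : ℕ} (G : Matrix (Fin R) (Fin R) ℂ) (A q : Matrix (Fin R) (Fin k) ℂ)
    (B B' : Matrix (Fin k) (Fin R) ℂ) (W : Matrix (Fin k) (Fin k) ℂ) (t : ℂ)
    (hB : B' = B + t • (W * B')) (hq : G * q = A) (hW : (1 - t • W).det = 1) :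
    (G + t • (A * B')).det = G.det * (1 + t • (B * q - W)).det := by
  have h1 : G + t • (A * B') = G * (1 + (t • q) * B') := by
    rw [Matrix.mul_add, Matrix.mul_one, ← Matrix.mul_assoc, Matrix.mul_smul, hq, Matrix.smul_mul]
  have h2 : (1 - t • W) * (1 + B' * (t • q)) = 1 + t • (B * q - W) := by
    have h3 : (1 - t • W) * B' = B := by
      rw [Matrix.sub_mul, Matrix.one_mul, Matrix.smul_mul]
      exact sub_eq_of_eq_add hB
    rw [Matrix.mul_add, ← Matrix.mul_assoc, h3, Matrix.mul_one, Matrix.mul_smul, smul_sub]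
    abel
  rw [h1, Matrix.det_mul, Matrix.det_one_add_mul_comm, ← h2, Matrix.det_mul, hW, one_mul]

/-- `1 - tW` is unimodular if `W` strictly raises a grading. -/
theorem det_one_sub_smul_eq_one {k : ℕ} (W : Matrix (Fin k) (Fin k) ℂ) (lev : Fin k → ℕ)
    (hW : ∀ a b, ¬ lev a < lev b → W a b = 0) (t : ℂ) : (1 - t • W).det = 1 := by
  have hbt : (1 - t • W).BlockTriangular lev := by
    intro a b hab
    have hne : a ≠ b := fun h => by simp [h] at hab
    simp [Matrix.one_apply_ne hne, hW a b (by omega)]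
  rw [hbt.det]
  refine Finset.prod_eq_one fun c _ => ?_
  have : (1 - t • W).toSquareBlock lev c = 1 := by
    ext a b
    have h0 := hW a.1 b.1 (by rw [a.2, b.2]; exact lt_irrefl _)
    simp [Matrix.toSquareBlock, Matrix.toSquareBlockProp, h0, Matrix.one_apply, Subtype.ext_iff]
  rw [this, Matrix.det_one]

end SymplecticPlancherel

end

noncomputable section

namespace SymplecticPlancherel

open scoped ComplexOrder

/-! ### Sequences of vectors with nonnegative determinants -/

/-- All determinants `det[a (x i) j]` with `x` strictly decreasing are nonnegative. -/
def DetNonneg {m : ℕ} (a : ℕ → Fin m → ℂ) : Prop :=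
  ∀ x : Fin m → ℕ, StrictAnti x → 0 ≤ (Matrix.of fun i j => a (x i) j).det

/-- Expand multilinearly in the rows. By `hI` every choice of indices is weakly decreasing; a choice
with a repetition gives two equal rows, and the others are covered by `ha`. -/
theorem DetNonneg.sum {m : ℕ} {a : ℕ → Fin m → ℂ} (ha : DetNonneg a) (I : Fin m → Finset ℕ)
    (c : Fin m → ℕ → ℂ) (hc : ∀ i, ∀ y ∈ I i, 0 ≤ c i y)
    (hI : ∀ i j, i < j → ∀ y ∈ I i, ∀ y' ∈ I j, y' ≤ y) :
    0 ≤ (Matrix.of fun i j => ∑ y ∈ I i, c i y * a y j).det := by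
  have h1 : (Matrix.of fun i j => ∑ y ∈ I i, c i y * a y j).det =
      Matrix.detRowAlternating.toMultilinearMap (fun i => ∑ y ∈ I i, c i y • a y) := by
    change Matrix.detRowAlternating _ = _
    refine congrArg Matrix.detRowAlternating ?_
    ext i j
    simp
  rw [h1, MultilinearMap.map_sum_finset]
  refine Finset.sum_nonneg fun y hy => ?_
  rw [Fintype.mem_piFinset] at hy
  rw [MultilinearMap.map_smul_univ]
  refine mul_nonneg (Finset.prod_nonneg fun i _ => hc i _ (hy i)) ?_
  by_cases hinj : Function.Injective y
  · refine ha y fun i j hij => lt_of_le_of_ne (hI i j hij _ (hy i) _ (hy j)) ?_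
    exact fun h => hij.ne (hinj h.symm)
  · obtain ⟨i, j, hij, hne⟩ := Function.not_injective_iff.1 hinj
    refine ge_of_eq ?_
    exact Matrix.det_zero_of_row_eq hne (congrArg a hij)

theorem DetNonneg.add_succ {m : ℕ} {a : ℕ → Fin m → ℂ} (ha : DetNonneg a) {p q : ℂ}
    (hp : 0 ≤ p) (hq : 0 ≤ q) : DetNonneg fun k j => p * a k j + q * a (k + 1) j := by
  intro x hx
  have := ha.sum (fun i => {x i, x i + 1}) (fun i y => if y = x i then p else q)
    (fun i y _ => by split_ifs <;> assumption) ?_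
  · simpa using this
  · intro i j hij y hy y' hy'
    have := hx hij
    simp only [Finset.mem_insert, Finset.mem_singleton] at hy hy'
    omega

theorem DetNonneg.add_pred {m : ℕ} {a : ℕ → Fin m → ℂ} (ha : DetNonneg a) {p q : ℂ}
    (hp : 0 ≤ p) (hq : 0 ≤ q) :
    DetNonneg fun k j => p * a k j + if k = 0 then 0 else q * a (k - 1) j := by
  intro x hx
  have := ha.sum (fun i => Finset.Icc (x i - 1) (x i)) (fun i y => if y = x i then p else q)
    (fun i y _ => by split_ifs <;> assumption) ?_
  · convert this using 4 with i
    funext j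
    rcases x i with _ | k
    · simp
    · have : Finset.Icc (k + 1 - 1) (k + 1) = {k + 1, k} := by
        ext; simp only [Finset.mem_Icc, Finset.mem_insert, Finset.mem_singleton]; omega
      rw [this, Finset.sum_pair (by omega)]
      simp
  · intro i j hij y hy y' hy'
    have := hx hij
    simp only [Finset.mem_Icc] at hy hy'
    omega

theorem det_eq_of_forall_row_eq_smul_add_succ {n : ℕ} {A B : Matrix (Fin (n + 1)) (Fin (n + 1)) ℂ}
    (c : Fin n → ℂ) (hlast : ∀ j, A (Fin.last n) j = B (Fin.last n) j)
    (h : ∀ (i : Fin n) j, A i.castSucc j = B i.castSucc j + c i * A i.succ j) :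
    A.det = B.det := by
  rw [← Matrix.det_submatrix_equiv_self Fin.revPerm A, ← Matrix.det_submatrix_equiv_self Fin.revPerm B]
  refine Matrix.det_eq_of_forall_row_eq_smul_add_pred (fun i => c i.rev) ?_ ?_
  · intro j
    simpa using hlast j.rev
  · intro i j
    simpa [Fin.rev_succ, Fin.rev_castSucc] using h i.rev j.rev

/-- Solutions `c` of `c k = w * a k + ρ * c (k + 1)`. -/
theorem DetNonneg.solve_succ {m : ℕ} {a c : ℕ → Fin m → ℂ} (ha : DetNonneg a) {w ρ : ℝ}
    (hw : 0 ≤ w) (hρ : 0 ≤ ρ) (hρ1 : ρ < 1) (hc : ∀ k j, c k j = w * a k j + ρ * c (k + 1) j)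
    {M : ℝ} (hM : ∀ k j, ‖c k j‖ ≤ M) : DetNonneg c := by
  have hwc : (0 : ℂ) ≤ w := by exact_mod_cast hw
  have hρc : (0 : ℂ) ≤ ρ := by exact_mod_cast hρ
  have iter : ∀ d k j, c k j = ∑ y ∈ Finset.Ico k (k + d), (ρ ^ (y - k) * w : ℂ) * a y j +
      ρ ^ d * c (k + d) j := by
    intro d
    induction d with
    | zero => intro k j; simp
    | succ d ih =>
      intro k j
      rw [ih k j, hc (k + d) j, ← add_assoc k d 1, Finset.sum_Ico_succ_top (by omega)]
      simp only [add_tsub_cancel_left]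
      ring
  intro x hx
  rcases m with _ | m
  · simp
  -- Unrolling the recursion in row `i` from `x i` up to `x (i - 1)` leaves a multiple of the
  -- preceding row, which a row operation removes. The first row has no predecessor; it is cut off
  -- after `d` steps, and its remainder tends to 0 because ρ < 1 and `c` is bounded.
  set B : ℕ → Matrix (Fin (m + 1)) (Fin (m + 1)) ℂ := fun d => Matrix.of fun i j =>
    ∑ y ∈ Finset.Ico (x i) (if h : (i : ℕ) = 0 then x 0 + d else x ⟨i - 1, by omega⟩),
      (ρ ^ (y - x i) * w : ℂ) * a y j with hB
  have hpos : ∀ d, 0 ≤ (B d).det := by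
    intro d
    refine ha.sum _ (fun i y => (ρ ^ (y - x i) * w : ℂ))
      (fun i y _ => mul_nonneg (pow_nonneg hρc _) hwc) ?_
    intro i j hij y hy y' hy'
    have hij' : (i : ℕ) < j := hij
    rw [dif_neg (by omega)] at hy'
    have : x ⟨j - 1, by omega⟩ ≤ x i := hx.antitone (by rw [Fin.le_def]; simp; omega)
    simp only [Finset.mem_Ico] at hy hy'
    omega
  have hlim : Filter.Tendsto (fun d => (B d).det) Filter.atTop
      (nhds (Matrix.of fun i j => c (x i) j).det) := by
    -- Below the first row `B d` does not depend on `d`, so `B 0` supplies these rows.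
    have hA : (Matrix.of fun i j => c (x i) j).det =
        (Matrix.of fun (i : Fin (m + 1)) j => if i = 0 then c (x 0) j else B 0 i j).det := by
      refine Matrix.det_eq_of_forall_row_eq_smul_add_pred
        (fun i => (ρ : ℂ) ^ (x i.castSucc - x i.succ)) (by simp) ?_
      intro i j
      have hlt : x i.succ < x i.castSucc := hx (Fin.castSucc_lt_succ)
      have := iter (x i.castSucc - x i.succ) (x i.succ) j
      rw [Nat.add_sub_cancel' hlt.le] at this
      simp only [Matrix.of_apply, Fin.succ_ne_zero, if_false, hB, Fin.val_succ]
      rw [dif_neg (by omega)]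
      exact this
    rw [hA]
    refine ((continuous_id.matrix_det).tendsto _).comp ?_
    refine tendsto_pi_nhds.2 fun i => tendsto_pi_nhds.2 fun j => ?_
    by_cases hi : i = 0
    · subst hi
      simp only [Matrix.of_apply, if_true, hB]
      have h0 : Filter.Tendsto (fun d : ℕ => (ρ : ℂ) ^ d * c (x 0 + d) j) Filter.atTop (nhds 0) := by
        refine squeeze_zero_norm (a := fun d => ρ ^ d * M) (fun d => ?_) ?_
        · rw [norm_mul, norm_pow, Complex.norm_of_nonneg hρ]
          exact mul_le_mul_of_nonneg_left (hM _ _) (pow_nonneg hρ _)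
        · simpa using (tendsto_pow_atTop_nhds_zero_of_lt_one hρ hρ1).mul_const M
      have h1 := h0.const_sub (c (x 0) j)
      rw [sub_zero] at h1
      refine h1.congr fun d => ?_
      rw [iter d (x 0) j]
      simp
    · have hi' : (i : ℕ) ≠ 0 := fun h => hi (Fin.ext h)
      simp only [Matrix.of_apply, hi, if_false, hB]
      rw [dif_neg hi']
      refine tendsto_const_nhds.congr fun d => ?_
      rw [dif_neg hi']
  exact ge_of_tendsto' hlim hpos

/-- Solutions `b` of `b k = w * a k + ρ * b (k - 1)`, where `b (-1) = 0`. -/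
theorem DetNonneg.solve_pred {m : ℕ} {a b : ℕ → Fin m → ℂ} (ha : DetNonneg a) {w ρ : ℝ}
    (hw : 0 ≤ w) (hρ : 0 ≤ ρ) (h0 : ∀ j, b 0 j = w * a 0 j)
    (hb : ∀ k j, b (k + 1) j = w * a (k + 1) j + ρ * b k j) : DetNonneg b := by
  have hwc : (0 : ℂ) ≤ w := by exact_mod_cast hw
  have hρc : (0 : ℂ) ≤ ρ := by exact_mod_cast hρ
  have iter : ∀ d k j, b (k + d) j = ∑ y ∈ Finset.Ico (k + 1) (k + d + 1),
      (ρ ^ (k + d - y) * w : ℂ) * a y j + ρ ^ d * b k j := by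
    intro d
    induction d with
    | zero => intro k j; simp
    | succ d ih =>
      intro k j
      rw [← add_assoc, hb, ih, Finset.sum_Ico_succ_top (b := k + d + 1) (by omega), mul_add,
        Finset.mul_sum]
      have : ∀ y ∈ Finset.Ico (k + 1) (k + d + 1), (ρ : ℂ) * (ρ ^ (k + d - y) * w * a y j) =
          ρ ^ (k + d + 1 - y) * w * a y j := by
        intro y hy
        rw [Finset.mem_Ico] at hy
        rw [show k + d + 1 - y = (k + d - y) + 1 by omega]
        ring
      rw [Finset.sum_congr rfl this]
      simp only [tsub_self]
      ring
  have iter0 : ∀ k j, b k j = ∑ y ∈ Finset.Ico 0 (k + 1), (ρ ^ (k - y) * w : ℂ) * a y j := by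
    intro k j
    have := iter k 0 j
    rw [Finset.sum_eq_sum_Ico_succ_bot (by omega)]
    simp only [zero_add] at this ⊢
    rw [this, h0]
    simp
    ring
  intro x hx
  rcases m with _ | m
  · simp
  -- The mirror image of the construction for `solve_succ`: row `i` is unrolled down to `x (i + 1)`.
  -- The last row reaches 0, where the recursion stops, so no limit is needed.
  set B : Matrix (Fin (m + 1)) (Fin (m + 1)) ℂ := Matrix.of fun i j =>
    ∑ y ∈ Finset.Ico (if h : (i : ℕ) = m then 0 else x ⟨i + 1, by omega⟩ + 1) (x i + 1),
      (ρ ^ (x i - y) * w : ℂ) * a y j with hB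
  have hpos : 0 ≤ B.det := by
    refine ha.sum _ (fun i y => (ρ ^ (x i - y) * w : ℂ))
      (fun i y _ => mul_nonneg (pow_nonneg hρc _) hwc) ?_
    intro i j hij y hy y' hy'
    have hij' : (i : ℕ) < j := hij
    have := j.2
    rw [dif_neg (by omega)] at hy
    have : x j ≤ x ⟨i + 1, by omega⟩ := hx.antitone (by rw [Fin.le_def]; simp; omega)
    simp only [Finset.mem_Ico] at hy hy'
    omega
  rwa [det_eq_of_forall_row_eq_smul_add_succ (B := B)
    (fun i => (ρ : ℂ) ^ (x i.castSucc - x i.succ))]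
  · intro j
    simpa [hB] using iter0 (x (Fin.last m)) j
  · intro i j
    have hlt : x i.succ < x i.castSucc := hx (Fin.castSucc_lt_succ)
    have := iter (x i.castSucc - x i.succ) (x i.succ) j
    rw [Nat.add_sub_cancel' hlt.le] at this
    simp only [Matrix.of_apply, hB, Fin.val_castSucc]
    rw [dif_neg (by omega)]
    exact this

end SymplecticPlancherel

end

noncomputable section

namespace SymplecticPlancherel

open Polynomial.Chebyshev (integral_measureT intervalIntegrable_sqrt_one_sub_sq_inv)

/-! ### The Chebyshev polynomials -/

theorem J_zero (n : ℕ) (x : ℂ) : J 0 n x = 1 := by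
  unfold J; split_ifs <;> simp [chebyshevV]

theorem J_one (n : ℕ) (x : ℂ) : J 1 n x = 2 * x - if Even n then 0 else 1 := by
  unfold J; split_ifs <;> simp [chebyshevV]

theorem J_add_two (k n : ℕ) (x : ℂ) : J (k + 2) n x = 2 * x * J (k + 1) n x - J k n x := by
  unfold J
  split_ifs
  · push_cast
    rw [Polynomial.Chebyshev.U_add_two]
    simp
  · rfl

theorem J_differentiable (k n : ℕ) : Differentiable ℂ (J k n) := by
  induction k using Nat.twoStepInduction with
  | zero =>
    rw [show J 0 n = fun _ => 1 from funext fun x => J_zero n x]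
    fun_prop
  | one =>
    rw [show J 1 n = fun x => 2 * x - if Even n then 0 else 1 from funext fun x => J_one n x]
    fun_prop
  | more k h0 h1 =>
    rw [show J (k + 2) n = fun x => 2 * x * J (k + 1) n x - J k n x from
      funext fun x => J_add_two k n x]
    fun_prop

theorem J_congr {k n n' : ℕ} (h : Even n ↔ Even n') : J k n = J k n' := by
  funext x; simp [J, h]

/-- With x = cos θ the two kinds are sin((k+1)θ)/sin θ and cos((k+1/2)θ)/cos(θ/2), so this is the
difference of two cosines. Together with `J_even_sub` it makes all tail sums telescope. -/
theorem J_odd_sub (k : ℕ) (x : ℂ) : J k 1 x - J (k + 1) 1 x = 2 * (1 - x) * J k 0 x := by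
  induction k using Nat.twoStepInduction with
  | zero => simp [J_zero, J_one]; ring
  | one => rw [J_add_two, J_zero]; simp [J_one]; ring
  | more k h0 h1 =>
    rw [J_add_two k 0, J_add_two (k + 1) 1, J_add_two k 1]
    rw [J_add_two k 1] at h1
    linear_combination (2 * x) * h1 - h0

theorem J_even_sub (k : ℕ) (x : ℂ) : J (k + 1) 0 x - J k 0 x = J (k + 1) 1 x := by
  induction k using Nat.twoStepInduction with
  | zero => simp [J_zero, J_one]
  | one => rw [J_add_two, J_add_two, J_zero, J_zero]; simp [J_one]; ring
  | more k h0 h1 =>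
    rw [J_add_two (k + 1) 0, J_add_two k 0, J_add_two (k + 1) 1]
    rw [J_add_two k 0] at h1
    linear_combination (2 * x) * h1 - h0

/-- The weight of the third kind is (1 + x)/√(1 - x²), so this reduces its integrals to those of the
first kind against the arcsine weight. -/
theorem one_add_mul_J_odd (k : ℕ) (x : ℂ) : (1 + x) * J k 1 x =
    (Polynomial.Chebyshev.T ℂ k).eval x + (Polynomial.Chebyshev.T ℂ (k + 1 : ℕ)).eval x := by
  induction k using Nat.twoStepInduction with
  | zero => simp [J_zero]
  | one =>
    have := Polynomial.Chebyshev.T_add_two ℂ 0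
    norm_num at this
    norm_num [J_one, this]
    ring
  | more k h0 h1 =>
    rw [J_add_two]
    push_cast at h0 h1 ⊢
    have e1 := Polynomial.Chebyshev.T_add_two ℂ k
    have e2 := Polynomial.Chebyshev.T_add_two ℂ (k + 1)
    rw [show (k : ℤ) + 2 + 1 = k + 1 + 2 by ring, e1, e2]
    rw [show (k : ℤ) + 1 + 1 = k + 2 by ring, e1] at h1 ⊢
    simp only [Polynomial.eval_sub, Polynomial.eval_mul, Polynomial.eval_X,
      Polynomial.eval_ofNat] at h1 ⊢
    linear_combination (2 * x) * h1 - h0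

theorem norm_one_add_mul_J_odd_le (k : ℕ) {x : ℝ} (hx : x ∈ Set.Icc (-1 : ℝ) 1) :
    ‖(1 + (x : ℂ)) * J k 1 x‖ ≤ 2 := by
  have h : ∀ j : ℤ, ‖(Polynomial.Chebyshev.T ℂ j).eval (x : ℂ)‖ ≤ 1 := by
    intro j
    rw [← Polynomial.Chebyshev.complex_ofReal_eval_T, Complex.norm_real]
    exact Polynomial.Chebyshev.abs_eval_T_real_le_one j (abs_le.2 hx)
  rw [one_add_mul_J_odd]
  refine (norm_add_le _ _).trans ?_
  have := h k
  have := h (k + 1 : ℕ)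
  linarith

/-! ### Integration against the arcsine weight -/

/-- Continuity along the real interval `[-1, 1]`. -/
def ContI (f : ℂ → ℂ) : Prop := ContinuousOn (fun x : ℝ => f x) (Set.Icc (-1) 1)

theorem ContI.mul {f g : ℂ → ℂ} (hf : ContI f) (hg : ContI g) : ContI fun x => f x * g x :=
  ContinuousOn.mul hf hg

theorem contI_of_continuous {f : ℂ → ℂ} (hf : Continuous f) : ContI f :=
  (hf.comp Complex.continuous_ofReal).continuousOn

theorem contI_J (k n : ℕ) : ContI (J k n) := contI_of_continuous (J_differentiable k n).continuous

theorem contI_of_differentiableOn {f : ℂ → ℂ} {ρ : ℝ} (hρ : 1 < ρ)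
    (hf : DifferentiableOn ℂ f (Metric.ball 0 ρ)) : ContI f := by
  refine hf.continuousOn.comp Complex.continuous_ofReal.continuousOn fun x hx => ?_
  rw [mem_ball_zero_iff, Complex.norm_real]
  exact (abs_le.2 hx).trans_lt hρ

/-- The integral of `f` over `[-1, 1]` with the weight `1 / √(1 - x²)`. -/
def arcInt (f : ℂ → ℂ) : ℂ := ∫ x in (-1 : ℝ)..1, f x * ((√(1 - x ^ 2)⁻¹ : ℝ) : ℂ)

theorem ContI.intervalIntegrable {f : ℂ → ℂ} (hf : ContI f) :
    IntervalIntegrable (fun x : ℝ => f x * ((√(1 - x ^ 2)⁻¹ : ℝ) : ℂ)) volume (-1) 1 := by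
  refine IntervalIntegrable.continuousOn_mul ?_ (by rwa [Set.uIcc_of_le (by norm_num)])
  exact ⟨intervalIntegrable_sqrt_one_sub_sq_inv.1.ofReal,
    intervalIntegrable_sqrt_one_sub_sq_inv.2.ofReal⟩

theorem arcInt_add {f g : ℂ → ℂ} (hf : ContI f) (hg : ContI g) :
    arcInt (fun x => f x + g x) = arcInt f + arcInt g := by
  simp only [arcInt, add_mul]
  exact intervalIntegral.integral_add hf.intervalIntegrable hg.intervalIntegrable

theorem arcInt_sub {f g : ℂ → ℂ} (hf : ContI f) (hg : ContI g) :
    arcInt (fun x => f x - g x) = arcInt f - arcInt g := by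
  simp only [arcInt, sub_mul]
  exact intervalIntegral.integral_sub hf.intervalIntegrable hg.intervalIntegrable

theorem arcInt_const_mul (c : ℂ) (f : ℂ → ℂ) : arcInt (fun x => c * f x) = c * arcInt f := by
  simp only [arcInt, mul_assoc]
  exact intervalIntegral.integral_const_mul _ _

theorem arcInt_congr {f g : ℂ → ℂ} (h : ∀ x ∈ Set.Icc (-1 : ℝ) 1, f x = g x) :
    arcInt f = arcInt g := by
  refine intervalIntegral.integral_congr fun x hx => ?_
  rw [Set.uIcc_of_le (by norm_num)] at hx
  simp only [h x hx]

theorem arcInt_T (k : ℕ) : arcInt (fun x => (Polynomial.Chebyshev.T ℂ k).eval x) =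
    if k = 0 then (Real.pi : ℂ) else 0 := by
  have h : arcInt (fun x => (Polynomial.Chebyshev.T ℂ k).eval x) =
      ((∫ x, (Polynomial.Chebyshev.T ℝ k).eval x ∂Polynomial.Chebyshev.measureT : ℝ) : ℂ) := by
    rw [integral_measureT, arcInt, ← intervalIntegral.integral_ofReal]
    simp [Polynomial.Chebyshev.complex_ofReal_eval_T]
  rw [h]
  split_ifs with hk
  · simp only [hk, Nat.cast_zero, Polynomial.Chebyshev.integral_eval_T_real_measureT_zero]
  · rw [Polynomial.Chebyshev.integral_eval_T_real_measureT_of_ne_zero (by exact_mod_cast hk)]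
    simp

theorem integral_arcsine_weight : ∫ x in (-1 : ℝ)..1, √(1 - x ^ 2)⁻¹ = Real.pi := by
  have := Polynomial.Chebyshev.integral_eval_T_real_measureT_zero
  rw [integral_measureT] at this
  simpa using this

theorem norm_arcInt_le {f : ℂ → ℂ} {M : ℝ} (h : ∀ x ∈ Set.Icc (-1 : ℝ) 1, ‖f x‖ ≤ M) :
    ‖arcInt f‖ ≤ M * Real.pi := by
  rw [← integral_arcsine_weight, ← intervalIntegral.integral_const_mul]
  refine intervalIntegral.norm_integral_le_of_norm_le (by norm_num)
    (Filter.Eventually.of_forall fun x hx => ?_)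
    (intervalIntegrable_sqrt_one_sub_sq_inv.const_mul M)
  rw [norm_mul, Complex.norm_of_nonneg (Real.sqrt_nonneg _)]
  exact mul_le_mul_of_nonneg_right (h x ⟨hx.1.le, hx.2⟩) (Real.sqrt_nonneg _)

/-! ### Chebyshev coefficients -/

/-- The normalized coefficient of `f` at `J_{k,α_n}`. -/
def coef (n k : ℕ) (f : ℂ → ℂ) : ℂ :=
  (((2 : ℝ) ^ (expo n + 1 / 2) / Real.pi : ℝ) : ℂ) *
    ∫ x in (-1 : ℝ)..1, f x * J k n x *
      (((1 - x) ^ expo n * (1 + x) ^ (1 / 2 : ℝ) : ℝ) : ℂ)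

theorem coef_even {n : ℕ} (hn : Even n) (k : ℕ) (f : ℂ → ℂ) :
    coef n k f = 2 / Real.pi * arcInt fun x => f x * ((1 - x ^ 2) * J k 0 x) := by
  unfold coef arcInt
  rw [J_congr (n := n) (n' := 0) (by simpa using hn)]
  have he : expo n = 1 / 2 := if_pos hn
  rw [he]
  congr 1
  · norm_num
  · refine intervalIntegral.integral_congr fun x hx => ?_
    rw [Set.uIcc_of_le (by norm_num)] at hx
    have h1 : (1 - x) ^ (1 / 2 : ℝ) * (1 + x) ^ (1 / 2 : ℝ) = (1 - x ^ 2) * √(1 - x ^ 2)⁻¹ := by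
      rw [← Real.mul_rpow (by linarith [hx.2]) (by linarith [hx.1]), ← Real.sqrt_eq_rpow,
        Real.sqrt_inv, show (1 - x) * (1 + x) = 1 - x ^ 2 by ring, ← div_eq_mul_inv,
        Real.div_sqrt]
    simp only [h1]
    push_cast
    ring

theorem coef_odd {n : ℕ} (hn : ¬ Even n) (k : ℕ) (f : ℂ → ℂ) :
    coef n k f = 1 / Real.pi * arcInt fun x => f x * ((1 + x) * J k 1 x) := by
  unfold coef arcInt
  rw [J_congr (n := n) (n' := 1) (by simpa using hn)]
  have he : expo n = -1 / 2 := if_neg hn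
  rw [he]
  congr 1
  · norm_num
  -- The power (1 - x)^(-1/2) is singular at 1, so the endpoint is discarded as a null set.
  · refine intervalIntegral.integral_congr_ae ?_
    have hne : ∀ᵐ x : ℝ, x ≠ 1 := by simp [ae_iff, measure_singleton]
    filter_upwards [hne] with x hx1 hx
    rw [Set.uIoc_of_le (by norm_num)] at hx
    have h2 : 0 < 1 - x := by
      have := lt_of_le_of_ne hx.2 hx1
      linarith
    have h3 : 0 < 1 + x := by linarith [hx.1]
    have h1 : (1 - x) ^ (-1 / 2 : ℝ) * (1 + x) ^ (1 / 2 : ℝ) = (1 + x) * √(1 - x ^ 2)⁻¹ := by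
      rw [show (-1 / 2 : ℝ) = -(1 / 2) by ring, Real.rpow_neg h2.le, ← Real.sqrt_eq_rpow,
        ← Real.sqrt_eq_rpow, Real.sqrt_inv, show 1 - x ^ 2 = (1 - x) * (1 + x) by ring,
        Real.sqrt_mul h2.le, mul_inv]
      have := Real.mul_self_sqrt h3.le
      have h4 := (Real.sqrt_pos.2 h3).ne'
      have h5 := (Real.sqrt_pos.2 h2).ne'
      field_simp
      rw [Real.sq_sqrt h3.le]
    simp only [h1]
    push_cast
    ring

theorem coef_congr_parity {n n' : ℕ} (h : Even n ↔ Even n') (k : ℕ) (f : ℂ → ℂ) :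
    coef n k f = coef n' k f := by
  simp only [coef, expo, h, J_congr h]

/-- The polynomial factor of the weight of `J_{k,α_n}` relative to the arcsine weight. -/
def weightPoly (n k : ℕ) (x : ℂ) : ℂ :=
  if Even n then 2 * ((1 - x ^ 2) * J k 0 x) else (1 + x) * J k 1 x

theorem contI_weightPoly (n k : ℕ) : ContI (weightPoly n k) := by
  have h0 := (J_differentiable k 0).continuous
  have h1 := (J_differentiable k 1).continuous
  refine contI_of_continuous ?_
  unfold weightPoly
  split_ifs <;> fun_prop

theorem coef_eq (n k : ℕ) (f : ℂ → ℂ) :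
    coef n k f = 1 / Real.pi * arcInt fun x => f x * weightPoly n k x := by
  by_cases hn : Even n
  · rw [coef_even hn]
    simp only [weightPoly, hn, if_true]
    have : (fun x => f x * (2 * ((1 - x ^ 2) * J k 0 x))) =
        fun x => 2 * (f x * ((1 - x ^ 2) * J k 0 x)) := by funext x; ring
    rw [this, arcInt_const_mul]
    ring
  · rw [coef_odd hn]
    simp only [weightPoly, hn, if_false]

theorem coef_add (n k : ℕ) {f g : ℂ → ℂ} (hf : ContI f) (hg : ContI g) :
    coef n k (fun x => f x + g x) = coef n k f + coef n k g := by
  simp only [coef_eq, add_mul]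
  rw [arcInt_add (hf.mul (contI_weightPoly n k)) (hg.mul (contI_weightPoly n k))]
  ring

theorem coef_sub (n k : ℕ) {f g : ℂ → ℂ} (hf : ContI f) (hg : ContI g) :
    coef n k (fun x => f x - g x) = coef n k f - coef n k g := by
  simp only [coef_eq, sub_mul]
  rw [arcInt_sub (hf.mul (contI_weightPoly n k)) (hg.mul (contI_weightPoly n k))]
  ring

theorem coef_const_mul (n k : ℕ) (c : ℂ) (f : ℂ → ℂ) :
    coef n k (fun x => c * f x) = c * coef n k f := by
  simp only [coef_eq, mul_assoc]
  rw [arcInt_const_mul]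
  ring

theorem coef_congr (n k : ℕ) {f g : ℂ → ℂ} (h : ∀ x ∈ Set.Icc (-1 : ℝ) 1, f x = g x) :
    coef n k f = coef n k g := by
  simp only [coef_eq]
  rw [arcInt_congr (g := fun x => g x * weightPoly n k x) fun x hx => by rw [h x hx]]

theorem ContI.sum {ι : Type*} (s : Finset ι) {f : ι → ℂ → ℂ} (hf : ∀ i ∈ s, ContI (f i)) :
    ContI fun x => ∑ i ∈ s, f i x :=
  continuousOn_finsetSum s hf

theorem coef_sum (n k : ℕ) {ι : Type*} (s : Finset ι) {f : ι → ℂ → ℂ}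
    (hf : ∀ i ∈ s, ContI (f i)) :
    coef n k (fun x => ∑ i ∈ s, f i x) = ∑ i ∈ s, coef n k (f i) := by
  classical
  induction s using Finset.induction_on with
  | empty => simp [coef]
  | insert a s ha ih =>
    simp only [Finset.sum_insert ha]
    rw [coef_add n k (hf _ (Finset.mem_insert_self _ _))
      (ContI.sum s fun i hi => hf i (Finset.mem_insert_of_mem hi)),
      ih fun i hi => hf i (Finset.mem_insert_of_mem hi)]

/-- Multiply `J_odd_sub` by 1 + x: the weighted polynomial of the second kind is a difference of
consecutive weighted polynomials of the third kind. -/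
theorem coef_even_eq_sub {f : ℂ → ℂ} (hf : ContI f) (k : ℕ) :
    coef 0 k f = coef 1 k f - coef 1 (k + 1) f := by
  simp only [coef_eq]
  rw [← mul_sub, ← arcInt_sub (hf.mul (contI_weightPoly 1 k)) (hf.mul (contI_weightPoly 1 _))]
  congr 2
  funext x
  simp only [weightPoly, Nat.not_even_one, if_false, Even.zero, if_true]
  linear_combination (-f x * (1 + x)) * J_odd_sub k x

theorem coef_odd_one (k : ℕ) : coef 1 k (fun _ => 1) = if k = 0 then 1 else 0 := by
  rw [coef_eq]
  simp only [weightPoly, Nat.not_even_one, if_false, one_mul, one_add_mul_J_odd]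
  rw [arcInt_add (contI_of_continuous (by fun_prop)) (contI_of_continuous (by fun_prop)),
    arcInt_T, arcInt_T]
  have : (Real.pi : ℂ) ≠ 0 := by exact_mod_cast Real.pi_ne_zero
  split_ifs <;> simp_all

theorem contI_one : ContI fun _ => 1 := contI_of_continuous continuous_const

theorem contI_id : ContI fun x => x := contI_of_continuous continuous_id

theorem contI_two_mul_sub_one : ContI fun x => 2 * (x - 1) :=
  contI_of_continuous (by fun_prop)

theorem coef_one (n k : ℕ) : coef n k (fun _ => 1) = if k = 0 then 1 else 0 := by
  by_cases hn : Even n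
  · rw [coef_congr_parity (n' := 0) (by simpa using hn), coef_even_eq_sub contI_one,
      coef_odd_one, coef_odd_one]
    simp
  · rw [coef_congr_parity (n' := 1) (by simpa using hn), coef_odd_one]

/-- The relation between the coefficients of `c + 2(x - 1) g(x)` and of `g`. -/
theorem coef_odd_succ_add {g : ℂ → ℂ} (hg : ContI g) (c : ℂ) (k : ℕ) :
    coef 1 (k + 1) (fun x => c + 2 * (x - 1) * g x) = coef 0 k g - coef 0 (k + 1) g := by
  rw [coef_add 1 _ (contI_of_continuous continuous_const) (contI_two_mul_sub_one.mul hg)]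
  have h1 := coef_const_mul 1 (k + 1) c (fun _ => 1)
  rw [coef_odd_one] at h1
  simp only [mul_one, Nat.succ_ne_zero, if_false, mul_zero] at h1
  rw [h1, zero_add]
  simp only [coef_eq]
  rw [← mul_sub, ← arcInt_sub (hg.mul (contI_weightPoly 0 k)) (hg.mul (contI_weightPoly 0 _))]
  congr 2
  funext x
  simp only [weightPoly, Nat.not_even_one, if_false, Even.zero, if_true]
  linear_combination (2 * g x * (1 - x ^ 2)) * J_even_sub k x

theorem coef_odd_zero_add {g : ℂ → ℂ} (hg : ContI g) (c : ℂ) :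
    coef 1 0 (fun x => c + 2 * (x - 1) * g x) = c - coef 0 0 g := by
  rw [coef_add 1 _ (contI_of_continuous continuous_const) (contI_two_mul_sub_one.mul hg)]
  have h1 := coef_const_mul 1 0 c (fun _ => 1)
  rw [coef_odd_one] at h1
  simp only [mul_one, if_true] at h1
  rw [h1, sub_eq_add_neg]
  congr 1
  rw [neg_eq_neg_one_mul, ← coef_const_mul]
  simp only [coef_eq]
  congr 2
  funext x
  simp only [weightPoly, Nat.not_even_one, if_false, Even.zero, if_true, J_zero]
  ring

theorem coef_two_mul_succ (n k : ℕ) {f : ℂ → ℂ} (hf : ContI f) :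
    coef n (k + 1) (fun x => 2 * x * f x) = coef n (k + 2) f + coef n k f := by
  simp only [coef_eq]
  rw [← mul_add, ← arcInt_add (hf.mul (contI_weightPoly n _)) (hf.mul (contI_weightPoly n _))]
  congr 2
  funext x
  simp only [weightPoly]
  split_ifs
  · linear_combination (-f x * 2 * (1 - x ^ 2)) * J_add_two k 0 x
  · linear_combination (-f x * (1 + x)) * J_add_two k 1 x

/-- The boundary term reflects the value at index -1 that the recurrence prescribes: 0 for the
second kind, 1 for the third. -/
theorem coef_two_mul_zero (n : ℕ) {f : ℂ → ℂ} (hf : ContI f) :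
    coef n 0 (fun x => 2 * x * f x) = coef n 1 f + if Even n then 0 else coef n 0 f := by
  by_cases hn : Even n
  · simp only [coef_eq, weightPoly, hn, if_true, J_zero, J_one, add_zero, Even.zero, sub_zero]
    congr 2
    funext x
    ring
  · simp only [hn, if_false]
    simp only [coef_eq]
    rw [← mul_add, ← arcInt_add (hf.mul (contI_weightPoly n _)) (hf.mul (contI_weightPoly n _))]
    simp only [weightPoly, hn, if_false, J_zero, J_one, Nat.not_even_one]
    congr 2
    funext x
    ring

/-- Multiplication by 2x acts on coefficients by the same symmetric tridiagonal matrix as on the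
polynomials, so orthonormality propagates from `coef_one`. -/
theorem coef_J (n k l : ℕ) : coef n k (J l n) = if k = l then 1 else 0 := by
  induction l using Nat.twoStepInduction generalizing k with
  | zero =>
    rw [← coef_one n k]
    exact congrArg _ (funext fun x => J_zero n x)
  | one =>
    have h : J 1 n = fun x => 2 * x * 1 - (if Even n then 0 else 1) * 1 :=
      funext fun x => by rw [J_one]; ring
    rw [h, coef_sub n k (contI_of_continuous (by fun_prop)) (contI_of_continuous (by fun_prop)),
      coef_const_mul, coef_one]
    rcases k with _ | k
    · rw [coef_two_mul_zero n contI_one, coef_one, coef_one]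
      simp
    · rw [coef_two_mul_succ n k contI_one, coef_one, coef_one]
      simp
  | more l h0 h1 =>
    have h : J (l + 2) n = fun x => 2 * x * J (l + 1) n x - J l n x :=
      funext fun x => J_add_two l n x
    rw [h, coef_sub n k (((contI_of_continuous continuous_const).mul contI_id).mul (contI_J _ _))
      (contI_J _ _), h0]
    rcases k with _ | k
    · rw [coef_two_mul_zero n (contI_J _ _), h1, h1]
      rcases l with _ | l <;> simp
    · rw [coef_two_mul_succ n k (contI_J _ _), h1, h1]
      split_ifs <;> first | omega | simp

theorem coef_pow_eq_zero (n : ℕ) (i k : ℕ) (hik : i < k) : coef n k (fun x => x ^ i) = 0 := by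
  induction i generalizing k with
  | zero => simp only [pow_zero]; rw [coef_one, if_neg (by omega)]
  | succ i ih =>
    obtain ⟨k, rfl⟩ := Nat.exists_eq_add_of_lt (Nat.zero_lt_of_lt hik)
    simp only [zero_add] at hik ⊢
    have h : (fun x : ℂ => x ^ (i + 1)) = fun x => (1 / 2) * (2 * x * x ^ i) := by
      funext x; ring
    rw [h, coef_const_mul, coef_two_mul_succ n k (contI_of_continuous (by fun_prop)),
      ih _ (by omega), ih _ (by omega)]
    simp

theorem norm_coef_odd_le {f : ℂ → ℂ} {M : ℝ} (h : ∀ x ∈ Set.Icc (-1 : ℝ) 1, ‖f x‖ ≤ M) (k : ℕ) :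
    ‖coef 1 k f‖ ≤ M * 2 := by
  rw [coef_eq, norm_mul]
  have h1 := norm_arcInt_le (f := fun x => f x * weightPoly 1 k x) (M := M * 2) fun x hx => by
    rw [norm_mul]
    have h2 := norm_one_add_mul_J_odd_le k hx
    simp only [weightPoly, Nat.not_even_one, if_false]
    exact mul_le_mul (h x hx) h2 (norm_nonneg _) ((norm_nonneg _).trans (h x hx))
  have h3 : ‖(1 : ℂ) / Real.pi‖ = 1 / Real.pi := by
    rw [norm_div, norm_one, Complex.norm_of_nonneg Real.pi_pos.le]
  rw [h3, one_div, inv_mul_le_iff₀ Real.pi_pos]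
  linarith

theorem norm_coef_even_le {f : ℂ → ℂ} (hf : ContI f) {M : ℝ}
    (h : ∀ x ∈ Set.Icc (-1 : ℝ) 1, ‖f x‖ ≤ M) (k : ℕ) : ‖coef 0 k f‖ ≤ M * 4 := by
  rw [coef_even_eq_sub hf]
  have h1 := norm_coef_odd_le h k
  have h2 := norm_coef_odd_le h (k + 1)
  have := norm_sub_le (coef 1 k f) (coef 1 (k + 1) f)
  linarith

end SymplecticPlancherel

end

noncomputable section

namespace SymplecticPlancherel

/-! ### Decay of Chebyshev coefficients -/

/-- The `k`-th coefficient annihilates polynomials of degree below `k`, so `f` may be replaced by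
its Taylor remainder at 0, which is geometrically small on [-1, 1] because the disk of holomorphy is
larger than the unit disk. -/
theorem exists_norm_coef_odd_le {f : ℂ → ℂ} {ρ : ℝ} (hρ : 1 < ρ)
    (hf : DifferentiableOn ℂ f (Metric.ball 0 ρ)) :
    ∃ a ∈ Set.Ioo (0 : ℝ) 1, ∃ C : ℝ, ∀ k, ‖coef 1 k f‖ ≤ C * a ^ k := by
  obtain ⟨s, hs1, hs2⟩ := exists_between hρ
  obtain ⟨s', hs1', hs2'⟩ := exists_between hs1
  lift s to NNReal using by linarith
  lift s' to NNReal using by linarith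
  have hp := (hf.mono (Metric.closedBall_subset_ball hs2)).hasFPowerSeriesOnBall
    (by exact_mod_cast (zero_lt_one.trans hs1))
  set p := cauchyPowerSeries f 0 s
  obtain ⟨a, ha, C, hC, h⟩ := hp.uniform_geometric_approx (r' := s') (by exact_mod_cast hs2')
  refine ⟨a, ha, C * 2, fun k => ?_⟩
  have hpart : coef 1 k (p.partialSum k) = 0 := by
    have : p.partialSum k = fun x => ∑ i ∈ Finset.range k, p.coeff i * x ^ i := by
      funext x
      simp [FormalMultilinearSeries.partialSum, mul_comm]
    rw [this, coef_sum 1 k _ fun i _ => contI_of_continuous (by fun_prop)]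
    refine Finset.sum_eq_zero fun i hi => ?_
    rw [coef_const_mul, coef_pow_eq_zero _ _ _ (Finset.mem_range.1 hi), mul_zero]
  have hsub : coef 1 k f = coef 1 k (fun x => f x - p.partialSum k x) := by
    rw [coef_sub 1 k (contI_of_differentiableOn hρ hf)
      (contI_of_continuous (p.partialSum_continuous k)), hpart, sub_zero]
  rw [hsub]
  have := norm_coef_odd_le (f := fun x => f x - p.partialSum k x) (M := C * a ^ k) (fun x hx => ?_) k
  · linarith
  · have := h x (by
      rw [mem_ball_zero_iff, Complex.norm_real]
      exact (abs_le.2 hx).trans_lt hs1') k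
    simpa using this

theorem exists_norm_coef_le {f : ℂ → ℂ} {ρ : ℝ} (hρ : 1 < ρ)
    (hf : DifferentiableOn ℂ f (Metric.ball 0 ρ)) (n : ℕ) :
    ∃ a ∈ Set.Ioo (0 : ℝ) 1, ∃ C : ℝ, ∀ k, ‖coef n k f‖ ≤ C * a ^ k := by
  obtain ⟨a, ha, C, h⟩ := exists_norm_coef_odd_le hρ hf
  by_cases hn : Even n
  · refine ⟨a, ha, C + C * a, fun k => ?_⟩
    rw [coef_congr_parity (n' := 0) (by simpa using hn),
      coef_even_eq_sub (contI_of_differentiableOn hρ hf)]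
    have h1 := h k
    have h2 := h (k + 1)
    rw [pow_succ] at h2
    have := norm_sub_le (coef 1 k f) (coef 1 (k + 1) f)
    linarith
  · refine ⟨a, ha, C, fun k => ?_⟩
    rw [coef_congr_parity (n' := 1) (by simpa using hn)]
    exact h k

theorem summable_norm_coef {f : ℂ → ℂ} {ρ : ℝ} (hρ : 1 < ρ)
    (hf : DifferentiableOn ℂ f (Metric.ball 0 ρ)) (n : ℕ) : Summable fun k => ‖coef n k f‖ := by
  obtain ⟨a, ha, C, h⟩ := exists_norm_coef_le hρ hf n
  exact Summable.of_nonneg_of_le (fun _ => norm_nonneg _) h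
    ((summable_geometric_of_lt_one ha.1.le ha.2).mul_left C)

theorem tendsto_coef {f : ℂ → ℂ} {ρ : ℝ} (hρ : 1 < ρ)
    (hf : DifferentiableOn ℂ f (Metric.ball 0 ρ)) (n : ℕ) :
    Filter.Tendsto (fun k => coef n k f) Filter.atTop (nhds 0) :=
  (summable_norm_coef hρ hf n).of_norm.tendsto_atTop_zero

/-! ### The Taylor quotient at `1` -/

/-- `Q f = (f - f(1)) / (2(x - 1))`. -/
def Q (f : ℂ → ℂ) : ℂ → ℂ := fun x => dslope f 1 x / 2

theorem eq_add_Q (f : ℂ → ℂ) (x : ℂ) : f x = f 1 + 2 * (x - 1) * Q f x := by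
  have := sub_smul_dslope f 1 x
  rw [smul_eq_mul] at this
  simp only [Q]
  linear_combination -this

theorem one_mem_ball {ρ : ℝ} (hρ : 1 < ρ) : (1 : ℂ) ∈ Metric.ball (0 : ℂ) ρ := by simpa using hρ

theorem Q_differentiableOn {f : ℂ → ℂ} {ρ : ℝ} (hρ : 1 < ρ)
    (hf : DifferentiableOn ℂ f (Metric.ball 0 ρ)) :
    DifferentiableOn ℂ (Q f) (Metric.ball 0 ρ) :=
  ((Complex.differentiableOn_dslope (Metric.isOpen_ball.mem_nhds (one_mem_ball hρ))).2 hf).div_const 2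

theorem Q_iterate_differentiableOn {f : ℂ → ℂ} {ρ : ℝ} (hρ : 1 < ρ)
    (hf : DifferentiableOn ℂ f (Metric.ball 0 ρ)) (i : ℕ) :
    DifferentiableOn ℂ (Q^[i] f) (Metric.ball 0 ρ) := by
  induction i with
  | zero => exact hf
  | succ i ih => rw [Function.iterate_succ_apply']; exact Q_differentiableOn hρ ih

/-- Away from 1 one cancels 2(x - 1); the value at 1 is forced by continuity. The algebraic rules
for `Q` below are instances of this uniqueness. -/
theorem Q_eq_of_eq_add {f g : ℂ → ℂ} (c : ℂ) (h : ∀ x, f x = c + 2 * (x - 1) * g x)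
    (hf : DifferentiableAt ℂ f 1) (hg : ContinuousAt g 1) : Q f = g := by
  have hc : f 1 = c := by simp [h 1]
  have hne : ∀ x, x ≠ 1 → Q f x = g x := by
    intro x hx
    have h1 := eq_add_Q f x
    rw [h x, hc] at h1
    have h2 : 2 * (x - 1) ≠ 0 := mul_ne_zero two_ne_zero (sub_ne_zero.2 hx)
    exact (mul_left_cancel₀ h2 (add_left_cancel h1)).symm
  funext x
  by_cases hx : x = 1
  · subst hx
    have hQ : ContinuousAt (Q f) 1 := (continuousAt_dslope_same.2 hf).div_const 2
    have h1 := hQ.tendsto.mono_left (nhdsWithin_le_nhds (s := {1}ᶜ))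
    have h2 := hg.tendsto.mono_left (nhdsWithin_le_nhds (s := {1}ᶜ))
    refine tendsto_nhds_unique (h1.congr' ?_) h2
    filter_upwards [self_mem_nhdsWithin] with x hx using hne x hx
  · exact hne x hx

theorem differentiableAt_one {f : ℂ → ℂ} {ρ : ℝ} (hρ : 1 < ρ)
    (hf : DifferentiableOn ℂ f (Metric.ball 0 ρ)) : DifferentiableAt ℂ f 1 :=
  hf.differentiableAt (Metric.isOpen_ball.mem_nhds (one_mem_ball hρ))

theorem Q_add {f g : ℂ → ℂ} {ρ : ℝ} (hρ : 1 < ρ) (hf : DifferentiableOn ℂ f (Metric.ball 0 ρ))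
    (hg : DifferentiableOn ℂ g (Metric.ball 0 ρ)) :
    Q (fun x => f x + g x) = fun x => Q f x + Q g x := by
  refine Q_eq_of_eq_add (f 1 + g 1) (fun x => ?_) (differentiableAt_one hρ (hf.add hg))
    (differentiableAt_one hρ
      ((Q_differentiableOn hρ hf).add (Q_differentiableOn hρ hg))).continuousAt
  rw [eq_add_Q f x, eq_add_Q g x]
  ring

theorem Q_const_mul {f : ℂ → ℂ} {ρ : ℝ} (hρ : 1 < ρ) (hf : DifferentiableOn ℂ f (Metric.ball 0 ρ))
    (c : ℂ) : Q (fun x => c * f x) = fun x => c * Q f x := by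
  refine Q_eq_of_eq_add (c * f 1) (fun x => ?_) (differentiableAt_one hρ (hf.const_mul c))
    (differentiableAt_one hρ ((Q_differentiableOn hρ hf).const_mul c)).continuousAt
  rw [eq_add_Q f x]
  ring

theorem Q_mul {f g : ℂ → ℂ} {ρ : ℝ} (hρ : 1 < ρ) (hf : DifferentiableOn ℂ f (Metric.ball 0 ρ))
    (hg : DifferentiableOn ℂ g (Metric.ball 0 ρ)) :
    Q (fun x => f x * g x) = fun x => f 1 * Q g x + Q f x * g x := by
  have hQf := Q_differentiableOn hρ hf
  have hQg := Q_differentiableOn hρ hg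
  refine Q_eq_of_eq_add (f 1 * g 1) (fun x => ?_) (differentiableAt_one hρ (hf.mul hg))
    (differentiableAt_one hρ ((hQg.const_mul (f 1)).add (hQf.mul hg))).continuousAt
  rw [eq_add_Q f x, eq_add_Q g x]
  ring

theorem Q_mul_self {f : ℂ → ℂ} {ρ : ℝ} (hρ : 1 < ρ) (hf : DifferentiableOn ℂ f (Metric.ball 0 ρ)) :
    Q (fun x => 2 * (x - 1) * f x) = f := by
  have hd : DifferentiableOn ℂ (fun x : ℂ => 2 * (x - 1)) (Metric.ball 0 ρ) := by fun_prop
  exact Q_eq_of_eq_add 0 (fun x => by ring) (differentiableAt_one hρ (hd.mul hf))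
    (differentiableAt_one hρ hf).continuousAt

theorem Q_iterate_const_mul {f : ℂ → ℂ} {ρ : ℝ} (hρ : 1 < ρ)
    (hf : DifferentiableOn ℂ f (Metric.ball 0 ρ)) (c : ℂ) (i : ℕ) :
    Q^[i] (fun x => c * f x) = fun x => c * Q^[i] f x := by
  induction i with
  | zero => rfl
  | succ i ih =>
    rw [Function.iterate_succ_apply', ih, Q_const_mul hρ (Q_iterate_differentiableOn hρ hf i),
      Function.iterate_succ_apply']

theorem Q_iterate_add {f g : ℂ → ℂ} {ρ : ℝ} (hρ : 1 < ρ)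
    (hf : DifferentiableOn ℂ f (Metric.ball 0 ρ)) (hg : DifferentiableOn ℂ g (Metric.ball 0 ρ))
    (i : ℕ) : Q^[i] (fun x => f x + g x) = fun x => Q^[i] f x + Q^[i] g x := by
  induction i with
  | zero => rfl
  | succ i ih =>
    rw [Function.iterate_succ_apply', ih, Q_add hρ (Q_iterate_differentiableOn hρ hf i)
      (Q_iterate_differentiableOn hρ hg i), Function.iterate_succ_apply',
      Function.iterate_succ_apply']

theorem Q_zero : Q (fun _ => 0) = fun _ => 0 :=
  Q_eq_of_eq_add 0 (fun x => by simp) (differentiableAt_const _) continuousAt_const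

theorem Q_iterate_sum {ι : Type*} (s : Finset ι) {f : ι → ℂ → ℂ} {ρ : ℝ} (hρ : 1 < ρ)
    (hf : ∀ a ∈ s, DifferentiableOn ℂ (f a) (Metric.ball 0 ρ)) (i : ℕ) :
    Q^[i] (fun x => ∑ a ∈ s, f a x) = fun x => ∑ a ∈ s, Q^[i] (f a) x := by
  classical
  induction s using Finset.induction_on with
  | empty =>
    simp only [Finset.sum_empty]
    exact Function.iterate_fixed Q_zero i
  | insert a s ha ih =>
    simp only [Finset.sum_insert ha]
    rw [Q_iterate_add hρ (hf a (Finset.mem_insert_self _ _))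
      (DifferentiableOn.fun_sum fun b hb => hf b (Finset.mem_insert_of_mem hb)),
      ih fun b hb => hf b (Finset.mem_insert_of_mem hb)]

theorem differentiableOn_pow_mul {f : ℂ → ℂ} {ρ : ℝ}
    (hf : DifferentiableOn ℂ f (Metric.ball 0 ρ)) (i : ℕ) :
    DifferentiableOn ℂ (fun x => (2 * (x - 1)) ^ i * f x) (Metric.ball 0 ρ) := by
  have : DifferentiableOn ℂ (fun x : ℂ => (2 * (x - 1)) ^ i) (Metric.ball 0 ρ) := by fun_prop
  exact this.mul hf

theorem Q_iterate_pow_mul {f : ℂ → ℂ} {ρ : ℝ} (hρ : 1 < ρ)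
    (hf : DifferentiableOn ℂ f (Metric.ball 0 ρ)) (i j : ℕ) :
    Q^[i] (fun x => (2 * (x - 1)) ^ (i + j) * f x) = fun x => (2 * (x - 1)) ^ j * f x := by
  induction i with
  | zero => simp
  | succ i ih =>
    rw [Function.iterate_succ_apply]
    have : (fun x : ℂ => (2 * (x - 1)) ^ (i + 1 + j) * f x) =
        fun x => 2 * (x - 1) * ((2 * (x - 1)) ^ (i + j) * f x) := by funext x; ring
    rw [this, Q_mul_self hρ (differentiableOn_pow_mul hf _), ih]

/-- Taylor's formula at `1`. -/
theorem eq_sum_add_Q_iterate (f : ℂ → ℂ) (i : ℕ) (x : ℂ) :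
    f x = ∑ j ∈ Finset.range i, Q^[j] f 1 * (2 * (x - 1)) ^ j + (2 * (x - 1)) ^ i * Q^[i] f x := by
  induction i with
  | zero => simp
  | succ i ih =>
    rw [Finset.sum_range_succ, Function.iterate_succ_apply']
    have h2 := eq_add_Q (Q^[i] f) x
    linear_combination ih + (2 * (x - 1)) ^ i * h2

/-- The Taylor coefficients of a product. -/
theorem Q_iterate_mul_apply_one {f g : ℂ → ℂ} {ρ : ℝ} (hρ : 1 < ρ)
    (hf : DifferentiableOn ℂ f (Metric.ball 0 ρ)) (hg : DifferentiableOn ℂ g (Metric.ball 0 ρ))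
    (i : ℕ) : Q^[i] (fun x => f x * g x) 1 =
      ∑ j ∈ Finset.range (i + 1), Q^[j] f 1 * Q^[i - j] g 1 := by
  induction i generalizing f with
  | zero => simp
  | succ i ih =>
    have hQf := Q_differentiableOn hρ hf
    have hQg := Q_differentiableOn hρ hg
    rw [Function.iterate_succ_apply, Q_mul hρ hf hg, Q_iterate_add (g := fun x => Q f x * g x) hρ
      (hQg.const_mul _) (hQf.mul hg), Q_iterate_const_mul hρ hQg]
    simp only
    rw [ih hQf, Finset.sum_range_succ' _ (i + 1)]
    simp only [Function.iterate_succ_apply, Function.iterate_zero, id_eq, tsub_zero,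
      Nat.add_sub_add_right]
    ring

/-! ### Sums of Chebyshev coefficients -/

theorem tsum_eq_of_telescoping {u v : ℕ → ℂ} (h : ∀ k, u k = v k - v (k + 1))
    (hu : Summable u) (hv : Filter.Tendsto v Filter.atTop (nhds 0)) (x : ℕ) :
    ∑' k, u (x + k) = v x := by
  have h1 := ((hu.comp_injective (add_right_injective x)).hasSum.tendsto_sum_nat)
  refine tendsto_nhds_unique h1 ?_
  have h2 : ∀ N, ∑ k ∈ Finset.range N, (u ∘ (x + ·)) k = v x - v (x + N) := by
    intro N
    induction N with
    | zero => simp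
    | succ N ih => rw [Finset.sum_range_succ, ih, Function.comp, h (x + N)]; ring_nf
  simp only [h2]
  have h3 : Filter.Tendsto (fun N => v (x + N)) Filter.atTop (nhds 0) :=
    hv.comp (Filter.tendsto_atTop_mono (fun N => Nat.le_add_left N x) Filter.tendsto_id)
  simpa using h3.const_sub (v x)

theorem tsum_coef_of_odd {f : ℂ → ℂ} {ρ : ℝ} (hρ : 1 < ρ)
    (hf : DifferentiableOn ℂ f (Metric.ball 0 ρ)) {n : ℕ} (hn : ¬ Even n) (x : ℕ) :
    ∑' k, coef (n + 1) (x + k) f = coef n x f := by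
  have e1 : ∀ k, coef (n + 1) k f = coef 0 k f := fun k =>
    coef_congr_parity (by simp [Nat.even_add_one, hn]) _ _
  have e2 : ∀ k, coef n k f = coef 1 k f := fun k =>
    coef_congr_parity (by simpa using hn) _ _
  rw [e2]
  simp only [e1]
  exact tsum_eq_of_telescoping (u := fun k => coef 0 k f) (v := fun k => coef 1 k f)
    (coef_even_eq_sub (contI_of_differentiableOn hρ hf))
    (summable_norm_coef hρ hf 0).of_norm (tendsto_coef hρ hf 1) x

theorem coef_odd_succ_eq {f : ℂ → ℂ} {ρ : ℝ} (hρ : 1 < ρ)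
    (hf : DifferentiableOn ℂ f (Metric.ball 0 ρ)) (k : ℕ) :
    coef 1 (k + 1) f = coef 0 k (Q f) - coef 0 (k + 1) (Q f) := by
  rw [← coef_odd_succ_add (contI_of_differentiableOn hρ (Q_differentiableOn hρ hf)) (f 1)]
  exact congrArg _ (funext (eq_add_Q f))

theorem coef_odd_zero_eq {f : ℂ → ℂ} {ρ : ℝ} (hρ : 1 < ρ)
    (hf : DifferentiableOn ℂ f (Metric.ball 0 ρ)) : coef 1 0 f = f 1 - coef 0 0 (Q f) := by
  rw [← coef_odd_zero_add (contI_of_differentiableOn hρ (Q_differentiableOn hρ hf)) (f 1)]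
  exact congrArg _ (funext (eq_add_Q f))

/-- Here telescoping by `J_even_sub` requires a factor 2(x - 1), so the function becomes `Q f`. The
constant f(1) has no coefficient at positive indices, and the sum starts at `x + 1`, just as
`lowerEnd` exceeds `tilde` by 1 for even `n`. -/
theorem tsum_coef_of_even {f : ℂ → ℂ} {ρ : ℝ} (hρ : 1 < ρ)
    (hf : DifferentiableOn ℂ f (Metric.ball 0 ρ)) {n : ℕ} (hn : Even n) (x : ℕ) :
    ∑' k, coef (n + 1) (x + 1 + k) f = coef n x (Q f) := by
  have e1 : ∀ k, coef (n + 1) k f = coef 1 k f := fun k =>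
    coef_congr_parity (by simp [Nat.even_add_one, hn]) _ _
  have e2 : ∀ k, coef n k (Q f) = coef 0 k (Q f) := fun k =>
    coef_congr_parity (by simpa using hn) _ _
  rw [e2]
  simp only [e1]
  have := tsum_eq_of_telescoping (u := fun k => coef 1 (k + 1) f) (v := fun k => coef 0 k (Q f))
    (coef_odd_succ_eq hρ hf)
    ((summable_norm_coef hρ hf 1).of_norm.comp_injective (add_left_injective 1))
    (tendsto_coef hρ (Q_differentiableOn hρ hf) 0) x
  rw [← this]
  exact tsum_congr fun k => by rw [show x + 1 + k = x + k + 1 by ring]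

/-- This is the Chebyshev expansion evaluated at 1, where every polynomial of the third kind equals
1. It gives the row left behind by the particle that is summed over all of ℕ. -/
theorem tsum_coef_zero_of_even {f : ℂ → ℂ} {ρ : ℝ} (hρ : 1 < ρ)
    (hf : DifferentiableOn ℂ f (Metric.ball 0 ρ)) {n : ℕ} (hn : Even n) :
    ∑' k, coef (n + 1) k f = f 1 := by
  have e1 : ∀ k, coef (n + 1) k f = coef 1 k f := fun k =>
    coef_congr_parity (by simp [Nat.even_add_one, hn]) _ _
  rw [(summable_norm_coef hρ hf (n + 1)).of_norm.tsum_eq_zero_add]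
  have h := tsum_coef_of_even hρ hf hn 0
  simp only [zero_add, add_comm 1] at h
  rw [h, e1, coef_odd_zero_eq hρ hf, coef_congr_parity (n := n) (n' := 0) (by simpa using hn)]
  ring

end SymplecticPlancherel

end

noncomputable section

namespace SymplecticPlancherel

/-! ### Infinite products of linear factors -/

/-- The entire function `∏ (1 + cᵢ (x - 1))`. -/
def linProd (c : ℕ → ℝ) (x : ℂ) : ℂ := ∏' i, (1 + (c i : ℂ) * (x - 1))

theorem linProd_differentiable {c : ℕ → ℝ} (hc : Summable fun i => |c i|) :
    Differentiable ℂ (linProd c) := by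
  intro x
  obtain ⟨M, hM⟩ : ∃ M : ℝ, ‖x - 1‖ < M := exists_gt _
  have hopen : IsOpen (Metric.ball (1 : ℂ) M) := Metric.isOpen_ball
  have h := Summable.hasProdLocallyUniformlyOn_nat_one_add (R := ℂ)
    (f := fun i (y : ℂ) => (c i : ℂ) * (y - 1)) hopen (hc.mul_right M)
    (Filter.Eventually.of_forall fun i y hy => ?_) fun i => by fun_prop
  · have hd : DifferentiableOn ℂ (linProd c) (Metric.ball 1 M) := by
      refine TendstoLocallyUniformlyOn.differentiableOn h
        (Filter.Eventually.of_forall fun s => ?_) hopen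
      exact DifferentiableOn.fun_finsetProd fun i _ => by fun_prop
    exact hd.differentiableAt (hopen.mem_nhds (by simpa [dist_eq_norm] using hM))
  · rw [norm_mul, Complex.norm_real]
    rw [Metric.mem_ball, dist_eq_norm] at hy
    exact mul_le_mul_of_nonneg_left hy.le (abs_nonneg _)

theorem linProd_ne_zero {c : ℕ → ℝ} (hc : Summable fun i => |c i|) {x : ℂ}
    (h : ∀ i, 1 + (c i : ℂ) * (x - 1) ≠ 0) : linProd c x ≠ 0 := by
  refine tprod_one_add_ne_zero_of_summable h ((hc.mul_right ‖x - 1‖).congr fun i => ?_)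
  rw [norm_mul, Complex.norm_real, Real.norm_eq_abs]

theorem linProd_eq_zero {c : ℕ → ℝ} {x : ℂ} {i : ℕ} (h : 1 + (c i : ℂ) * (x - 1) = 0) :
    linProd c x = 0 := tprod_of_exists_eq_zero ⟨i, h⟩

theorem linProd_multipliable {c : ℕ → ℝ} (hc : Summable fun i => |c i|) (x : ℂ) :
    Multipliable fun i => 1 + (c i : ℂ) * (x - 1) := by
  refine multipliable_one_add_of_summable ((hc.mul_right ‖x - 1‖).congr fun i => ?_)
  rw [norm_mul, Complex.norm_real, Real.norm_eq_abs]

theorem linProd_eq_prod_mul {c : ℕ → ℝ} (hc : Summable fun i => |c i|) (N : ℕ) (x : ℂ) :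
    linProd c x = (∏ i ∈ Finset.range N, (1 + (c i : ℂ) * (x - 1))) *
      linProd (fun i => c (i + N)) x := by
  refine (Multipliable.prod_mul_tprod_nat_mul' ?_).symm
  exact linProd_multipliable (c := fun i => c (i + N))
    (hc.comp_injective (add_left_injective N)) x

theorem linProd_im {c : ℕ → ℝ} (hc : Summable fun i => |c i|) (x : ℝ) : (linProd c x).im = 0 := by
  have h := (linProd_multipliable hc (x : ℂ)).hasProd
  have hcl : IsClosed {z : ℂ | z.im = 0} := isClosed_eq Complex.continuous_im continuous_const
  refine hcl.mem_of_tendsto h (Filter.Eventually.of_forall fun s => ?_)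
  have : ∏ i ∈ s, (1 + (c i : ℂ) * ((x : ℂ) - 1)) =
      ((∏ i ∈ s, (1 + c i * (x - 1)) : ℝ) : ℂ) := by push_cast; rfl
  simp only [Set.mem_ofPred_eq, this, Complex.ofReal_im]

/-! ### The function `E` -/

/-- The coefficients of the linear factors in the numerator of `E`. -/
def numCoeff (ω : Param) (i : ℕ) : ℝ := ω.β i - ω.β i ^ 2 / 2

/-- The coefficients of the linear factors in the denominator of `E`, with the sign reversed. -/
def denCoeff (ω : Param) (i : ℕ) : ℝ := ω.α i + ω.α i ^ 2 / 2

theorem factor_β (ω : Param) (i : ℕ) (x : ℂ) :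
    factor (ω.β i) x = 1 + (numCoeff ω i : ℂ) * (x - 1) := by
  simp only [factor, numCoeff]; push_cast; ring

theorem factor_α (ω : Param) (i : ℕ) (x : ℂ) :
    factor (-ω.α i) x = 1 + ((-denCoeff ω i : ℝ) : ℂ) * (x - 1) := by
  simp only [factor, denCoeff]; push_cast; ring

theorem numCoeff_nonneg (ω : Param) (i : ℕ) : 0 ≤ numCoeff ω i := by
  have := ω.β_nonneg i; have := ω.β_le_one i
  simp only [numCoeff]; nlinarith

theorem numCoeff_le_half (ω : Param) (i : ℕ) : numCoeff ω i ≤ 1 / 2 := by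
  simp only [numCoeff]; nlinarith [sq_nonneg (1 - ω.β i)]

theorem numCoeff_le_zero_index (ω : Param) (i : ℕ) : numCoeff ω i ≤ numCoeff ω 0 := by
  have := ω.β_le_one 0; have := ω.β_antitone (Nat.zero_le i)
  simp only [numCoeff]; nlinarith

theorem numCoeff_zero_lt {ω : Param} (h : ω.β 0 < 1) : numCoeff ω 0 < 1 / 2 := by
  simp only [numCoeff]; nlinarith [mul_pos (sub_pos.2 h) (sub_pos.2 h)]

theorem denCoeff_nonneg (ω : Param) (i : ℕ) : 0 ≤ denCoeff ω i := by
  have := ω.α_nonneg i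
  simp only [denCoeff]; positivity

theorem denCoeff_le_zero_index (ω : Param) (i : ℕ) : denCoeff ω i ≤ denCoeff ω 0 := by
  have := ω.α_nonneg i; have := ω.α_antitone (Nat.zero_le i)
  simp only [denCoeff]; nlinarith

theorem numCoeff_summable (ω : Param) : Summable fun i => |numCoeff ω i| := by
  refine Summable.of_nonneg_of_le (fun _ => abs_nonneg _) (fun i => ?_) ω.β_summable
  rw [abs_of_nonneg (numCoeff_nonneg ω i)]
  simp only [numCoeff]; nlinarith [sq_nonneg (ω.β i)]

theorem denCoeff_summable (ω : Param) : Summable fun i => |(-denCoeff ω i)| := by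
  refine Summable.of_nonneg_of_le (fun _ => abs_nonneg _) (fun i => ?_)
    (ω.α_summable.mul_left (1 + ω.α 0 / 2))
  rw [abs_neg, abs_of_nonneg (denCoeff_nonneg ω i)]
  have := ω.α_nonneg i; have := ω.α_antitone (Nat.zero_le i)
  simp only [denCoeff]; nlinarith

theorem E_eq_of_not_isPole {ω : Param} {x : ℂ} (h : ¬ IsPole ω x) :
    E ω x = Complex.exp (ω.γ * (x - 1)) *
      (linProd (numCoeff ω) x / linProd (fun i => -denCoeff ω i) x) := by
  simp only [IsPole, not_exists, factor_α] at h
  have h2 := linProd_ne_zero (denCoeff_summable ω) h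
  unfold E
  simp only [factor_β, factor_α]
  congr 1
  exact (linProd_multipliable (numCoeff_summable ω) x).tprod_div₀
    (linProd_multipliable (denCoeff_summable ω) x) h2

theorem E_eq_zero_of_isPole {ω : Param} {x : ℂ} (h : IsPole ω x) : E ω x = 0 := by
  obtain ⟨i, hi⟩ := h
  unfold E
  rw [tprod_of_exists_eq_zero ⟨i, by simp [hi]⟩, mul_zero]

/-- No exception at the poles: there `E` takes the default value 0, its inverse is 0, and the
product of the denominators vanishes as well. -/
theorem E_inv (ω : Param) (x : ℂ) : (E ω x)⁻¹ = Complex.exp (-(ω.γ * (x - 1))) *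
    linProd (fun i => -denCoeff ω i) x / linProd (numCoeff ω) x := by
  by_cases h : IsPole ω x
  · rw [E_eq_zero_of_isPole h]
    obtain ⟨i, hi⟩ := h
    rw [factor_α] at hi
    rw [linProd_eq_zero hi]
    simp
  · rw [E_eq_of_not_isPole h, mul_inv, Complex.exp_neg, inv_div, mul_div_assoc]

/-- The zero is 1 - 1/c with 0 < c ≤ 1/2. Hence zeros never meet poles, which lie to the right of 1.
-/
theorem re_le_neg_one_of_factor_β {ω : Param} {i : ℕ} {x : ℂ} (h : factor (ω.β i) x = 0) :
    x.re ≤ -1 := by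
  rw [factor_β] at h
  have h1 := congrArg Complex.re h
  simp at h1
  have h2 := numCoeff_nonneg ω i
  have h3 := numCoeff_le_half ω i
  by_contra h4
  push Not at h4
  rcases h2.eq_or_lt with h5 | h5
  · rw [← h5] at h1; norm_num at h1
  · nlinarith

theorem one_lt_re_of_isPole {ω : Param} {x : ℂ} (h : IsPole ω x) : 1 < x.re := by
  obtain ⟨i, h⟩ := h
  rw [factor_α] at h
  have h1 := congrArg Complex.re h
  simp at h1
  have h2 := denCoeff_nonneg ω i
  by_contra h4
  push Not at h4
  nlinarith

theorem isZero_iff {ω : Param} {x : ℂ} : IsZero ω x ↔ ∃ i, factor (ω.β i) x = 0 := by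
  constructor
  · rintro ⟨h1, h2⟩
    by_contra h3
    push Not at h3
    simp only [factor_β] at h3
    have h4 := linProd_ne_zero (numCoeff_summable ω) h3
    rw [E_eq_of_not_isPole h1] at h2
    simp only [IsPole, not_exists, factor_α] at h1
    have h5 := linProd_ne_zero (denCoeff_summable ω) h1
    exact mul_ne_zero (Complex.exp_ne_zero _) (div_ne_zero h4 h5) h2
  · rintro ⟨i, hi⟩
    have hre := re_le_neg_one_of_factor_β hi
    have hp : ¬ IsPole ω x := fun hp => by linarith [one_lt_re_of_isPole hp]
    refine ⟨hp, ?_⟩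
    rw [E_eq_of_not_isPole hp]
    rw [factor_β] at hi
    rw [linProd_eq_zero hi]
    simp

theorem E_one (ω : Param) : E ω 1 = 1 := by
  simp [E, factor]

theorem E_im (ω : Param) {x : ℝ} (hx : x ≤ 1) : (E ω x).im = 0 := by
  have hp : ¬ IsPole ω (x : ℂ) := fun hp => by
    have := one_lt_re_of_isPole hp
    rw [Complex.ofReal_re] at this
    linarith
  rw [E_eq_of_not_isPole hp]
  have h1 := linProd_im (numCoeff_summable ω) x
  have h2 := linProd_im (denCoeff_summable ω) x
  have h3 : Complex.exp (ω.γ * ((x : ℂ) - 1)) = ((Real.exp (ω.γ * (x - 1)) : ℝ) : ℂ) := by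
    push_cast; rfl
  rw [h3, ← Complex.conj_eq_iff_im]
  rw [← Complex.conj_eq_iff_im] at h1 h2
  rw [map_mul, map_div₀, h1, h2, Complex.conj_ofReal]

/-- The zero nearest to the unit disk is 1 - 1/c₀ < -1, since c₀ < 1/2, and the nearest pole is 1 +
1/d₀ > 1. On the resulting disk both E and 1/E are holomorphic. -/
theorem exists_radius {ω : Param} (h : ω.β 0 < 1) : ∃ ρ : ℝ, 1 < ρ ∧
    (∀ x ∈ Metric.ball (0 : ℂ) ρ, ¬ IsPole ω x ∧ ¬ IsZero ω x) := by
  have hn := numCoeff_zero_lt h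
  have h1 : ∀ᶠ ρ in nhdsWithin (1 : ℝ) (Set.Ioi 1), numCoeff ω 0 * (1 + ρ) < 1 := by
    have hc : ContinuousAt (fun ρ : ℝ => numCoeff ω 0 * (1 + ρ)) 1 := by fun_prop
    exact (hc.eventually_lt continuousAt_const (by norm_num; linarith)).filter_mono
      nhdsWithin_le_nhds
  have h2 : ∀ᶠ ρ in nhdsWithin (1 : ℝ) (Set.Ioi 1), denCoeff ω 0 * (ρ - 1) < 1 := by
    have hc : ContinuousAt (fun ρ : ℝ => denCoeff ω 0 * (ρ - 1)) 1 := by fun_prop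
    exact (hc.eventually_lt continuousAt_const (by norm_num)).filter_mono nhdsWithin_le_nhds
  have h3 : ∀ᶠ ρ in nhdsWithin (1 : ℝ) (Set.Ioi 1), 1 < ρ := self_mem_nhdsWithin
  obtain ⟨ρ, h1, h2, h3⟩ := (h1.and (h2.and h3)).exists
  refine ⟨ρ, h3, fun x hx => ?_⟩
  rw [mem_ball_zero_iff] at hx
  have hre := abs_le.1 ((Complex.abs_re_le_norm x).trans hx.le)
  constructor
  · rintro ⟨i, hi⟩
    rw [factor_α] at hi
    have h4 := congrArg Complex.re hi
    simp at h4
    have := denCoeff_nonneg ω i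
    have := denCoeff_le_zero_index ω i
    nlinarith
  · rw [isZero_iff]
    rintro ⟨i, hi⟩
    rw [factor_β] at hi
    have h4 := congrArg Complex.re hi
    simp at h4
    have := numCoeff_nonneg ω i
    have := numCoeff_le_zero_index ω i
    nlinarith

theorem E_differentiableOn {ω : Param} {ρ : ℝ}
    (h : ∀ x ∈ Metric.ball (0 : ℂ) ρ, ¬ IsPole ω x ∧ ¬ IsZero ω x) :
    DifferentiableOn ℂ (E ω) (Metric.ball 0 ρ) := by
  refine DifferentiableOn.congr ?_ fun x hx => E_eq_of_not_isPole (h x hx).1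
  have h1 := (linProd_differentiable (numCoeff_summable ω)).differentiableOn (s := Metric.ball 0 ρ)
  have h2 := (linProd_differentiable (denCoeff_summable ω)).differentiableOn (s := Metric.ball 0 ρ)
  refine DifferentiableOn.mul (by fun_prop) (h1.div h2 fun x hx => ?_)
  refine linProd_ne_zero (denCoeff_summable ω) fun i hi => (h x hx).1 ⟨i, ?_⟩
  rw [factor_α, hi]

theorem E_ne_zero {ω : Param} {x : ℂ} (h : ¬ IsPole ω x ∧ ¬ IsZero ω x) : E ω x ≠ 0 :=
  fun h0 => h.2 ⟨h.1, h0⟩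

/-! ### Admissible loops -/

theorem contourIntegral_circle (c : ℂ) (R : ℝ) (f : ℂ → ℂ) :
    contourIntegral (fun t => circleMap c R (2 * Real.pi * t)) f = ∮ z in C(c, R), f z := by
  have hd : ∀ t : ℝ, deriv (fun t : ℝ => circleMap c R (2 * Real.pi * t)) t =
      2 * Real.pi * deriv (circleMap c R) (2 * Real.pi * t) := by
    intro t
    have hlin : HasDerivAt (fun t : ℝ => 2 * Real.pi * t) (2 * Real.pi) t := by
      simpa using (hasDerivAt_id t).const_mul (2 * Real.pi)
    have := (hasDerivAt_circleMap c R (2 * Real.pi * t)).scomp t hlin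
    rw [show (fun t : ℝ => circleMap c R (2 * Real.pi * t)) =
      circleMap c R ∘ fun t => 2 * Real.pi * t from rfl, this.deriv, deriv_circleMap]
    simp
  unfold contourIntegral circleIntegral
  have h := intervalIntegral.smul_integral_comp_mul_left (a := 0) (b := 1)
    (fun θ => deriv (circleMap c R) θ • f (circleMap c R θ)) (2 * Real.pi)
  rw [mul_zero, mul_one] at h
  rw [← h, ← intervalIntegral.integral_smul]
  refine intervalIntegral.integral_congr fun t _ => ?_
  simp only [hd, smul_eq_mul, Complex.real_smul]
  push_cast
  ring

theorem isSimpleLoop_circle (c : ℂ) {R : ℝ} (hR : R ≠ 0) :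
    IsSimpleLoop fun t => circleMap c R (2 * Real.pi * t) where
  closed := by simp [circleMap]
  injOn := by
    intro s hs t ht hst
    simp only at hst
    rw [circleMap_eq_circleMap_iff c hR] at hst
    obtain ⟨n, hn⟩ := hst
    have hpi : (2 * Real.pi * Complex.I : ℂ) ≠ 0 := Complex.two_pi_I_ne_zero
    have h1 : (s : ℂ) = t + n := by
      apply mul_left_cancel₀ hpi
      push_cast at hn
      linear_combination hn
    have h2 : s = t + n := by exact_mod_cast h1
    have h3 : n = 0 := by
      have h4 : (n : ℝ) < 1 := by linarith [hs.2, ht.1]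
      have h5 : (-1 : ℝ) < n := by linarith [hs.1, ht.2]
      have h6 : n < 1 := by exact_mod_cast h4
      have h7 : -1 < n := by exact_mod_cast h5
      omega
    simpa [h3] using h2
  piecewise := by
    refine ⟨1, fun i => if i = 0 then 0 else 1, ?_, by simp, by simp, fun i _ => ?_⟩
    · intro i j hij
      simp only
      split_ifs <;> first | omega | norm_num
    · have : ContDiff ℝ 1 fun t : ℝ => circleMap c R (2 * Real.pi * t) :=
        (contDiff_circleMap c R).comp (contDiff_const.mul contDiff_id)
      exact this.contDiffOn

/-- A circle about 1 works: [-1, 1] lies within distance 2 of 1, while every zero is at distance at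
least 1/c₀ > 2. -/
theorem exists_isAdmissible {ω : Param} (h : ω.β 0 < 1) : ∃ Γ : ℝ → ℂ, IsAdmissible ω Γ := by
  have hn := numCoeff_zero_lt h
  obtain ⟨R, hR2, hR⟩ : ∃ R : ℝ, 2 < R ∧ numCoeff ω 0 * R < 1 := by
    have hc : ContinuousAt (fun R : ℝ => numCoeff ω 0 * R) 2 := by fun_prop
    have h1 : ∀ᶠ R in nhdsWithin (2 : ℝ) (Set.Ioi 2), numCoeff ω 0 * R < 1 :=
      (hc.eventually_lt continuousAt_const (by linarith)).filter_mono nhdsWithin_le_nhds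
    have h2 : ∀ᶠ R in nhdsWithin (2 : ℝ) (Set.Ioi 2), 2 < R := self_mem_nhdsWithin
    obtain ⟨R, h1, h2⟩ := (h1.and h2).exists
    exact ⟨R, h2, h1⟩
  have hmem : ∀ a ∈ (fun t : ℝ => circleMap 1 R (2 * Real.pi * t)) '' Set.Icc 0 1, ‖a - 1‖ = R := by
    rintro a ⟨t, _, rfl⟩
    have := circleMap_mem_sphere (1 : ℂ) (by linarith : 0 ≤ R) (2 * Real.pi * t)
    simpa [dist_eq_norm] using this
  refine ⟨fun t => circleMap 1 R (2 * Real.pi * t), isSimpleLoop_circle 1 (by linarith), ?_, ?_⟩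
  · intro x hx
    have hx1 : ‖(x : ℂ) - 1‖ < R := by
      have : (x : ℂ) - 1 = ((x - 1 : ℝ) : ℂ) := by push_cast; rfl
      rw [this, Complex.norm_real, Real.norm_eq_abs, abs_lt]
      constructor <;> linarith [hx.1, hx.2]
    refine ⟨fun hm => hx1.ne (hmem _ hm), ?_⟩
    unfold winding
    rw [contourIntegral_circle]
    simp only [one_div]
    rw [circleIntegral.integral_sub_inv_of_mem_ball (by simpa [dist_eq_norm] using hx1)]
    exact inv_mul_cancel₀ Complex.two_pi_I_ne_zero
  · intro a ha
    obtain ⟨i, hi⟩ := isZero_iff.1 ha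
    rw [factor_β] at hi
    have ha1 : R < ‖a - 1‖ := by
      by_contra hle
      push Not at hle
      have h1 : ‖(numCoeff ω i : ℂ) * (a - 1)‖ = 1 := by
        rw [eq_neg_of_add_eq_zero_right hi]; simp
      rw [norm_mul, Complex.norm_of_nonneg (numCoeff_nonneg ω i)] at h1
      have := mul_le_mul (numCoeff_le_zero_index ω i) hle (norm_nonneg _)
        (numCoeff_nonneg ω 0)
      linarith
    refine ⟨fun hm => ha1.ne' (hmem _ hm), ?_⟩
    unfold winding
    rw [contourIntegral_circle, Complex.circleIntegral_eq_zero_of_differentiable_on_off_countable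
      (by linarith) Set.countable_empty, mul_zero]
    · refine ContinuousOn.div continuousOn_const (by fun_prop) fun z hz => ?_
      rw [Metric.mem_closedBall, dist_eq_norm] at hz
      intro h0
      rw [sub_eq_zero.1 h0] at hz
      linarith
    · intro z hz
      have hz1 := hz.1
      rw [Metric.mem_ball, dist_eq_norm] at hz1
      refine DifferentiableAt.div (by fun_prop) (by fun_prop) fun h0 => ?_
      rw [sub_eq_zero.1 h0] at hz1
      linarith

/-- If β₁ = 1, then -1 is a zero, which would need winding number 0 as a zero and 1 as a point of
[-1, 1]. -/
theorem β_zero_lt_one_of_isAdmissible {ω : Param} {Γ : ℝ → ℂ} (h : IsAdmissible ω Γ) :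
    ω.β 0 < 1 := by
  refine lt_of_le_of_ne (ω.β_le_one 0) fun h1 => ?_
  have hz : IsZero ω (-1) := isZero_iff.2 ⟨0, by rw [h1]; norm_num [factor]⟩
  have h2 := (h.zero_outside _ hz).2
  have h3 := (h.around (-1) (by norm_num)).2
  push_cast at h3
  rw [h2] at h3
  exact zero_ne_one h3

end SymplecticPlancherel

end

noncomputable section

namespace SymplecticPlancherel

/-! ### Andréief's identity and the coefficients of the extreme characters -/

/-- Expand both determinants and apply Fubini. For each permutation σ of the first, the sum over the
second is the determinant with rows permuted by σ, whose sign cancels; this leaves m! equal terms.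
-/
theorem integral_det_mul_det {m : ℕ} (μ : Measure ℝ) [SigmaFinite μ] (f g : Fin m → ℝ → ℝ)
    (h : ∀ i j, Integrable (fun x => f i x * g j x) μ) :
    ∫ θ : Fin m → ℝ, (Matrix.of fun i j => f i (θ j)).det * (Matrix.of fun i j => g i (θ j)).det
        ∂(Measure.pi fun _ => μ) =
      m.factorial * (Matrix.of fun i j => ∫ x, f i x * g j x ∂μ).det := by
  set M : Matrix (Fin m) (Fin m) ℝ := Matrix.of fun i j => ∫ x, f i x * g j x ∂μ
  have h1 : ∀ θ : Fin m → ℝ, (Matrix.of fun i j => f i (θ j)).det *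
      (Matrix.of fun i j => g i (θ j)).det = ∑ σ : Equiv.Perm (Fin m), ∑ τ : Equiv.Perm (Fin m),
        ((Equiv.Perm.sign σ : ℝ) * (Equiv.Perm.sign τ : ℝ)) *
          ∏ j, f (σ j) (θ j) * g (τ j) (θ j) := by
    intro θ
    rw [Matrix.det_apply', Matrix.det_apply', Finset.sum_mul_sum]
    refine Finset.sum_congr rfl fun σ _ => Finset.sum_congr rfl fun τ _ => ?_
    rw [Finset.prod_mul_distrib]
    simp only [Matrix.of_apply]
    ring
  have hint : ∀ σ τ : Equiv.Perm (Fin m), Integrable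
      (fun θ : Fin m → ℝ => ∏ j, f (σ j) (θ j) * g (τ j) (θ j)) (Measure.pi fun _ => μ) :=
    fun σ τ => Integrable.fintype_prod (f := fun j x => f (σ j) x * g (τ j) x) fun j => h _ _
  simp only [h1]
  rw [integral_finsetSum _ fun σ _ => integrable_finsetSum _ fun τ _ => (hint σ τ).const_mul _]
  have h2 : ∀ σ : Equiv.Perm (Fin m), ∫ θ : Fin m → ℝ, ∑ τ : Equiv.Perm (Fin m),
      ((Equiv.Perm.sign σ : ℝ) * (Equiv.Perm.sign τ : ℝ)) *
          ∏ j, f (σ j) (θ j) * g (τ j) (θ j) ∂(Measure.pi fun _ => μ) = M.det := by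
    intro σ
    rw [integral_finsetSum _ fun τ _ => (hint σ τ).const_mul _]
    simp only [integral_const_mul]
    have h3 : ∀ τ : Equiv.Perm (Fin m), ∫ θ : Fin m → ℝ, ∏ j, f (σ j) (θ j) * g (τ j) (θ j)
        ∂(Measure.pi fun _ => μ) = ∏ j, M (σ j) (τ j) := fun τ =>
      integral_fintype_prod_eq_prod (fun j x => f (σ j) x * g (τ j) x)
    simp only [h3]
    have h4 := Matrix.det_permute σ M
    rw [← Matrix.det_transpose, Matrix.det_apply'] at h4
    simp only [Matrix.transpose_apply, Matrix.submatrix_apply, id] at h4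
    simp only [mul_assoc, ← Finset.mul_sum]
    rw [h4, ← mul_assoc, ← Int.cast_mul, ← Units.val_mul, Int.units_mul_self]
    simp
  simp only [h2, Finset.sum_const, Finset.card_univ, Fintype.card_perm, Fintype.card_fin,
    nsmul_eq_mul]

theorem coef_E_mul_J {ω : Param} {n : ℕ} (hn : Even n) (k l : ℕ) :
    coef n k (fun x => E ω x * J l n x) =
      ((2 / Real.pi * ∫ θ in (0 : ℝ)..Real.pi, (E ω (Real.cos θ : ℂ)).re *
        Real.sin (((k : ℝ) + 1) * θ) * Real.sin (((l : ℝ) + 1) * θ) : ℝ) : ℂ) := by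
  rw [coef_even hn]
  have hJ : ∀ (j : ℕ) (x : ℝ), J j 0 x = (((Polynomial.Chebyshev.U ℝ j).eval x : ℝ) : ℂ) := by
    intro j x
    rw [Polynomial.Chebyshev.complex_ofReal_eval_U]
    simp [J]
  set g : ℝ → ℝ := fun x => (E ω (x : ℂ)).re * (Polynomial.Chebyshev.U ℝ l).eval x *
    ((1 - x ^ 2) * (Polynomial.Chebyshev.U ℝ k).eval x) with hg
  have h1 : arcInt (fun x => E ω x * J l n x * ((1 - x ^ 2) * J k 0 x)) =
      ((∫ x, g x ∂Polynomial.Chebyshev.measureT : ℝ) : ℂ) := by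
    rw [Polynomial.Chebyshev.integral_measureT, arcInt, ← intervalIntegral.integral_ofReal]
    refine intervalIntegral.integral_congr fun x hx => ?_
    rw [Set.uIcc_of_le (by norm_num)] at hx
    have hE : E ω (x : ℂ) = ((E ω (x : ℂ)).re : ℂ) :=
      Complex.ext rfl (by simpa using E_im ω hx.2)
    rw [J_congr (n := n) (n' := 0) (by simpa using hn)]
    simp only [hJ, hg]
    rw [hE]
    push_cast
    simp
  rw [h1, Polynomial.Chebyshev.integral_measureT_eq_integral_cos]
  rw [← Complex.ofReal_ofNat, ← Complex.ofReal_div, ← Complex.ofReal_mul]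
  congr 3
  funext θ
  have e1 := Polynomial.Chebyshev.U_real_cos θ k
  have e2 := Polynomial.Chebyshev.U_real_cos θ l
  push_cast at e1 e2
  rw [← e1, ← e2]
  simp only [hg]
  rw [← Real.sin_sq]
  ring

theorem continuous_re_E_cos {ω : Param} (h : ω.β 0 < 1) :
    Continuous fun θ : ℝ => (E ω (Real.cos θ : ℂ)).re := by
  obtain ⟨ρ, hρ, hball⟩ := exists_radius h
  refine Complex.continuous_re.comp ((E_differentiableOn hball).continuousOn.comp_continuous
    (Complex.continuous_ofReal.comp Real.continuous_cos) fun θ => ?_)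
  rw [mem_ball_zero_iff]
  simp only [Complex.norm_real]
  exact (Real.abs_cos_le_one θ).trans_lt hρ

theorem charInner_eq_det {ω : Param} (h : ω.β 0 < 1) {n : ℕ} (hn : Even n) (l : Part n) :
    (charInner n (extremeCharacter n ω) (character n l) : ℂ) =
      (Matrix.of fun i j : Fin (r n) =>
        coef n (tilde l i) fun x => E ω x * J (r n - 1 - j) n x).det := by
  set e : ℝ → ℝ := fun θ => (E ω (Real.cos θ : ℂ)).re with he
  have hec : Continuous e := continuous_re_E_cos h
  set f : Fin (r n) → ℝ → ℝ := fun i θ => e θ * Real.sin (((tilde l i : ℝ) + 1) * θ) with hf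
  set g : Fin (r n) → ℝ → ℝ := fun i θ => Real.sin (((r n : ℝ) - i) * θ) with hg
  have hbox : Set.Icc (0 : Fin (r n) → ℝ) (fun _ => Real.pi) =
      Set.univ.pi fun _ => Set.Icc 0 Real.pi := by
    rw [Set.pi_univ_Icc]; rfl
  have hint : ∀ θ : Fin (r n) → ℝ, extremeCharacter n ω θ * character n l θ * weylDenom n θ ^ 2 =
      (Matrix.of fun i j => f i (θ j)).det * (Matrix.of fun i j => g i (θ j)).det := by
    intro θ
    have h1 : (Matrix.of fun i j => f i (θ j)).det = (∏ j, e (θ j)) *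
        (Matrix.of fun i j : Fin (r n) => Real.sin (((tilde l i : ℝ) + 1) * θ j)).det := by
      rw [← Matrix.det_mul_row]
      rfl
    have h2 : (Matrix.of fun i j => g i (θ j)).det = weylDenom n θ := rfl
    rw [h1, h2]
    unfold extremeCharacter character
    -- Where the Weyl denominator vanishes, the character is a division by zero, but the squared
    -- denominator makes both sides 0.
    by_cases h0 : weylDenom n θ = 0
    · simp [h0]
    · field_simp
      exact mul_comm _ _
  have hint2 : ∀ i j, Integrable (fun x => f i x * g j x)
      (volume.restrict (Set.Icc 0 Real.pi)) := fun i j =>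
    (Continuous.integrableOn_Icc (by fun_prop) : IntegrableOn _ _ _)
  have key := integral_det_mul_det (volume.restrict (Set.Icc 0 Real.pi)) f g hint2
  have hfac : ((r n).factorial : ℝ) ≠ 0 := by positivity
  have hreal : charInner n (extremeCharacter n ω) (character n l) =
      (Matrix.of fun i j : Fin (r n) => 2 / Real.pi * ∫ θ in (0 : ℝ)..Real.pi,
        f i θ * g j θ).det := by
    unfold charInner
    simp only [hint]
    rw [hbox, volume_pi, Measure.restrict_pi_pi, key]
    have h3 : (Matrix.of fun i j : Fin (r n) => 2 / Real.pi * ∫ θ in (0 : ℝ)..Real.pi,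
        f i θ * g j θ) = (2 / Real.pi : ℝ) • (Matrix.of fun i j : Fin (r n) =>
          ∫ x in Set.Icc 0 Real.pi, f i x * g j x) := by
      ext i j
      simp only [Matrix.of_apply, Matrix.smul_apply, smul_eq_mul]
      rw [intervalIntegral.integral_of_le Real.pi_pos.le, integral_Icc_eq_integral_Ioc]
    rw [h3, Matrix.det_smul, Fintype.card_fin]
    field_simp
  rw [hreal, ← Complex.ofRealHom_eq_coe, RingHom.map_det]
  congr 1
  ext i j
  simp only [RingHom.mapMatrix_apply, Matrix.map_apply, Matrix.of_apply, Complex.ofRealHom_eq_coe]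
  rw [coef_E_mul_J hn]
  congr 3
  funext θ
  have hj := j.2
  have h4 : ((r n - 1 - (j : ℕ) : ℕ) : ℝ) + 1 = r n - j := by
    rw [Nat.sub_sub, Nat.cast_sub (by omega)]; push_cast; ring
  rw [h4]

theorem exists_monic_eval_eq_J (k n : ℕ) : ∃ p : Polynomial ℂ, p.Monic ∧ p.natDegree = k ∧
    ∀ x, J k n x = p.eval (2 * (x - 1)) := by
  induction k using Nat.twoStepInduction with
  | zero => exact ⟨1, Polynomial.monic_one, by simp, fun x => by simp [J_zero]⟩
  | one =>
    refine ⟨Polynomial.X + Polynomial.C (2 - if Even n then 0 else 1), Polynomial.monic_X_add_C _,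
      Polynomial.natDegree_X_add_C _, fun x => ?_⟩
    rw [J_one]
    split_ifs <;> simp <;> ring
  | more k h0 h1 =>
    obtain ⟨p, hp, hpd, hpe⟩ := h0
    obtain ⟨q, hq, hqd, hqe⟩ := h1
    have hX := Polynomial.monic_X_add_C (2 : ℂ)
    have hm := hX.mul hq
    have hd : ((Polynomial.X + Polynomial.C (2 : ℂ)) * q).natDegree = k + 2 := by
      rw [hX.natDegree_mul hq, Polynomial.natDegree_X_add_C, hqd]; ring
    have hlt : p.degree < ((Polynomial.X + Polynomial.C (2 : ℂ)) * q).degree := by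
      apply Polynomial.degree_lt_degree
      omega
    refine ⟨(Polynomial.X + Polynomial.C 2) * q - p, hm.sub_of_left hlt, ?_, fun x => ?_⟩
    · rw [Polynomial.natDegree_sub_eq_left_of_natDegree_lt (by omega), hd]
    · rw [J_add_two, hpe, hqe]
      simp only [Polynomial.eval_sub, Polynomial.eval_mul, Polynomial.eval_add, Polynomial.eval_X,
        Polynomial.eval_C]
      ring

/-- A triangular change of the columns. -/
theorem det_coef_mul_J_eq {f : ℂ → ℂ} (hf : ContI f) (n m : ℕ) (x : Fin m → ℕ) :
    (Matrix.of fun i j : Fin m => coef n (x i) fun z => f z * J (m - 1 - j) n z).det =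
      (Matrix.of fun i j : Fin m =>
        coef n (x i) fun z => (2 * (z - 1)) ^ (m - 1 - (j : ℕ)) * f z).det := by
  choose p hp hpd hpe using fun k => exists_monic_eval_eq_J k n
  set T : Matrix (Fin m) (Fin m) ℂ := Matrix.of fun l j => (p (m - 1 - j)).coeff (m - 1 - l)
  have hT : T.det = 1 := by
    rw [Matrix.det_of_isLowerTriangular]
    · refine Finset.prod_eq_one fun i _ => ?_
      have := (hp (m - 1 - i)).coeff_natDegree
      rwa [hpd] at this
    · intro i j hij
      have h1 := i.2
      have h2 := j.2
      have hij' : (i : ℕ) < j := by simpa using hij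
      refine Polynomial.coeff_eq_zero_of_natDegree_lt ?_
      rw [hpd]
      omega
  suffices h : (Matrix.of fun i j : Fin m => coef n (x i) fun z => f z * J (m - 1 - j) n z) =
      (Matrix.of fun i j : Fin m =>
        coef n (x i) fun z => (2 * (z - 1)) ^ (m - 1 - (j : ℕ)) * f z) * T by
    rw [h, Matrix.det_mul, hT, mul_one]
  ext i j
  have hj := j.2
  have h1 : (fun z => f z * J (m - 1 - j) n z) = fun z => ∑ l : Fin m,
      (p (m - 1 - j)).coeff (m - 1 - l) * ((2 * (z - 1)) ^ (m - 1 - (l : ℕ)) * f z) := by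
    funext z
    rw [hpe, Polynomial.eval_eq_sum_range' (n := m) (by rw [hpd]; omega), Finset.sum_range,
      Finset.mul_sum, ← Equiv.sum_comp Fin.revPerm]
    refine Finset.sum_congr rfl fun l _ => ?_
    have : ((Fin.revPerm l : Fin m) : ℕ) = m - 1 - l := by
      rw [Fin.revPerm_apply, Fin.val_rev]; omega
    rw [this]
    ring
  rw [Matrix.of_apply, h1, coef_sum, Matrix.mul_apply]
  · refine Finset.sum_congr rfl fun l _ => ?_
    rw [coef_const_mul, mul_comm]
    rfl
  · intro l _
    exact (contI_of_continuous continuous_const).mul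
      ((contI_of_continuous (by fun_prop : Continuous fun z : ℂ => (2 * (z - 1)) ^ (m - 1 - (l : ℕ)))).mul hf)

end SymplecticPlancherel

end

noncomputable section

namespace SymplecticPlancherel

open scoped ComplexOrder

/-! ### Positivity of the coefficients of the extreme characters -/

/-- All determinants `det[coef 0 (x i) (f J_{m-1-j})]` with `x` strictly decreasing are
nonnegative. -/
def CoefDetNonneg (m : ℕ) (f : ℂ → ℂ) : Prop :=
  DetNonneg fun k (j : Fin m) => coef 0 k fun x => f x * J (m - 1 - j) 0 x

/-- By orthonormality the entries are Kronecker deltas of `x i` and `m - 1 - j`. Since `x i ≥ m - 1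
- i`, the matrix is lower triangular with diagonal entries 0 or 1. -/
theorem coefDetNonneg_one (m : ℕ) : CoefDetNonneg m fun _ => 1 := by
  intro x hx
  have hge : ∀ d (i : Fin m), m - 1 - i = d → d ≤ x i := by
    intro d
    induction d with
    | zero => intro i _; exact Nat.zero_le _
    | succ d ih =>
      intro i hi
      have hi2 : (i : ℕ) + 1 < m := by omega
      have h1 := ih ⟨i + 1, hi2⟩ (by simp; omega)
      have h2 : x ⟨i + 1, hi2⟩ < x i := hx (by simp [Fin.lt_def])
      omega
  simp only [one_mul, coef_J]
  rw [Matrix.det_of_isLowerTriangular]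
  · refine Finset.prod_nonneg fun i _ => ?_
    simp only [Matrix.of_apply]
    split_ifs <;> simp
  · intro i j hij
    have hij' : (i : ℕ) < j := by simpa using hij
    have h1 := hge _ i rfl
    have h2 := j.2
    simp only [Matrix.of_apply]
    rw [if_neg (by omega)]

theorem coef_linear_mul (c : ℂ) {f : ℂ → ℂ} (hf : ContI f) (k : ℕ) :
    coef 0 k (fun x => (1 + c * (x - 1)) * f x) = (1 - c) * coef 0 k f +
      c / 2 * (coef 0 (k + 1) f + if k = 0 then 0 else coef 0 (k - 1) f) := by
  have h : (fun x => (1 + c * (x - 1)) * f x) =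
      fun x => (1 - c) * f x + c / 2 * (2 * x * f x) := by funext x; ring
  have hc : ∀ c : ℂ, ContI fun _ => c := fun c => contI_of_continuous continuous_const
  rw [h, coef_add 0 k ((hc _).mul hf) ((hc _).mul (((hc 2).mul contI_id).mul hf)), coef_const_mul,
    coef_const_mul]
  rcases k with _ | k
  · rw [coef_two_mul_zero 0 hf]
    simp
  · rw [coef_two_mul_succ 0 k hf]
    simp

/-- Write c = 2pq with p + q = 1. Multiplication by 1 + c(x - 1) has the tridiagonal matrix with
diagonal p² + q² and off-diagonal pq, which factors into two nonnegative bidiagonal steps. With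
`add_pred` applied first, the row of index 0 is also correct. -/
theorem CoefDetNonneg.mul_linear {m : ℕ} {f : ℂ → ℂ} (hf : ContI f) (h : CoefDetNonneg m f)
    {c : ℝ} (hc0 : 0 ≤ c) (hc : c ≤ 1 / 2) :
    CoefDetNonneg m fun x => (1 + (c : ℂ) * (x - 1)) * f x := by
  -- The smaller root of q(1 - q) = c/2, real because c ≤ 1/2. For `c = numCoeff ω i` it is βᵢ/2,
  -- and the factorization is the one in the variable z.
  obtain ⟨q, hq0, hq1, hq⟩ : ∃ q : ℝ, 0 ≤ q ∧ q ≤ 1 ∧ c = 2 * ((1 - q) * q) := by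
    have h1 : √(1 - 2 * c) ≤ 1 := Real.sqrt_le_one.2 (by linarith)
    have h2 := Real.sqrt_nonneg (1 - 2 * c)
    have h3 := Real.sq_sqrt (show 0 ≤ 1 - 2 * c by linarith)
    exact ⟨(1 - √(1 - 2 * c)) / 2, by linarith, by linarith, by nlinarith⟩
  have hqc : (0 : ℂ) ≤ q := by exact_mod_cast hq0
  have hpc : (0 : ℂ) ≤ ((1 - q : ℝ) : ℂ) := by exact_mod_cast sub_nonneg.2 hq1
  have h2 := (DetNonneg.add_pred h hpc hqc).add_succ hpc hqc
  unfold CoefDetNonneg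
  convert h2 using 3 with k j
  simp only [mul_assoc]
  rw [coef_linear_mul _ (hf.mul (contI_J _ _)), hq]
  rcases k with _ | k <;> simp <;> ring

theorem contI_inv_linear {d : ℝ} (hd : 0 ≤ d) :
    ContI fun x => (1 - (d : ℂ) * (x - 1))⁻¹ := by
  have h : ContI fun x => 1 - (d : ℂ) * (x - 1) := contI_of_continuous (by fun_prop)
  refine ContinuousOn.inv₀ h fun x hx h0 => ?_
  have := congrArg Complex.re h0
  simp at this
  nlinarith [hx.2]

theorem one_sub_linear_ne_zero {d : ℝ} (hd : 0 ≤ d) {x : ℝ} (hx : x ∈ Set.Icc (-1 : ℝ) 1) :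
    1 - (d : ℂ) * ((x : ℂ) - 1) ≠ 0 := by
  intro h0
  have := congrArg Complex.re h0
  simp at this
  nlinarith [hx.2]

theorem ContI.exists_bound {f : ℂ → ℂ} (hf : ContI f) :
    ∃ M, ∀ x ∈ Set.Icc (-1 : ℝ) 1, ‖f x‖ ≤ M :=
  isCompact_Icc.exists_bound_of_continuousOn hf

/-- With d = 2q(1 + q), multiplication by 1 - d(x - 1) is a product of two bidiagonal operators with
diagonal 1 + q and off-diagonal -q. They are inverted one after the other, by `solve_succ` and
`solve_pred`. -/
theorem CoefDetNonneg.div_linear {m : ℕ} {f : ℂ → ℂ} (hf : ContI f) (h : CoefDetNonneg m f)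
    {d : ℝ} (hd : 0 ≤ d) :
    CoefDetNonneg m fun x => (1 - (d : ℂ) * (x - 1))⁻¹ * f x := by
  obtain ⟨q, hq0, hq⟩ : ∃ q : ℝ, 0 ≤ q ∧ d = 2 * ((1 + q) * q) := by
    have h1 : 1 ≤ √(1 + 2 * d) := Real.one_le_sqrt.2 (by linarith)
    have h3 := Real.sq_sqrt (show 0 ≤ 1 + 2 * d by linarith)
    exact ⟨(√(1 + 2 * d) - 1) / 2, by linarith, by nlinarith⟩
  have hp : 0 < 1 + q := by linarith
  have hpc : ((1 + q : ℝ) : ℂ) ≠ 0 := by exact_mod_cast hp.ne'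
  set g : Fin m → ℂ → ℂ := fun j x => (1 - (d : ℂ) * (x - 1))⁻¹ * f x * J (m - 1 - j) 0 x
  have hg : ∀ j, ContI (g j) := fun j => ((contI_inv_linear hd).mul hf).mul (contI_J _ _)
  set b : ℕ → Fin m → ℂ := fun k j => coef 0 k (g j) with hb
  set c : ℕ → Fin m → ℂ := fun k j => (1 + q : ℝ) * b k j - if k = 0 then 0 else q * b (k - 1) j
    with hc
  have hfb : ∀ k (j : Fin m), coef 0 k (fun x => f x * J (m - 1 - j) 0 x) =
      (1 + q : ℝ) * c k j - q * c (k + 1) j := by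
    intro k j
    have h1 : coef 0 k (fun x => f x * J (m - 1 - j) 0 x) =
        coef 0 k fun x => (1 + ((-d : ℝ) : ℂ) * (x - 1)) * g j x := by
      refine coef_congr 0 k fun x hx => ?_
      have h0 := one_sub_linear_ne_zero hd hx
      simp only [g]
      push_cast
      rw [neg_mul, ← sub_eq_add_neg, mul_assoc, mul_inv_cancel_left₀ h0]
    rw [h1, coef_linear_mul _ (hg j), hq]
    rcases k with _ | k <;> simp [hc, hb] <;> ring
  -- The upward recursion has no starting value; boundedness is what lets its tail be dropped in
  -- `solve_succ`.
  obtain ⟨M, hM⟩ : ∃ M, ∀ k j, ‖c k j‖ ≤ M := by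
    choose B hB using fun j => (hg j).exists_bound
    have hBb : ∀ k j, ‖b k j‖ ≤ B j * 4 := fun k j => norm_coef_even_le (hg j) (hB j) k
    have hB0 : ∀ j, 0 ≤ B j := fun j => (norm_nonneg _).trans (hB j 0 (by norm_num))
    refine ⟨∑ j, ((1 + q) * (B j * 4) + q * (B j * 4)), fun k j => ?_⟩
    refine le_trans ?_ (Finset.single_le_sum
      (f := fun j => (1 + q) * (B j * 4) + q * (B j * 4)) (fun i _ => ?_) (Finset.mem_univ j))
    · refine (norm_sub_le _ _).trans (add_le_add ?_ ?_)
      · rw [norm_mul, Complex.norm_of_nonneg hp.le]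
        exact mul_le_mul_of_nonneg_left (hBb _ _) hp.le
      · split_ifs
        · rw [norm_zero]; have := hB0 j; positivity
        · rw [norm_mul, Complex.norm_of_nonneg hq0]
          exact mul_le_mul_of_nonneg_left (hBb _ _) hq0
    · have := hB0 i; positivity
  have hc' : DetNonneg c := by
    refine DetNonneg.solve_succ h (w := 1 / (1 + q)) (ρ := q / (1 + q)) (by positivity)
      (by positivity) (by rw [div_lt_one hp]; linarith) (fun k j => ?_) hM
    rw [hfb]
    push_cast at hpc ⊢
    field_simp
    ring
  refine DetNonneg.solve_pred hc' (w := 1 / (1 + q)) (ρ := q / (1 + q)) (by positivity)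
    (by positivity) (fun j => ?_) (fun k j => ?_)
  · change b 0 j = _ * c 0 j
    simp only [hc, if_true]
    push_cast at hpc ⊢
    field_simp
    ring
  · change b (k + 1) j = _ * c (k + 1) j + _ * b k j
    simp only [hc, Nat.succ_ne_zero, if_false, Nat.add_sub_cancel]
    push_cast at hpc ⊢
    field_simp
    ring

theorem tendsto_coef_of_dominated {f : ℕ → ℂ → ℂ} {g : ℂ → ℂ} (hf : ∀ N, ContI (f N))
    {M : ℝ} (hM : ∀ᶠ N in Filter.atTop, ∀ x ∈ Set.Icc (-1 : ℝ) 1, ‖f N x‖ ≤ M)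
    (hlim : ∀ x ∈ Set.Icc (-1 : ℝ) 1,
      Filter.Tendsto (fun N => f N x) Filter.atTop (nhds (g x))) (n k : ℕ) :
    Filter.Tendsto (fun N => coef n k (f N)) Filter.atTop (nhds (coef n k g)) := by
  obtain ⟨B, hB⟩ := (contI_weightPoly n k).exists_bound
  simp only [coef_eq]
  refine Filter.Tendsto.const_mul _ ?_
  have hsub : ∀ x ∈ Set.uIoc (-1 : ℝ) 1, x ∈ Set.Icc (-1 : ℝ) 1 := fun x hx => by
    rw [Set.uIoc_of_le (by norm_num)] at hx
    exact ⟨hx.1.le, hx.2⟩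
  refine intervalIntegral.tendsto_integral_filter_of_dominated_convergence
    (fun x => M * B * √(1 - x ^ 2)⁻¹) ?_ ?_ ?_ ?_
  · refine Filter.Eventually.of_forall fun N => ?_
    have := ((hf N).mul (contI_weightPoly n k)).intervalIntegrable.def'
    exact this.aestronglyMeasurable
  · filter_upwards [hM] with N hN
    refine Filter.Eventually.of_forall fun x hx => ?_
    have h1 := hN x (hsub x hx)
    have h2 := hB x (hsub x hx)
    rw [norm_mul, Complex.norm_of_nonneg (Real.sqrt_nonneg _), norm_mul]
    exact mul_le_mul_of_nonneg_right (mul_le_mul h1 h2 (norm_nonneg _)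
      ((norm_nonneg _).trans h1)) (Real.sqrt_nonneg _)
  · exact Polynomial.Chebyshev.intervalIntegrable_sqrt_one_sub_sq_inv.const_mul _
  · refine Filter.Eventually.of_forall fun x hx => ?_
    exact ((hlim x (hsub x hx)).mul_const _).mul_const _

theorem tendsto_det {m : ℕ} {A : ℕ → Matrix (Fin m) (Fin m) ℂ} {B : Matrix (Fin m) (Fin m) ℂ}
    (h : ∀ i j, Filter.Tendsto (fun N => A N i j) Filter.atTop (nhds (B i j))) :
    Filter.Tendsto (fun N => (A N).det) Filter.atTop (nhds B.det) := by
  simp only [Matrix.det_apply']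
  exact tendsto_finsetSum _ fun σ _ => (tendsto_finsetProd _ fun i _ => h _ _).const_mul _

theorem CoefDetNonneg.of_tendsto {m : ℕ} {f : ℕ → ℂ → ℂ} {g : ℂ → ℂ} (hf : ∀ N, ContI (f N))
    (h : ∀ᶠ N in Filter.atTop, CoefDetNonneg m (f N)) {M : ℝ}
    (hM : ∀ᶠ N in Filter.atTop, ∀ x ∈ Set.Icc (-1 : ℝ) 1, ‖f N x‖ ≤ M)
    (hlim : ∀ x ∈ Set.Icc (-1 : ℝ) 1,
      Filter.Tendsto (fun N => f N x) Filter.atTop (nhds (g x))) : CoefDetNonneg m g := by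
  intro x hx
  have hdet : Filter.Tendsto (fun N => (Matrix.of fun i j : Fin m =>
      coef 0 (x i) fun z => f N z * J (m - 1 - j) 0 z).det) Filter.atTop
      (nhds (Matrix.of fun i j : Fin m => coef 0 (x i) fun z => g z * J (m - 1 - j) 0 z).det) := by
    refine tendsto_det fun i j => ?_
    obtain ⟨B, hB⟩ := (contI_J (m - 1 - j) 0).exists_bound
    refine tendsto_coef_of_dominated (f := fun N z => f N z * J (m - 1 - j) 0 z)
      (g := fun z => g z * J (m - 1 - j) 0 z) (M := M * B) (fun N => (hf N).mul (contI_J _ _)) ?_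
      (fun z hz => (hlim z hz).mul_const _) 0 (x i)
    filter_upwards [hM] with N hN z hz
    rw [norm_mul]
    exact mul_le_mul (hN z hz) (hB z hz) (norm_nonneg _) ((norm_nonneg _).trans (hN z hz))
  exact ge_of_tendsto hdet (h.mono fun N hN => hN x hx)

/-- Finite approximations of `E`. -/
def approxE (ω : Param) (N : ℕ) (x : ℂ) : ℂ :=
  (1 + ((ω.γ / N : ℝ) : ℂ) * (x - 1)) ^ N *
    ∏ i ∈ Finset.range N, ((1 + (numCoeff ω i : ℂ) * (x - 1)) *
      (1 - (denCoeff ω i : ℂ) * (x - 1))⁻¹)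

theorem norm_linear_le_one {c : ℝ} (hc0 : 0 ≤ c) (hc : c ≤ 1 / 2) {x : ℝ}
    (hx : x ∈ Set.Icc (-1 : ℝ) 1) : ‖1 + (c : ℂ) * ((x : ℂ) - 1)‖ ≤ 1 := by
  have : 1 + (c : ℂ) * ((x : ℂ) - 1) = ((1 + c * (x - 1) : ℝ) : ℂ) := by push_cast; rfl
  rw [this, Complex.norm_real, Real.norm_eq_abs, abs_le]
  constructor <;> nlinarith [hx.1, hx.2]

theorem norm_inv_linear_le_one {d : ℝ} (hd : 0 ≤ d) {x : ℝ}
    (hx : x ∈ Set.Icc (-1 : ℝ) 1) : ‖(1 - (d : ℂ) * ((x : ℂ) - 1))⁻¹‖ ≤ 1 := by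
  have : 1 - (d : ℂ) * ((x : ℂ) - 1) = ((1 + d * (1 - x) : ℝ) : ℂ) := by push_cast; ring
  have h1 : 1 ≤ 1 + d * (1 - x) := by nlinarith [hx.2]
  rw [this, norm_inv, Complex.norm_real, Real.norm_eq_abs, abs_of_nonneg (by linarith)]
  exact inv_le_one_of_one_le₀ h1

theorem eventually_div_le (γ : ℝ) : ∀ᶠ N : ℕ in Filter.atTop, γ / N ≤ 1 / 2 :=
  (tendsto_const_div_atTop_nhds_zero_nat γ).eventually_le_const (by norm_num)

theorem contI_pow {f : ℂ → ℂ} (hf : ContI f) (N : ℕ) : ContI fun x => f x ^ N :=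
  ContinuousOn.pow hf N

theorem contI_linear (c : ℂ) : ContI fun x => 1 + c * (x - 1) :=
  contI_of_continuous (by fun_prop)

theorem contI_prod_factors (ω : Param) (N : ℕ) : ContI fun x =>
    ∏ i ∈ Finset.range N, ((1 + (numCoeff ω i : ℂ) * (x - 1)) *
      (1 - (denCoeff ω i : ℂ) * (x - 1))⁻¹) :=
  continuousOn_finsetProd _ fun i _ =>
    (contI_linear _).mul (contI_inv_linear (denCoeff_nonneg ω i))

theorem coefDetNonneg_prod_factors (ω : Param) (m N : ℕ) : CoefDetNonneg m fun x =>
    ∏ i ∈ Finset.range N, ((1 + (numCoeff ω i : ℂ) * (x - 1)) *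
      (1 - (denCoeff ω i : ℂ) * (x - 1))⁻¹) := by
  induction N with
  | zero => simpa using coefDetNonneg_one m
  | succ N ih =>
    have hc := contI_prod_factors ω N
    have h1 := (ih.div_linear hc (denCoeff_nonneg ω N)).mul_linear
      ((contI_inv_linear (denCoeff_nonneg ω N)).mul hc) (numCoeff_nonneg ω N)
      (numCoeff_le_half ω N)
    convert h1 using 2 with x
    rw [Finset.prod_range_succ]
    ring

theorem CoefDetNonneg.mul_linear_pow {m : ℕ} {f : ℂ → ℂ} (hf : ContI f) (h : CoefDetNonneg m f)
    {c : ℝ} (hc0 : 0 ≤ c) (hc : c ≤ 1 / 2) (N : ℕ) :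
    CoefDetNonneg m fun x => (1 + (c : ℂ) * (x - 1)) ^ N * f x := by
  induction N with
  | zero => simpa using h
  | succ N ih =>
    have h1 := ih.mul_linear ((contI_pow (contI_linear _) N).mul hf) hc0 hc
    convert h1 using 2 with x
    ring

/-- On [-1, 1], `E` is the pointwise limit of `approxE`, with the exponential as the limit of (1 +
γ(x - 1)/N)^N. Once γ/N ≤ 1/2, every linear factor is of the type handled above and all factors have
modulus at most 1, so dominated convergence applies. -/
theorem coefDetNonneg_E (ω : Param) (m : ℕ) : CoefDetNonneg m (E ω) := by
  refine CoefDetNonneg.of_tendsto (f := approxE ω) (M := 1) (fun N => ?_) ?_ ?_ ?_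
  · exact (contI_pow (contI_linear _) N).mul (contI_prod_factors ω N)
  · filter_upwards [eventually_div_le ω.γ] with N hN
    exact (coefDetNonneg_prod_factors ω m N).mul_linear_pow (contI_prod_factors ω N)
      (div_nonneg ω.γ_nonneg (Nat.cast_nonneg N)) hN N
  · filter_upwards [eventually_div_le ω.γ] with N hN x hx
    unfold approxE
    rw [norm_mul, norm_pow, norm_prod]
    refine mul_le_one₀ (pow_le_one₀ (norm_nonneg _)
      (norm_linear_le_one (div_nonneg ω.γ_nonneg (Nat.cast_nonneg N)) hN hx))
      (Finset.prod_nonneg fun i _ => norm_nonneg _)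
      (Finset.prod_le_one (fun i _ => norm_nonneg _) fun i _ => ?_)
    rw [norm_mul]
    exact mul_le_one₀ (norm_linear_le_one (numCoeff_nonneg ω i) (numCoeff_le_half ω i) hx)
      (norm_nonneg _) (norm_inv_linear_le_one (denCoeff_nonneg ω i) hx)
  · intro x hx
    have hp : ¬ IsPole ω (x : ℂ) := fun hp => by
      have := one_lt_re_of_isPole hp
      rw [Complex.ofReal_re] at this
      linarith [hx.2]
    have hd : linProd (fun i => -denCoeff ω i) (x : ℂ) ≠ 0 := by
      simp only [IsPole, not_exists, factor_α] at hp
      exact linProd_ne_zero (denCoeff_summable ω) hp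
    rw [E_eq_of_not_isPole hp, div_eq_mul_inv]
    have h1 := Complex.tendsto_one_add_div_pow_exp ((ω.γ : ℂ) * ((x : ℂ) - 1))
    have h2 := (linProd_multipliable (numCoeff_summable ω) (x : ℂ)).hasProd.tendsto_prod_nat
    have h3 := ((linProd_multipliable (denCoeff_summable ω) (x : ℂ)).hasProd.tendsto_prod_nat).inv₀
      hd
    refine (h1.mul (h2.mul h3)).congr fun N => ?_
    unfold approxE
    rw [Finset.prod_mul_distrib, Finset.prod_inv_distrib]
    congr 1
    · push_cast
      ring
    · congr 2
      refine Finset.prod_congr rfl fun i _ => ?_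
      push_cast
      ring

end SymplecticPlancherel

end

noncomputable section

namespace SymplecticPlancherel

/-! ### Summation over levels, from the top to the bottom -/

section Levels

variable {R k : ℕ} (f : Fin R → ℂ → ℂ) (z : Fin k → ℕ × ℕ+) (t : ℂ) (B : Matrix (Fin k) (Fin R) ℂ)

/-- The Chebyshev polynomial of a site. -/
def siteJ (w : ℕ × ℕ+) : ℂ → ℂ := J w.1 w.2

/-- The functions whose coefficients describe level `n`, including the perturbation at level `n`. -/
def geFun (n : ℕ) (j : Fin R) (x : ℂ) : ℂ :=
  Q^[R - r n] (f j) x + t * ∑ a, if n ≤ ((z a).2 : ℕ) then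
    B a j * Q^[r (z a).2 - r n] (siteJ (z a)) x else 0

/-- The functions whose coefficients describe level `n`, without the perturbation at level `n`. -/
def gtFun (n : ℕ) (j : Fin R) (x : ℂ) : ℂ :=
  Q^[R - r n] (f j) x + t * ∑ a, if n < ((z a).2 : ℕ) then
    B a j * Q^[r (z a).2 - r n] (siteJ (z a)) x else 0

variable {f} {ρ : ℝ}

theorem siteJ_differentiableOn (w : ℕ × ℕ+) : DifferentiableOn ℂ (siteJ w) (Metric.ball 0 ρ) :=
  (J_differentiable _ _).differentiableOn

theorem differentiableOn_ite_Q (hρ : 1 < ρ) (p : Prop) [Decidable p] (c : ℂ) (i : ℕ)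
    (w : ℕ × ℕ+) : DifferentiableOn ℂ (fun x => if p then c * Q^[i] (siteJ w) x else 0)
      (Metric.ball 0 ρ) := by
  split_ifs
  · exact (Q_iterate_differentiableOn hρ (siteJ_differentiableOn w) i).const_mul c
  · exact differentiableOn_const 0

theorem geFun_differentiableOn (hρ : 1 < ρ) (hf : ∀ j, DifferentiableOn ℂ (f j) (Metric.ball 0 ρ))
    (n : ℕ) (j : Fin R) : DifferentiableOn ℂ (geFun f z t B n j) (Metric.ball 0 ρ) :=
  (Q_iterate_differentiableOn hρ (hf j) _).add ((DifferentiableOn.fun_sum fun _ _ =>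
    differentiableOn_ite_Q hρ _ _ _ _).const_mul t)

theorem gtFun_differentiableOn (hρ : 1 < ρ) (hf : ∀ j, DifferentiableOn ℂ (f j) (Metric.ball 0 ρ))
    (n : ℕ) (j : Fin R) : DifferentiableOn ℂ (gtFun f z t B n j) (Metric.ball 0 ρ) :=
  (Q_iterate_differentiableOn hρ (hf j) _).add ((DifferentiableOn.fun_sum fun _ _ =>
    differentiableOn_ite_Q hρ _ _ _ _).const_mul t)

theorem r_succ_of_not_even {n : ℕ} (hn : ¬ Even n) : r (n + 1) = r n := by
  rw [Nat.not_even_iff_odd] at hn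
  obtain ⟨c, rfl⟩ := hn
  unfold r; omega

theorem r_succ_of_even {n : ℕ} (hn : Even n) : r (n + 1) = r n + 1 := by
  obtain ⟨c, rfl⟩ := hn
  unfold r; omega

theorem r_mono {m n : ℕ} (h : m ≤ n) : r m ≤ r n := by
  unfold r; omega

theorem gtFun_of_not_even {n : ℕ} (hn : ¬ Even n) (j : Fin R) :
    gtFun f z t B n j = geFun f z t B (n + 1) j := by
  funext x
  simp only [gtFun, geFun, r_succ_of_not_even hn, Nat.succ_le_iff]

/-- The iteration exponents of `Q` count how many particles have disappeared since the top level, or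
since the level of the site; each step down to an even level raises them by one. -/
theorem gtFun_of_even (hρ : 1 < ρ) (hf : ∀ j, DifferentiableOn ℂ (f j) (Metric.ball 0 ρ))
    {n : ℕ} (hn : Even n) (hR : r (n + 1) ≤ R) (j : Fin R) :
    gtFun f z t B n j = Q (geFun f z t B (n + 1) j) := by
  have hQ : Q (geFun f z t B (n + 1) j) = fun x => Q (Q^[R - r (n + 1)] (f j)) x +
      t * ∑ a, Q (fun x => if n + 1 ≤ ((z a).2 : ℕ) then
        B a j * Q^[r (z a).2 - r (n + 1)] (siteJ (z a)) x else 0) x := by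
    have hd : ∀ a, DifferentiableOn ℂ (fun x => if n + 1 ≤ ((z a).2 : ℕ) then
        B a j * Q^[r (z a).2 - r (n + 1)] (siteJ (z a)) x else 0) (Metric.ball 0 ρ) :=
      fun a => differentiableOn_ite_Q hρ _ _ _ _
    have hs : DifferentiableOn ℂ (fun x => ∑ a, if n + 1 ≤ ((z a).2 : ℕ) then
        B a j * Q^[r (z a).2 - r (n + 1)] (siteJ (z a)) x else 0) (Metric.ball 0 ρ) :=
      DifferentiableOn.fun_sum fun a _ => hd a
    have h1 := Q_iterate_sum Finset.univ hρ (fun a _ => hd a) 1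
    simp only [Function.iterate_one] at h1
    have h2 := Q_add hρ (Q_iterate_differentiableOn hρ (hf j) (R - r (n + 1))) (hs.const_mul t)
    rw [Q_const_mul hρ hs t, h1] at h2
    exact h2
  rw [hQ]
  funext x
  simp only [gtFun]
  rw [r_succ_of_even hn] at hR ⊢
  rw [show R - r n = R - (r n + 1) + 1 by omega, Function.iterate_succ_apply']
  congr 2
  refine Finset.sum_congr rfl fun a _ => ?_
  by_cases ha : n + 1 ≤ ((z a).2 : ℕ)
  · have h1 : r n + 1 ≤ r (z a).2 := by
      rw [← r_succ_of_even hn]; exact r_mono ha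
    simp only [ha, if_true, Nat.lt_iff_add_one_le]
    rw [Q_const_mul hρ (Q_iterate_differentiableOn hρ (siteJ_differentiableOn _) _),
      show r (z a).2 - r n = r (z a).2 - (r n + 1) + 1 by omega, Function.iterate_succ_apply']
  · simp only [ha, if_false, Nat.lt_iff_add_one_le, Q_zero]

variable (f)

/-- The rows that belong to the particles that disappear. -/
def virtualRow (i j : Fin R) : ℂ := geFun f z t B (2 * i + 1) j 1

/-- The sum of the weights of all continuations above level `n`, with the weight of level `n`. -/
def geDet (n : ℕ) (l : Part n) : ℂ :=
  (rowsMatrix (fun i j => coef n (tilde l i) (geFun f z t B n j)) (virtualRow f z t B)).det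

/-- The sum of the weights of all continuations above level `n`. -/
def gtDet (n : ℕ) (l : Part n) : ℂ :=
  (rowsMatrix (fun i j => coef n (tilde l i) (gtFun f z t B n j)) (virtualRow f z t B)).det

variable {f}

/-- One step down: the tail sums in the rows of surviving particles become coefficients at level
`n`, and for even `n` the row of the last particle joins the virtual rows. -/
theorem hasSum_geDet (hρ : 1 < ρ) (hf : ∀ j, DifferentiableOn ℂ (f j) (Metric.ball 0 ρ))
    {n : ℕ} (hR : r (n + 1) ≤ R) (l : Part n) :
    HasSum (fun m : {m : Part (n + 1) // Interlaces l m} => geDet f z t B (n + 1) m.1)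
      (gtDet f z t B n l) := by
  have hd := geFun_differentiableOn z t B hρ hf (n + 1)
  have h := hasSum_det_interlaces hR l (fun y j => coef (n + 1) y (geFun f z t B (n + 1) j))
    (fun j => summable_norm_coef hρ (hd j) (n + 1)) (virtualRow f z t B)
  have heq : (rowsMatrix (fun i : Fin (r (n + 1)) => fun j => ∑' y,
      coef (n + 1) (lowerEnd l i + y) (geFun f z t B (n + 1) j)) (virtualRow f z t B)) =
      rowsMatrix (fun i j => coef n (tilde l i) (gtFun f z t B n j)) (virtualRow f z t B) := by
    ext i j
    simp only [rowsMatrix, Matrix.of_apply]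
    by_cases hn : Even n
    · have hr := r_succ_of_even hn
      by_cases hi : (i : ℕ) < r n
      · rw [dif_pos (by omega), dif_pos hi, gtFun_of_even z t B hρ hf hn hR,
          ← tsum_coef_of_even hρ (hd j) hn]
        have : lowerEnd l i = tilde l ⟨i, hi⟩ + 1 := by
          have := part_val l ⟨i, hi⟩
          simp only [lowerEnd, tilde, ← this]
          omega
        rw [this]
      · rw [dif_neg hi]
        by_cases hi2 : (i : ℕ) < r (n + 1)
        · rw [dif_pos hi2, virtualRow]
          have h0 : lowerEnd l i = 0 := by
            simp only [lowerEnd, part, hi, dite_false]; omega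
          -- The disappearing particle has index `r n`, and `2 * r n + 1` is the first level that
          -- contains a particle with this index.
          have h1 : 2 * (i : ℕ) + 1 = n + 1 := by
            obtain ⟨c, rfl⟩ := hn
            unfold r at hi hi2; omega
          simp only [h0, zero_add, h1]
          exact tsum_coef_zero_of_even hρ (hd j) hn
        · rw [dif_neg hi2]
    · have hr := r_succ_of_not_even hn
      by_cases hi : (i : ℕ) < r n
      · rw [dif_pos (by omega), dif_pos hi, gtFun_of_not_even z t B hn,
          ← tsum_coef_of_odd hρ (hd j) hn]
        have : lowerEnd l i = tilde l ⟨i, hi⟩ := by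
          have := part_val l ⟨i, hi⟩
          simp only [lowerEnd, tilde, ← this]
          omega
        rw [this]
      · rw [dif_neg hi, dif_neg (by omega)]
  rw [heq] at h
  exact h

open Classical in
/-- The weight `1 + t` of the sites `z`. -/
def siteWeight (n x : ℕ) : ℂ := if ∃ a, ((z a).2 : ℕ) = n ∧ (z a).1 = x then 1 + t else 1

theorem geFun_eq (n : ℕ) (j : Fin R) : geFun f z t B n j = fun x => gtFun f z t B n j x +
    t * ∑ a, if n = ((z a).2 : ℕ) then B a j * siteJ (z a) x else 0 := by
  funext x
  simp only [geFun, gtFun, add_assoc, ← mul_add, ← Finset.sum_add_distrib]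
  congr 2
  refine Finset.sum_congr rfl fun a _ => ?_
  rcases lt_trichotomy n ((z a).2 : ℕ) with h | h | h
  · simp [h.le, h, h.ne]
  · simp [← h]
  · simp [not_le.2 h, not_lt.2 h.le, h.ne']

/-- By orthonormality the added term t·B·J changes only the coefficient at its own site, and `hB`
says that it adds t times this coefficient. Injectivity of `z` prevents a site from being counted
twice. -/
theorem coef_geFun (hρ : 1 < ρ) (hf : ∀ j, DifferentiableOn ℂ (f j) (Metric.ball 0 ρ))
    (hz : Function.Injective z)
    (hB : ∀ a j, B a j = coef (z a).2 (z a).1 (gtFun f z t B (z a).2 j)) (n x : ℕ) (j : Fin R) :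
    coef n x (geFun f z t B n j) = siteWeight z t n x * coef n x (gtFun f z t B n j) := by
  have hJ : ∀ a, ContI fun x => if n = ((z a).2 : ℕ) then B a j * siteJ (z a) x else 0 := by
    intro a
    refine contI_of_continuous ?_
    have := (J_differentiable (z a).1 (z a).2).continuous
    unfold siteJ
    split_ifs <;> fun_prop
  rw [geFun_eq, coef_add _ _ (contI_of_differentiableOn hρ (gtFun_differentiableOn z t B hρ hf n j))
    ((contI_of_continuous continuous_const).mul (ContI.sum _ fun a _ => hJ a)), coef_const_mul,
    coef_sum _ _ _ fun a _ => hJ a]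
  have h1 : ∀ a, coef n x (fun x => if n = ((z a).2 : ℕ) then B a j * siteJ (z a) x else 0) =
      if ((z a).2 : ℕ) = n ∧ (z a).1 = x then coef n x (gtFun f z t B n j) else 0 := by
    intro a
    by_cases ha : n = ((z a).2 : ℕ)
    · subst ha
      simp only [if_true, true_and]
      rw [coef_const_mul, siteJ, coef_J]
      by_cases hx : (z a).1 = x
      · rw [if_pos hx.symm, if_pos hx, hB a j, hx, mul_one]
      · rw [if_neg (Ne.symm hx), if_neg hx, mul_zero]
    · rw [if_neg fun h => ha h.1.symm]
      simp only [ha, if_false]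
      simp [coef]
  simp only [h1, siteWeight]
  split_ifs with h
  · obtain ⟨a, ha⟩ := h
    rw [Finset.sum_eq_single a, if_pos ha]
    · ring
    · intro b _ hba
      rw [if_neg]
      rintro ⟨hb1, hb2⟩
      exact hba (hz (Prod.ext (hb2.trans ha.2.symm) (PNat.eq (hb1.trans ha.1.symm))))
    · exact fun h => absurd (Finset.mem_univ _) h
  · rw [Finset.sum_eq_zero]
    · ring
    · intro a _
      exact if_neg fun h' => h ⟨a, h'⟩

theorem geDet_eq (hρ : 1 < ρ) (hf : ∀ j, DifferentiableOn ℂ (f j) (Metric.ball 0 ρ))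
    (hz : Function.Injective z)
    (hB : ∀ a j, B a j = coef (z a).2 (z a).1 (gtFun f z t B (z a).2 j)) {n : ℕ} (hR : r n ≤ R)
    (l : Part n) : geDet f z t B n l = (∏ i, siteWeight z t n (tilde l i)) * gtDet f z t B n l := by
  have h1 := prod_rows hR (fun i => siteWeight z t n (tilde l i)) (fun _ => 1)
  simp only [ite_self, Finset.prod_const_one, mul_one] at h1
  rw [gtDet, ← h1, ← Matrix.det_mul_column, geDet]
  congr 1
  ext i j
  simp only [rowsMatrix, Matrix.of_apply]
  split_ifs with hi
  · exact coef_geFun z t B hρ hf hz hB n _ j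
  · rw [one_mul]

theorem gtDet_top {N : ℕ} (hN : r N = R) (hz : ∀ a, ((z a).2 : ℕ) ≤ N) (l : Part N) :
    gtDet f z t B N l = (Matrix.of fun i j : Fin R => coef N (tilde l (i.cast hN.symm)) (f j)).det := by
  unfold gtDet
  congr 1
  ext i j
  have hi : (i : ℕ) < r N := by have := i.2; omega
  simp only [rowsMatrix, Matrix.of_apply, hi, dite_true]
  refine congrArg _ (funext fun x => ?_)
  simp [gtFun, hN, not_lt.2 (hz _)]

theorem geDet_zero (l : Part 0) :
    geDet f z t B 0 l = (Matrix.of fun i j => virtualRow f z t B i j).det := by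
  unfold geDet
  congr 1

end Levels

end SymplecticPlancherel

end

noncomputable section

namespace SymplecticPlancherel

/-! ### Plancherel measures divided by dimensions -/

theorem dim_pos (n : ℕ) (l : Part n) : 0 < dim n l := by
  have key : ∀ c d : ℝ, 0 < c → d < 1 → 0 < ∏ i : Fin (r n), ∏ j ∈ Finset.Ioi i,
      (((tilde l i : ℝ) + c) ^ 2 - ((tilde l j : ℝ) + c) ^ 2) /
        (((r n : ℝ) - i - d) ^ 2 - ((r n : ℝ) - j - d) ^ 2) := by
    intro c d hc hd
    refine Finset.prod_pos fun i _ => Finset.prod_pos fun j hj => div_pos ?_ ?_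
    · have h : (tilde l j : ℝ) < tilde l i := by
        exact_mod_cast tilde_strictAnti l (Finset.mem_Ioi.1 hj)
      have h0 : (0 : ℝ) ≤ tilde l j := Nat.cast_nonneg _
      nlinarith
    · have h : (i : ℝ) < j := by exact_mod_cast Finset.mem_Ioi.1 hj
      have h0 : (j : ℝ) + 1 ≤ r n := by exact_mod_cast j.2
      nlinarith
  unfold dim
  split_ifs
  · refine mul_pos (by simpa using key 1 0 one_pos one_pos) (Finset.prod_pos fun i _ => ?_)
    have h0 : (i : ℝ) + 1 ≤ r n := by exact_mod_cast i.2
    exact div_pos (by positivity) (by linarith)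
  · exact key (1 / 2) (1 / 2) (by norm_num) (by norm_num)

/-- The probability that level `n` is `l`, divided by the number of paths from level `0` to `l`. -/
def pathProb (ω : Param) (n : ℕ) (l : Part n) : ℝ := plancherel ω n l / dim n l

theorem pathProb_of_even (ω : Param) {n : ℕ} (hn : Even n) (l : Part n) :
    pathProb ω n l = charInner n (extremeCharacter n ω) (character n l) := by
  rw [pathProb, plancherel, if_pos hn, plancherelEven, mul_div_cancel_right₀ _ (dim_pos n l).ne']

theorem pathProb_of_not_even (ω : Param) {n : ℕ} (hn : ¬ Even n) (l : Part n) :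
    pathProb ω n l = ∑' m : {m : Part (n + 1) // Interlaces l m}, pathProb ω (n + 1) m.1 := by
  have hn1 : Even (n + 1) := by simpa [Nat.even_add_one] using hn
  rw [pathProb, plancherel, if_neg hn, ← tsum_div_const]
  refine tsum_congr fun m => ?_
  rw [pathProb, plancherel, if_pos hn1]
  have := (dim_pos n l).ne'
  field_simp

/-- The functions whose coefficients give `pathProb`, for matrices of size `R`. -/
def baseFun (ω : Param) (R : ℕ) (j : Fin R) (x : ℂ) : ℂ :=
  (2 * (x - 1)) ^ (R - 1 - (j : ℕ)) * E ω x

theorem exists_E_differentiableOn {ω : Param} (h : ω.β 0 < 1) :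
    ∃ ρ : ℝ, 1 < ρ ∧ DifferentiableOn ℂ (E ω) (Metric.ball 0 ρ) ∧
      ∀ x ∈ Metric.ball (0 : ℂ) ρ, E ω x ≠ 0 := by
  obtain ⟨ρ, hρ, hb⟩ := exists_radius h
  exact ⟨ρ, hρ, E_differentiableOn hb, fun x hx => E_ne_zero (hb x hx)⟩

theorem pathProb_eq_det {ω : Param} (h : ω.β 0 < 1) {n : ℕ} (hn : Even n) (l : Part n) :
    (pathProb ω n l : ℂ) =
      (Matrix.of fun i j : Fin (r n) => coef n (tilde l i) (baseFun ω (r n) j)).det := by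
  obtain ⟨ρ, hρ, hE, -⟩ := exists_E_differentiableOn h
  rw [pathProb_of_even ω hn, charInner_eq_det h hn]
  exact det_coef_mul_J_eq (contI_of_differentiableOn hρ hE) n (r n) (tilde l)

theorem pathProb_nonneg {ω : Param} (h : ω.β 0 < 1) (n : ℕ) (l : Part n) :
    0 ≤ pathProb ω n l := by
  have heven : ∀ {n : ℕ}, Even n → ∀ l : Part n, 0 ≤ pathProb ω n l := by
    intro n hn l
    have h1 := coefDetNonneg_E ω (r n) (tilde l) (tilde_strictAnti l)
    have hJ : ∀ k, J k n = J k 0 := fun k => J_congr (by simp [hn])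
    have h2 : (pathProb ω n l : ℂ) = (Matrix.of fun i j : Fin (r n) =>
        coef 0 (tilde l i) fun x => E ω x * J (r n - 1 - j) 0 x).det := by
      rw [pathProb_of_even ω hn, charInner_eq_det h hn]
      simp only [hJ, coef_congr_parity (show Even n ↔ Even 0 by simp [hn])]
    rw [← h2] at h1
    exact_mod_cast h1
  by_cases hn : Even n
  · exact heven hn l
  · rw [pathProb_of_not_even ω hn]
    exact tsum_nonneg fun m => heven (by simpa [Nat.even_add_one] using hn) _

theorem pathProb_zero {ω : Param} (h : ω.β 0 < 1) (l : Part 0) : pathProb ω 0 l = 1 := by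
  have h1 := pathProb_eq_det h Even.zero l
  rw [Matrix.det_eq_one_of_card_eq_zero (by simp [r])] at h1
  exact_mod_cast h1

theorem baseFun_differentiableOn {ω : Param} {ρ : ℝ}
    (hE : DifferentiableOn ℂ (E ω) (Metric.ball 0 ρ)) (R : ℕ) (j : Fin R) :
    DifferentiableOn ℂ (baseFun ω R j) (Metric.ball 0 ρ) :=
  differentiableOn_pow_mul hE _

theorem gtDet_eq_pathProb {ω : Param} (h : ω.β 0 < 1) {k : ℕ} (z : Fin k → ℕ × ℕ+) (t : ℂ)
    {R : ℕ} (B : Matrix (Fin k) (Fin R) ℂ) {N : ℕ} (hN : r N = R) (hev : Even N)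
    (hz : ∀ a, ((z a).2 : ℕ) ≤ N) (l : Part N) :
    gtDet (baseFun ω R) z t B N l = pathProb ω N l := by
  subst hN
  rw [gtDet_top z t B rfl hz, pathProb_eq_det h hev]
  rfl

/-- Without sites the two kinds of determinants coincide, so the summation over levels specializes
to coherence of the measures. -/
theorem geDet_elim0 {R : ℕ} (f : Fin R → ℂ → ℂ) (B : Matrix (Fin 0) (Fin R) ℂ) (n : ℕ)
    (l : Part n) : geDet f Fin.elim0 0 B n l = gtDet f Fin.elim0 0 B n l := by
  unfold geDet gtDet
  simp only [geFun_eq]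
  simp

theorem hasSum_pathProb_of_not_even {ω : Param} (h : ω.β 0 < 1) {n : ℕ} (hn : ¬ Even n)
    (l : Part n) :
    HasSum (fun m : {m : Part (n + 1) // Interlaces l m} => (pathProb ω (n + 1) m.1 : ℂ))
      (pathProb ω n l) ∧
    (pathProb ω n l : ℂ) = gtDet (baseFun ω (r n)) Fin.elim0 0 0 n l := by
  obtain ⟨ρ, hρ, hE, -⟩ := exists_E_differentiableOn h
  have hn1 : Even (n + 1) := by simpa [Nat.even_add_one] using hn
  have hr := r_succ_of_not_even hn
  have h1 := hasSum_geDet Fin.elim0 0 0 hρ (baseFun_differentiableOn hE (r n)) hr.le l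
  simp only [geDet_elim0, gtDet_eq_pathProb h Fin.elim0 0 0 hr hn1 (fun a => a.elim0)] at h1
  have h2 : (pathProb ω n l : ℂ) = gtDet (baseFun ω (r n)) Fin.elim0 0 0 n l := by
    rw [← h1.tsum_eq, pathProb_of_not_even ω hn, Complex.ofReal_tsum]
  exact ⟨h2 ▸ h1, h2⟩

theorem det_rowsMatrix_last {R : ℕ} (a : Fin R → Fin (R + 1) → ℂ)
    (w : Fin (R + 1) → Fin (R + 1) → ℂ) (hw : ∀ j : Fin R, w (Fin.last R) j.castSucc = 0)
    (hw1 : w (Fin.last R) (Fin.last R) = 1) :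
    (rowsMatrix a w).det = (Matrix.of fun i j : Fin R => a i j.castSucc).det := by
  rw [Matrix.det_succ_row _ (Fin.last R), Fin.sum_univ_castSucc]
  have h1 : ∀ j, rowsMatrix a w (Fin.last R) j = w (Fin.last R) j := by
    intro j; simp [rowsMatrix]
  simp only [h1, hw, hw1, mul_zero, zero_mul, Finset.sum_const_zero, zero_add, mul_one]
  rw [show (-1 : ℂ) ^ ((Fin.last R : ℕ) + (Fin.last R : ℕ)) = 1 from Even.neg_one_pow ⟨_, rfl⟩,
    one_mul]
  congr 1
  ext i j
  simp [rowsMatrix, Fin.succAbove_last]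

/-- For even `n` the new virtual row consists of the values at 1 of (2(x - 1))^(R-1-j) E, that is
(0, …, 0, 1) because E(1) = 1. Expansion along it deletes the last column, and in the other columns
`Q` removes one factor 2(x - 1), which gives the determinant of level `n`. -/
theorem hasSum_pathProb {ω : Param} (h : ω.β 0 < 1) (n : ℕ) (l : Part n) :
    HasSum (fun m : {m : Part (n + 1) // Interlaces l m} => pathProb ω (n + 1) m.1)
      (pathProb ω n l) := by
  by_cases hn : Even n
  swap
  · exact_mod_cast (hasSum_pathProb_of_not_even h hn l).1
  obtain ⟨ρ, hρ, hE, -⟩ := exists_E_differentiableOn h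
  have hn1 : ¬ Even (n + 1) := by simpa [Nat.even_add_one] using hn
  have hr := r_succ_of_even hn
  have h1 := hasSum_geDet Fin.elim0 0 0 hρ (baseFun_differentiableOn hE (r (n + 1))) le_rfl l
  simp only [geDet_elim0, ← (hasSum_pathProb_of_not_even h hn1 _).2] at h1
  have h2 : gtDet (baseFun ω (r (n + 1))) Fin.elim0 0 0 n l = pathProb ω n l := by
    have hgt : ∀ j, gtFun (baseFun ω (r (n + 1))) Fin.elim0 0 0 n j =
        Q (baseFun ω (r (n + 1)) j) := by
      intro j; funext x; simp [gtFun, hr]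
    have hv : ∀ i : Fin (r (n + 1)), (i : ℕ) = r n → ∀ j,
        virtualRow (baseFun ω (r (n + 1))) Fin.elim0 0 0 i j = baseFun ω (r (n + 1)) j 1 := by
      intro i hi j
      have : r (2 * r n + 1) = r (n + 1) := by
        obtain ⟨c, rfl⟩ := hn; unfold r; omega
      simp [virtualRow, geFun, hi, this]
    rw [pathProb_eq_det h hn, gtDet]
    simp only [hgt]
    generalize virtualRow (baseFun ω (r (n + 1))) Fin.elim0 0 0 = w at hv
    generalize r (n + 1) = R at *
    subst hr
    rw [det_rowsMatrix_last]
    · congr 1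
      ext i j
      simp only [Matrix.of_apply]
      congr 1
      have : baseFun ω (r n + 1) j.castSucc = fun x => 2 * (x - 1) * baseFun ω (r n) j x := by
        funext x
        simp only [baseFun, Fin.val_castSucc]
        rw [show r n + 1 - 1 - (j : ℕ) = r n - 1 - j + 1 by omega, pow_succ]
        ring
      rw [this, Q_mul_self hρ (baseFun_differentiableOn hE _ _)]
    · intro j
      rw [hv _ (Fin.val_last _)]
      have : r n - (j : ℕ) ≠ 0 := by omega
      simp [baseFun, this]
    · rw [hv _ (Fin.val_last _)]
      simp [baseFun, E_one]
  rw [h2] at h1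
  exact_mod_cast h1

end SymplecticPlancherel

end

noncomputable section

namespace SymplecticPlancherel

/-! ### The central measure on sequences of partitions -/

section Trajectories

open ProbabilityTheory Preorder Finset

variable {X : ℕ → Type*} [∀ n, MeasurableSpace (X n)] [∀ n, MeasurableSingletonClass (X n)]

/-- The chain rule for atoms: the probability of a finite path is multiplied by one transition
probability. -/
theorem partialTraj_succ_singleton (κ : (n : ℕ) → Kernel (Π i : Iic n, X i) (X (n + 1)))
    [∀ n, IsMarkovKernel (κ n)] (n : ℕ) (x₀ : Π i : Iic 0, X i) (u : Π n, X n) :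
    Kernel.partialTraj κ 0 (n + 1) x₀ {frestrictLe (n + 1) u} =
      Kernel.partialTraj κ 0 n x₀ {frestrictLe n u} * κ n (frestrictLe n u) {u (n + 1)} := by
  have hM := Kernel.IsMarkovKernel.map (κ n) (MeasurableEquiv.piSingleton n).measurable
  have hpre : IicProdIoc n (n + 1) ⁻¹' {frestrictLe (n + 1) u} =
      {frestrictLe n u} ×ˢ (MeasurableEquiv.piSingleton n '' {u (n + 1)}) := by
    ext ⟨x, y⟩
    simp only [Set.mem_preimage, Set.mem_singleton_iff, Set.mem_prod, Set.image_singleton]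
    constructor
    · intro h
      constructor
      · funext i
        have hi := mem_Iic.1 i.2
        have := congrFun h ⟨i, mem_Iic.2 (hi.trans n.le_succ)⟩
        simpa [IicProdIoc, hi] using this
      · funext i
        obtain ⟨i, hi⟩ := i
        obtain rfl : i = n + 1 := by
          have := mem_Ioc.1 hi; omega
        have := congrFun h ⟨n + 1, mem_Iic.2 le_rfl⟩
        simpa [IicProdIoc, MeasurableEquiv.piSingleton] using this
    · rintro ⟨rfl, rfl⟩
      funext i
      obtain ⟨i, hi⟩ := i
      by_cases h : i ≤ n
      · simp [IicProdIoc, h]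
      · obtain rfl : i = n + 1 := by
          have := mem_Iic.1 hi; omega
        simp [IicProdIoc, MeasurableEquiv.piSingleton]
  rw [Kernel.partialTraj_succ_of_le (Nat.zero_le n), Kernel.map_apply' _ (by fun_prop) _
    (measurableSet_singleton _), hpre, Kernel.comp_apply' _ _ _ (by measurability)]
  have hint : ∀ x, (Kernel.id ×ₖ (κ n).map (MeasurableEquiv.piSingleton n)) x
      ({frestrictLe n u} ×ˢ (MeasurableEquiv.piSingleton n '' {u (n + 1)})) =
      Set.indicator {frestrictLe n u} (fun _ => κ n (frestrictLe n u) {u (n + 1)}) x := by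
    intro x
    rw [Kernel.prod_apply_prod, Kernel.id_apply, Kernel.map_apply' _ (by fun_prop) _
      (by measurability), (MeasurableEquiv.piSingleton n).injective.preimage_image,
      Measure.dirac_apply' _ (measurableSet_singleton _)]
    by_cases hx : x = frestrictLe n u
    · simp [hx]
    · simp [Set.indicator, hx]
  simp only [hint]
  rw [lintegral_indicator_const (measurableSet_singleton _), mul_comm]

theorem traj_cylinder (κ : (n : ℕ) → Kernel (Π i : Iic n, X i) (X (n + 1)))
    [∀ n, IsMarkovKernel (κ n)] (n : ℕ) (x₀ : Π i : Iic 0, X i) (u : Π n, X n) :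
    Kernel.traj κ 0 x₀ {t | ∀ m ≤ n, t m = u m} =
      Kernel.partialTraj κ 0 n x₀ {frestrictLe n u} := by
  rw [← Kernel.traj_map_frestrictLe_apply, Measure.map_apply (by fun_prop)
    (measurableSet_singleton _)]
  congr 1
  ext t
  simp only [Set.mem_ofPred_eq, Set.mem_preimage, Set.mem_singleton_iff, funext_iff]
  simp

end Trajectories

/-! ### Transition probabilities between consecutive levels; existence and uniqueness of the law. -/

instance (n : ℕ) : Nonempty (Part n) := ⟨⟨fun _ => 0, fun _ _ _ => le_rfl⟩⟩

instance : Subsingleton (Part 0) := ⟨fun a b => Subtype.ext (funext fun i => absurd i.2 (by simp [r]))⟩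

open Classical in
theorem hasSum_ite_interlaces {ω : Param} (h : ω.β 0 < 1) {n : ℕ} {l : Part n}
    (hl : pathProb ω n l ≠ 0) :
    HasSum (fun m => ENNReal.ofReal
      (if Interlaces l m then pathProb ω (n + 1) m / pathProb ω n l else 0)) 1 := by
  have h1 := (hasSum_pathProb h n l).div_const (pathProb ω n l)
  rw [div_self hl] at h1
  have h2 : HasSum (fun m => if Interlaces l m then pathProb ω (n + 1) m / pathProb ω n l else 0)
      1 := by
    convert (hasSum_subtype_iff_indicator (s := {m | Interlaces l m})
      (f := fun m => pathProb ω (n + 1) m / pathProb ω n l)).1 h1 using 1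
    funext m
    simp [Set.indicator]
  have hnn : ∀ m, 0 ≤ if Interlaces l m then pathProb ω (n + 1) m / pathProb ω n l else 0 := by
    intro m
    split_ifs
    · exact div_nonneg (pathProb_nonneg h _ _) (pathProb_nonneg h _ _)
    · exact le_rfl
  have := ENNReal.ofReal_tsum_of_nonneg hnn h2.summable
  rw [h2.tsum_eq, ENNReal.ofReal_one] at this
  rw [this]
  exact ENNReal.summable.hasSum

open Classical in
/-- The conditional law of level `n + 1` at a partition `l` of positive probability. -/
def nextLawOfNeZero {ω : Param} (h : ω.β 0 < 1) {n : ℕ} {l : Part n} (hl : pathProb ω n l ≠ 0) :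
    PMF (Part (n + 1)) :=
  ⟨_, hasSum_ite_interlaces h hl⟩

open Classical in
/-- The conditional law of level `n + 1`, given level `n`. -/
def nextLaw {ω : Param} (h : ω.β 0 < 1) (n : ℕ) (l : Part n) : PMF (Part (n + 1)) :=
  if hl : pathProb ω n l ≠ 0 then nextLawOfNeZero h hl
  -- Partitions of probability zero are almost surely not visited, so any law serves here.
  else PMF.pure (Classical.arbitrary _)

open ProbabilityTheory in
/-- The transition kernels of the levels. -/
def nextKernel {ω : Param} (h : ω.β 0 < 1) (n : ℕ) :
    Kernel ((i : Finset.Iic n) → Part i) (Part (n + 1)) :=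
  (Kernel.ofFunOfCountable fun l : Part n => (nextLaw h n l).toMeasure).comap
    (fun x => x ⟨n, Finset.mem_Iic.2 le_rfl⟩) (measurable_pi_apply _)

instance {ω : Param} (h : ω.β 0 < 1) (n : ℕ) : ProbabilityTheory.IsMarkovKernel (nextKernel h n) :=
  ⟨fun x => by
    change IsProbabilityMeasure (nextLaw h n _).toMeasure
    infer_instance⟩

/-- The law of the sequence of partitions. -/
def plancherelLaw {ω : Param} (h : ω.β 0 < 1) : Measure Seqs :=
  ProbabilityTheory.Kernel.traj (nextKernel h) 0 fun _ => Classical.arbitrary _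

open Classical in
theorem weight_succ (n : ℕ) (u : Seqs) :
    weight (n + 1) u = weight n u * if Interlaces (u n) (u (n + 1)) then 1 else 0 := by
  unfold weight
  simp only [Nat.lt_succ_iff_lt_or_eq, or_imp, forall_and, forall_eq]
  split_ifs <;> simp_all

open Classical in
theorem plancherelLaw_cylinder {ω : Param} (h : ω.β 0 < 1) (n : ℕ) (u : Seqs) :
    plancherelLaw h (cylinder n u) = ENNReal.ofReal (weight n u * pathProb ω n (u n)) := by
  have hw : ∀ n, 0 ≤ weight n u := by
    intro n; unfold weight; split_ifs <;> norm_num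
  rw [plancherelLaw, cylinder, traj_cylinder]
  induction n with
  | zero =>
    rw [ProbabilityTheory.Kernel.partialTraj_self, ProbabilityTheory.Kernel.id_apply,
      Measure.dirac_apply' _ (measurableSet_singleton _), pathProb_zero h]
    rw [Set.indicator_of_mem]
    · simp [weight]
    · refine funext fun ⟨i, hi⟩ => ?_
      obtain rfl : i = 0 := by simpa using hi
      exact Subsingleton.elim (α := Part 0) _ _
  | succ n ih =>
    rw [partialTraj_succ_singleton, ih, weight_succ]
    have hk : nextKernel h n (Preorder.frestrictLe n u) {u (n + 1)} =
        nextLaw h n (u n) (u (n + 1)) := by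
      rw [← PMF.toMeasure_apply_singleton _ _ (measurableSet_singleton _)]
      rfl
    rw [hk]
    by_cases hl : pathProb ω n (u n) ≠ 0
    · have : nextLaw h n (u n) (u (n + 1)) = ENNReal.ofReal (if Interlaces (u n) (u (n + 1)) then
          pathProb ω (n + 1) (u (n + 1)) / pathProb ω n (u n) else 0) := by
        rw [nextLaw, dif_pos hl]
        rfl
      rw [this, ← ENNReal.ofReal_mul (mul_nonneg (hw n) (pathProb_nonneg h _ _))]
      congr 1
      split_ifs
      · field_simp
      · simp
    -- After a partition of path probability zero, all interlacing successors have path probability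
    -- zero too, as nonnegative terms with sum zero; both sides vanish whatever the kernel is.
    · rw [not_not] at hl
      rw [hl]
      split_ifs with hi
      · have h1 := hasSum_pathProb h n (u n)
        rw [hl, hasSum_zero_iff_of_nonneg fun _ => pathProb_nonneg h _ _] at h1
        have := congrFun h1 ⟨u (n + 1), hi⟩
        simp only [Pi.zero_apply] at this
        simp [this]
      · simp

theorem isPlancherelLaw_plancherelLaw {ω : Param} (h : ω.β 0 < 1) :
    IsPlancherelLaw ω (plancherelLaw h) where
  isProbabilityMeasure := by unfold plancherelLaw; infer_instance
  cylinder_eq n _ u := by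
    have hw : 0 ≤ weight n u := by unfold weight; split_ifs <;> norm_num
    rw [measureReal_def, plancherelLaw_cylinder,
      ENNReal.toReal_ofReal (mul_nonneg hw (pathProb_nonneg h _ _)), pathProb, mul_div_assoc]

theorem cylinder_eq_pathProb {ω : Param} (h : ω.β 0 < 1) {P : Measure Seqs}
    (hP : IsPlancherelLaw ω P) (n : ℕ) (u : Seqs) :
    P.real (cylinder n u) = weight n u * pathProb ω n (u n) := by
  have := hP.isProbabilityMeasure
  rcases Nat.eq_zero_or_pos n with rfl | hn
  · have h1 : cylinder 0 u = Set.univ := by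
      refine Set.eq_univ_of_forall fun t m hm => ?_
      obtain rfl : m = 0 := by simpa using hm
      exact Subsingleton.elim _ _
    rw [h1, probReal_univ, pathProb_zero h, weight]
    simp
  · rw [hP.cylinder_eq n hn u, pathProb, mul_div_assoc]

/-- The levels are countable, so cylinder probabilities determine the marginals on the first levels,
and a projective limit of finite measures is unique. -/
theorem IsPlancherelLaw.unique {ω : Param} {P P' : Measure Seqs} (hP : IsPlancherelLaw ω P)
    (hP' : IsPlancherelLaw ω P') : P = P' := by
  have := hP.isProbabilityMeasure
  have := hP'.isProbabilityMeasure
  have hmap : ∀ n, 1 ≤ n → P.map (Preorder.frestrictLe n) = P'.map (Preorder.frestrictLe n) := by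
    intro n hn
    refine Measure.ext_of_singleton fun x => ?_
    let u : Seqs := fun m => if hm : m ≤ n then x ⟨m, Finset.mem_Iic.2 hm⟩ else Classical.arbitrary _
    have hx : Preorder.frestrictLe n ⁻¹' {x} = cylinder n u := by
      ext t
      simp only [cylinder, Set.mem_preimage, Set.mem_singleton_iff, funext_iff, Set.mem_ofPred_eq]
      constructor
      · intro ht m hm
        simpa [u, hm] using ht ⟨m, Finset.mem_Iic.2 hm⟩
      · rintro ht ⟨m, hm⟩
        have := ht m (Finset.mem_Iic.1 hm)
        simpa [u, Finset.mem_Iic.1 hm] using this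
    rw [Measure.map_apply (by fun_prop) (measurableSet_singleton _),
      Measure.map_apply (by fun_prop) (measurableSet_singleton _), hx]
    rw [← measureReal_eq_measureReal_iff, hP.cylinder_eq n hn, hP'.cylinder_eq n hn]
  have hfam : IsProjectiveMeasureFamily fun I : Finset ℕ => P.map I.restrict :=
    ProbabilityTheory.isProjectiveMeasureFamily_map_restrict
      (X := fun (n : ℕ) (u : Seqs) => u n) fun n => (measurable_pi_apply n).aemeasurable
  refine IsProjectiveLimit.unique (P := fun I : Finset ℕ => P.map I.restrict) (fun I => rfl) ?_
  exact (isProjectiveLimit_nat_iff' hfam P' 1).2 fun n hn => (hmap n hn).symm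

end SymplecticPlancherel

end

noncomputable section

namespace SymplecticPlancherel

/-! ### Evaluation of the determinant at level zero -/

/-- Needed because identities such as E·(J/E) = J are available only on the disk where E has no
zeros. -/
theorem Q_iterate_congr {f g : ℂ → ℂ} {ρ : ℝ} (hρ : 1 < ρ)
    (h : ∀ x ∈ Metric.ball (0 : ℂ) ρ, f x = g x) (i : ℕ) :
    ∀ x ∈ Metric.ball (0 : ℂ) ρ, Q^[i] f x = Q^[i] g x := by
  induction i with
  | zero => exact h
  | succ i ih =>
    intro x hx
    have hmem := one_mem_ball hρ
    rw [Function.iterate_succ_apply', Function.iterate_succ_apply', Q, Q]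
    congr 1
    rcases eq_or_ne x 1 with rfl | hx1
    · rw [dslope_same, dslope_same]
      exact Filter.EventuallyEq.deriv_eq
        (Filter.eventually_of_mem (Metric.isOpen_ball.mem_nhds hmem) ih)
    · rw [dslope_of_ne _ hx1, dslope_of_ne _ hx1, slope_def_field, slope_def_field, ih x hx,
        ih 1 hmem]

theorem Q_iterate_pow_mul_of_le {f : ℂ → ℂ} {ρ : ℝ} (hρ : 1 < ρ)
    (hf : DifferentiableOn ℂ f (Metric.ball 0 ρ)) {i j : ℕ} (hij : i ≤ j) :
    Q^[i] (fun x => (2 * (x - 1)) ^ j * f x) = fun x => (2 * (x - 1)) ^ (j - i) * f x := by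
  obtain ⟨d, rfl⟩ := Nat.exists_eq_add_of_le hij
  rw [Q_iterate_pow_mul hρ hf, Nat.add_sub_cancel_left]

theorem Q_iterate_pow_mul_of_ge {f : ℂ → ℂ} {ρ : ℝ} (hρ : 1 < ρ)
    (hf : DifferentiableOn ℂ f (Metric.ball 0 ρ)) {i j : ℕ} (hij : j ≤ i) :
    Q^[i] (fun x => (2 * (x - 1)) ^ j * f x) = Q^[i - j] f := by
  obtain ⟨d, rfl⟩ := Nat.exists_eq_add_of_le hij
  rw [add_comm, Function.iterate_add_apply, Nat.add_sub_cancel]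
  congr 1
  rw [Q_iterate_pow_mul_of_le hρ hf le_rfl]
  simp

section Evaluation

variable {R k : ℕ} (ω : Param) (z : Fin k → ℕ × ℕ+)

/-- The quotient of the polynomial of a site by `E`. -/
def siteQuot (w : ℕ × ℕ+) (x : ℂ) : ℂ := siteJ w x / E ω x

/-- The correlation kernel, up to conjugation, in terms of coefficients. -/
def coefKernel (a b : ℕ × ℕ+) : ℂ :=
  (if b.2 ≤ a.2 then coef a.2 a.1 fun x => (2 * (x - 1)) ^ (r a.2 - r b.2) * siteJ b x else 0) -
    coef a.2 a.1 fun x => (2 * (x - 1)) ^ r a.2 * (E ω x * Q^[r b.2] (siteQuot ω b) x)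

/-- The coefficients of the functions of the sites, at lower sites. -/
def siteMatrix : Matrix (Fin k) (Fin k) ℂ := Matrix.of fun a b =>
  if ((z a).2 : ℕ) < (z b).2 then coef (z a).2 (z a).1 (Q^[r (z b).2 - r (z a).2] (siteJ (z b)))
  else 0

/-- The coefficients of the unperturbed functions at the sites. -/
def baseMatrix (R : ℕ) : Matrix (Fin k) (Fin R) ℂ := Matrix.of fun a j =>
  coef (z a).2 (z a).1 (Q^[R - r (z a).2] (baseFun ω R j))

/-- The Taylor coefficients of the quotients of the sites by `E`. -/
def quotMatrix (R : ℕ) : Matrix (Fin R) (Fin k) ℂ := Matrix.of fun j b =>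
  if (j : ℕ) < r (z b).2 then Q^[r (z b).2 - 1 - j] (siteQuot ω (z b)) 1 else 0

variable {ω} {ρ : ℝ}

theorem siteQuot_differentiableOn (hE : DifferentiableOn ℂ (E ω) (Metric.ball 0 ρ))
    (h0 : ∀ x ∈ Metric.ball (0 : ℂ) ρ, E ω x ≠ 0) (w : ℕ × ℕ+) :
    DifferentiableOn ℂ (siteQuot ω w) (Metric.ball 0 ρ) :=
  (siteJ_differentiableOn w).div hE h0

/-- Multiply Taylor's formula at 1 for J_b/E, to order r_b, by (2(x-1))^(R - r_b) E. The Taylor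
polynomial becomes a combination of the base functions and the remainder carries (2(x-1))^R; then
apply `Q` R - r_a times. -/
theorem Q_iterate_sum_baseFun_eq (hρ : 1 < ρ) (hE : DifferentiableOn ℂ (E ω) (Metric.ball 0 ρ))
    (h0 : ∀ x ∈ Metric.ball (0 : ℂ) ρ, E ω x ≠ 0) {a b : ℕ × ℕ+} (ha : r a.2 ≤ R)
    (hb : r b.2 ≤ R) (x : ℂ) (hx : x ∈ Metric.ball (0 : ℂ) ρ) :
    ∑ j : Fin R, (if (j : ℕ) < r b.2 then Q^[r b.2 - 1 - j] (siteQuot ω b) 1 else 0) *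
        Q^[R - r a.2] (baseFun ω R j) x =
      Q^[R - r a.2] (fun x => (2 * (x - 1)) ^ (R - r b.2) * siteJ b x) x -
        (2 * (x - 1)) ^ r a.2 * (E ω x * Q^[r b.2] (siteQuot ω b) x) := by
  have hF := siteQuot_differentiableOn hE h0 b
  have hbase := baseFun_differentiableOn hE R
  have hg : DifferentiableOn ℂ (fun x => E ω x * Q^[r b.2] (siteQuot ω b) x) (Metric.ball 0 ρ) :=
    hE.mul (Q_iterate_differentiableOn hρ hF _)
  have hJ := siteJ_differentiableOn (ρ := ρ) b
  set c : Fin R → ℂ := fun j =>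
    if (j : ℕ) < r b.2 then Q^[r b.2 - 1 - j] (siteQuot ω b) 1 else 0 with hc
  have hsum : ∀ x ∈ Metric.ball (0 : ℂ) ρ, ∑ j : Fin R, c j * baseFun ω R j x +
      (2 * (x - 1)) ^ R * (E ω x * Q^[r b.2] (siteQuot ω b) x) =
      (2 * (x - 1)) ^ (R - r b.2) * siteJ b x := by
    intro x hx
    have h1 : siteJ b x = E ω x * siteQuot ω b x := by
      rw [siteQuot, mul_div_cancel₀ _ (h0 x hx)]
    have h2 : ∑ j : Fin R, c j * baseFun ω R j x = (2 * (x - 1)) ^ (R - r b.2) *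
        (E ω x * ∑ j ∈ Finset.range (r b.2), Q^[j] (siteQuot ω b) 1 * (2 * (x - 1)) ^ j) := by
      rw [← Finset.sum_range_reflect, Finset.mul_sum, Finset.mul_sum]
      simp only [hc, baseFun]
      rw [Fin.sum_univ_eq_sum_range (fun j => (if j < r b.2 then
          Q^[r b.2 - 1 - j] (siteQuot ω b) 1 else 0) * ((2 * (x - 1)) ^ (R - 1 - j) * E ω x)) R]
      rw [← Finset.sum_subset (Finset.range_mono hb)]
      · refine Finset.sum_congr rfl fun j hj => ?_
        have hj := Finset.mem_range.1 hj
        rw [if_pos hj, show R - 1 - j = R - r b.2 + (r b.2 - 1 - j) by omega, pow_add]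
        ring
      · intro j _ hj
        rw [if_neg (by simpa using hj), zero_mul]
    rw [h2, h1]
    conv_rhs => rw [eq_sum_add_Q_iterate (siteQuot ω b) (r b.2) x]
    rw [show (2 * (x - 1)) ^ R = (2 * (x - 1)) ^ (R - r b.2) * (2 * (x - 1)) ^ r b.2 by
      rw [← pow_add]; congr 1; omega]
    ring
  have h3 := Q_iterate_congr hρ hsum (R - r a.2) x hx
  rw [Q_iterate_add hρ (DifferentiableOn.fun_sum fun j _ => (hbase j).const_mul _)
    (differentiableOn_pow_mul hg R), Q_iterate_sum _ hρ fun j _ => (hbase j).const_mul _,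
    Q_iterate_pow_mul_of_le hρ hg (Nat.sub_le _ _), Nat.sub_sub_self ha] at h3
  simp only [Q_iterate_const_mul hρ (hbase _)] at h3
  rw [← h3]
  ring

/-- The indicator in the kernel arises here. If `a` lies below `b`, the iterates of `Q` exhaust the
power of x - 1 and leave the coefficient of Q^(r_b - r_a) J_b, which is exactly what `siteMatrix`
subtracts. Otherwise (2(x-1))^(r_a - r_b) J_b survives and nothing is subtracted. -/
theorem baseMatrix_mul_quotMatrix_sub (hρ : 1 < ρ)
    (hE : DifferentiableOn ℂ (E ω) (Metric.ball 0 ρ))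
    (h0 : ∀ x ∈ Metric.ball (0 : ℂ) ρ, E ω x ≠ 0) (hR : ∀ a, r (z a).2 ≤ R) :
    baseMatrix ω z R * quotMatrix ω z R - siteMatrix z =
      Matrix.of fun a b => coefKernel ω (z a) (z b) := by
  ext a b
  have hF := siteQuot_differentiableOn hE h0 (z b)
  have hbase := baseFun_differentiableOn hE R
  have hJ := siteJ_differentiableOn (ρ := ρ) (z b)
  have hg : DifferentiableOn ℂ (fun x => E ω x * Q^[r (z b).2] (siteQuot ω (z b)) x)
      (Metric.ball 0 ρ) := hE.mul (Q_iterate_differentiableOn hρ hF _)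
  have hI : ∀ {f : ℂ → ℂ}, DifferentiableOn ℂ f (Metric.ball 0 ρ) → ContI f :=
    fun hf => contI_of_differentiableOn hρ hf
  have hball : ∀ x ∈ Set.Icc (-1 : ℝ) 1, (x : ℂ) ∈ Metric.ball (0 : ℂ) ρ := by
    intro x hx
    rw [mem_ball_zero_iff, Complex.norm_real]
    exact (abs_le.2 hx).trans_lt hρ
  have h1 : (baseMatrix ω z R * quotMatrix ω z R) a b =
      coef (z a).2 (z a).1 (Q^[R - r (z a).2]
        (fun x => (2 * (x - 1)) ^ (R - r (z b).2) * siteJ (z b) x)) -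
      coef (z a).2 (z a).1 fun x =>
        (2 * (x - 1)) ^ r (z a).2 * (E ω x * Q^[r (z b).2] (siteQuot ω (z b)) x) := by
    rw [← coef_sub _ _ (hI (Q_iterate_differentiableOn hρ (differentiableOn_pow_mul hJ _) _))
      (hI (differentiableOn_pow_mul hg _)), ← coef_congr (f := fun x => ∑ j : Fin R, (if (j : ℕ) < r (z b).2 then
          Q^[r (z b).2 - 1 - j] (siteQuot ω (z b)) 1 else 0) * Q^[R - r (z a).2] (baseFun ω R j) x)
        _ _ fun x hx => Q_iterate_sum_baseFun_eq hρ hE h0 (hR a) (hR b) x (hball x hx),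
      coef_sum _ _ _ fun j _ => hI ((Q_iterate_differentiableOn hρ (hbase j) _).const_mul _)]
    simp only [coef_const_mul]
    simp only [Matrix.mul_apply, baseMatrix, quotMatrix, Matrix.of_apply]
    exact Finset.sum_congr rfl fun j _ => mul_comm _ _
  rw [Matrix.sub_apply, h1]
  simp only [siteMatrix, coefKernel, Matrix.of_apply]
  have ha := hR a
  have hb := hR b
  rw [sub_right_comm]
  congr 1
  by_cases hab : ((z a).2 : ℕ) < (z b).2
  · have hr := r_mono hab.le
    rw [if_pos hab, if_neg (by exact_mod_cast not_le.2 hab),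
      Q_iterate_pow_mul_of_ge hρ hJ (by omega),
      show R - r (z a).2 - (R - r (z b).2) = r (z b).2 - r (z a).2 by omega, sub_self]
  · have hr := r_mono (not_lt.1 hab)
    rw [if_neg hab, if_pos (by exact_mod_cast not_lt.1 hab),
      Q_iterate_pow_mul_of_le hρ hJ (by omega),
      show R - r (z b).2 - (R - r (z a).2) = r (z a).2 - r (z b).2 by omega, sub_zero]

/-- The Taylor coefficients of the unperturbed functions. -/
def taylorMatrix (ω : Param) (R : ℕ) : Matrix (Fin R) (Fin R) ℂ := Matrix.of fun i j =>
  Q^[R - 1 - i] (baseFun ω R j) 1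

theorem taylorMatrix_apply (hρ : 1 < ρ) (hE : DifferentiableOn ℂ (E ω) (Metric.ball 0 ρ))
    (i j : Fin R) : taylorMatrix ω R i j = if i ≤ j then Q^[(j : ℕ) - i] (E ω) 1 else 0 := by
  simp only [taylorMatrix, Matrix.of_apply]
  have hj := j.2
  have hi := i.2
  unfold baseFun
  split_ifs with h
  · have h' : (i : ℕ) ≤ j := h
    rw [Q_iterate_pow_mul_of_ge hρ hE (by omega),
      show R - 1 - (i : ℕ) - (R - 1 - j) = j - i by omega]
  · have h' : (j : ℕ) < i := not_le.1 h
    rw [Q_iterate_pow_mul_of_le hρ hE (by omega)]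
    have : R - 1 - (j : ℕ) - (R - 1 - i) ≠ 0 := by omega
    simp [this]

theorem det_taylorMatrix (hρ : 1 < ρ) (hE : DifferentiableOn ℂ (E ω) (Metric.ball 0 ρ)) :
    (taylorMatrix ω R).det = 1 := by
  rw [Matrix.det_of_isUpperTriangular]
  · refine Finset.prod_eq_one fun i _ => ?_
    rw [taylorMatrix_apply hρ hE, if_pos le_rfl]
    simp [E_one]
  · intro i j hij
    rw [taylorMatrix_apply hρ hE]
    exact if_neg (not_le.2 hij)

/-- The Taylor coefficients of the functions of the sites. -/
def siteTaylorMatrix (R : ℕ) : Matrix (Fin R) (Fin k) ℂ := Matrix.of fun i b =>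
  if (i : ℕ) < r (z b).2 then Q^[r (z b).2 - 1 - i] (siteJ (z b)) 1 else 0

/-- The Cauchy product of Taylor series at 1, applied to E·(J/E) = J. -/
theorem taylorMatrix_mul_quotMatrix (hρ : 1 < ρ)
    (hE : DifferentiableOn ℂ (E ω) (Metric.ball 0 ρ))
    (h0 : ∀ x ∈ Metric.ball (0 : ℂ) ρ, E ω x ≠ 0) (hR : ∀ a, r (z a).2 ≤ R) :
    taylorMatrix ω R * quotMatrix ω z R = siteTaylorMatrix z R := by
  ext i b
  have hF := siteQuot_differentiableOn hE h0 (z b)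
  rw [Matrix.mul_apply]
  simp only [taylorMatrix_apply hρ hE, quotMatrix, siteTaylorMatrix, Matrix.of_apply]
  have hb := hR b
  have hi := i.2
  simp only [Fin.le_def]
  rw [Fin.sum_univ_eq_sum_range (fun j => (if (i : ℕ) ≤ j then Q^[j - i] (E ω) 1 else 0) *
    if j < r (z b).2 then Q^[r (z b).2 - 1 - j] (siteQuot ω (z b)) 1 else 0) R]
  have hsub : Finset.Ico (i : ℕ) (r (z b).2) ⊆ Finset.range R := by
    intro j hj
    have := Finset.mem_Ico.1 hj
    exact Finset.mem_range.2 (by omega)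
  rw [← Finset.sum_subset hsub]
  swap
  · intro j _ hj
    rw [Finset.mem_Ico, not_and_or] at hj
    rcases hj with hj | hj <;> simp [hj]
  split_ifs with hib
  · rw [← Q_iterate_congr hρ (f := fun x => E ω x * siteQuot ω (z b) x) (g := siteJ (z b))
      (fun x hx => by rw [siteQuot, mul_div_cancel₀ _ (h0 x hx)]) _ 1 (one_mem_ball hρ),
      Q_iterate_mul_apply_one hρ hE hF, Finset.sum_Ico_eq_sum_range,
      show r (z b).2 - 1 - (i : ℕ) + 1 = r (z b).2 - i by omega]
    refine Finset.sum_congr rfl fun j hj => ?_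
    have := Finset.mem_range.1 hj
    rw [if_pos (by omega), if_pos (by omega), Nat.add_sub_cancel_left,
      show r (z b).2 - 1 - ((i : ℕ) + j) = r (z b).2 - 1 - i - j by omega]
  · rw [Finset.Ico_eq_empty (by omega), Finset.sum_empty]

theorem coef_gtFun (hρ : 1 < ρ) {f : Fin R → ℂ → ℂ}
    (hf : ∀ j, DifferentiableOn ℂ (f j) (Metric.ball 0 ρ)) (t : ℂ)
    (B : Matrix (Fin k) (Fin R) ℂ) (n x : ℕ) (j : Fin R) :
    coef n x (gtFun f z t B n j) = coef n x (Q^[R - r n] (f j)) +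
      t * ∑ b, (if n < ((z b).2 : ℕ) then coef n x (Q^[r (z b).2 - r n] (siteJ (z b))) else 0) *
        B b j := by
  have hd : ∀ b, DifferentiableOn ℂ (fun x => if n < ((z b).2 : ℕ) then
      B b j * Q^[r (z b).2 - r n] (siteJ (z b)) x else 0) (Metric.ball 0 ρ) :=
    fun b => differentiableOn_ite_Q hρ _ _ _ _
  unfold gtFun
  rw [coef_add _ _ (contI_of_differentiableOn hρ (Q_iterate_differentiableOn hρ (hf j) _))
    (contI_of_differentiableOn hρ ((DifferentiableOn.fun_sum fun b _ => hd b).const_mul t)),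
    coef_const_mul, coef_sum _ _ _ fun b _ => contI_of_differentiableOn hρ (hd b)]
  congr 2
  refine Finset.sum_congr rfl fun b _ => ?_
  split_ifs
  · rw [coef_const_mul, mul_comm]
  · simp [coef]

/-- There are perturbation coefficients that are compatible with the functions they define, and the
resulting determinant is a characteristic polynomial of the kernel. -/
theorem exists_compatible_det_virtualRow (hρ : 1 < ρ)
    (hE : DifferentiableOn ℂ (E ω) (Metric.ball 0 ρ))
    (h0 : ∀ x ∈ Metric.ball (0 : ℂ) ρ, E ω x ≠ 0) (hR : ∀ a, r (z a).2 ≤ R) (t : ℂ) :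
    ∃ B : Matrix (Fin k) (Fin R) ℂ,
      (∀ a j, B a j = coef (z a).2 (z a).1 (gtFun (baseFun ω R) z t B (z a).2 j)) ∧
      (Matrix.of fun i j => virtualRow (baseFun ω R) z t B i j).det =
        (1 + t • Matrix.of fun a b => coefKernel ω (z a) (z b)).det := by
  have hW : (1 - t • siteMatrix z).det = 1 :=
    det_one_sub_smul_eq_one _ (fun a => ((z a).2 : ℕ)) (fun a b hab => if_neg hab) t
  -- Compatibility means B = B₀ + tWB: a coefficient at a site involves only the perturbations at
  -- higher sites. As 1 - tW is unimodular, the system is solvable for every t.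
  have hB : (1 - t • siteMatrix z)⁻¹ * baseMatrix ω z R = baseMatrix ω z R +
      t • (siteMatrix z * ((1 - t • siteMatrix z)⁻¹ * baseMatrix ω z R)) := by
    have h1 : (1 - t • siteMatrix z) * ((1 - t • siteMatrix z)⁻¹ * baseMatrix ω z R) =
        baseMatrix ω z R := by
      rw [← Matrix.mul_assoc, Matrix.mul_nonsing_inv _ (by rw [hW]; exact isUnit_one),
        Matrix.one_mul]
    rw [Matrix.sub_mul, Matrix.one_mul, Matrix.smul_mul, sub_eq_iff_eq_add] at h1
    exact h1
  generalize (1 - t • siteMatrix z)⁻¹ * baseMatrix ω z R = B at hB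
  refine ⟨B, fun a j => ?_, ?_⟩
  · rw [coef_gtFun z hρ (baseFun_differentiableOn hE R)]
    conv_lhs => rw [hB]
    simp only [Matrix.add_apply, Matrix.smul_apply, Matrix.mul_apply, smul_eq_mul, siteMatrix,
      baseMatrix, Matrix.of_apply]
  · have hrow : (Matrix.of fun i j => virtualRow (baseFun ω R) z t B i j) =
        taylorMatrix ω R + t • (siteTaylorMatrix z R * B) := by
      ext i j
      have hr : r (2 * (i : ℕ) + 1) = i + 1 := by unfold r; omega
      simp only [virtualRow, geFun, hr, Matrix.of_apply, Matrix.add_apply, Matrix.smul_apply,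
        Matrix.mul_apply, smul_eq_mul, taylorMatrix, siteTaylorMatrix, Nat.sub_sub,
        add_comm 1 (i : ℕ)]
      congr 2
      refine Finset.sum_congr rfl fun b _ => ?_
      have : 2 * (i : ℕ) + 1 ≤ (z b).2 ↔ (i : ℕ) < r (z b).2 := by unfold r; omega
      simp only [this]
      split_ifs
      · rw [mul_comm]
      · rw [zero_mul]
    rw [hrow, det_add_smul_mul _ _ _ _ _ _ t hB (taylorMatrix_mul_quotMatrix z hρ hE h0 hR) hW,
      det_taylorMatrix hρ hE, one_mul, baseMatrix_mul_quotMatrix_sub z hρ hE h0 hR]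

end Evaluation

end SymplecticPlancherel

end

noncomputable section

namespace SymplecticPlancherel

/-! ### Correlation functions -/

section Correlation

variable {k : ℕ} (z : Fin k → ℕ × ℕ+)

/-- The weight of level `m`. -/
def levelWeight (t : ℂ) (m : ℕ) (u : Seqs) : ℂ := ∏ i, siteWeight z t m (tilde (u m) i)

theorem norm_siteWeight_le (t : ℂ) (n x : ℕ) : ‖siteWeight z t n x‖ ≤ 1 + ‖t‖ := by
  unfold siteWeight
  split_ifs
  · exact (norm_add_le _ _).trans (by simp)
  · simp

theorem norm_levelWeight_le (t : ℂ) (m : ℕ) (u : Seqs) :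
    ‖levelWeight z t m u‖ ≤ (1 + ‖t‖) ^ r m := by
  unfold levelWeight
  rw [norm_prod]
  exact (Finset.prod_le_prod (fun _ _ => norm_nonneg _) fun i _ => norm_siteWeight_le z t m _).trans
    (by simp)

theorem measurable_levelWeight (t : ℂ) (m : ℕ) : Measurable (levelWeight z t m) :=
  (Measurable.of_discrete (f := fun l : Part m => ∏ i, siteWeight z t m (tilde l i))).comp
    (measurable_pi_apply m)

theorem integrable_prod_levelWeight (P : Measure Seqs) [IsProbabilityMeasure P] (t : ℂ)
    (I : Finset ℕ) : Integrable (fun u => ∏ m ∈ I, levelWeight z t m u) P := by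
  refine Integrable.of_bound (C := ∏ m ∈ I, (1 + ‖t‖) ^ r m)
    (Finset.measurable_prod _ fun m _ => measurable_levelWeight z t m).aestronglyMeasurable
    (Filter.Eventually.of_forall fun u => ?_)
  rw [norm_prod]
  exact Finset.prod_le_prod (fun _ _ => norm_nonneg _) fun m _ => norm_levelWeight_le z t m u

theorem measurableSet_cylinder (n : ℕ) (u : Seqs) : MeasurableSet (cylinder n u) := by
  have : cylinder n u = ⋂ m, ⋂ (_ : m ≤ n), (fun t : Seqs => t m) ⁻¹' {u m} := by
    ext t; simp [cylinder]
  rw [this]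
  exact MeasurableSet.iInter fun m => MeasurableSet.iInter fun _ =>
    measurable_pi_apply m (measurableSet_singleton _)

theorem cylinder_eq_iUnion (n : ℕ) (u : Seqs) :
    cylinder n u = ⋃ l : Part (n + 1), cylinder (n + 1) (Function.update u (n + 1) l) := by
  ext t
  simp only [cylinder, Set.mem_ofPred_eq, Set.mem_iUnion]
  constructor
  · intro h
    refine ⟨t (n + 1), fun m hm => ?_⟩
    rcases eq_or_ne m (n + 1) with rfl | hne
    · rw [Function.update_self]
    · rw [Function.update_of_ne hne, h m (by omega)]
  · rintro ⟨l, hl⟩ m hm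
    rw [hl m (by omega), Function.update_of_ne (by omega)]

theorem pairwise_disjoint_cylinder (n : ℕ) (u : Seqs) : Pairwise fun l l' : Part (n + 1) =>
    Disjoint (cylinder (n + 1) (Function.update u (n + 1) l))
      (cylinder (n + 1) (Function.update u (n + 1) l')) := by
  intro l l' hne
  rw [Set.disjoint_left]
  intro t h h'
  have h1 := h (n + 1) le_rfl
  have h2 := h' (n + 1) le_rfl
  rw [Function.update_self] at h1 h2
  exact hne (h1.symm.trans h2)

theorem weight_update (n : ℕ) (u : Seqs) (l : Part (n + 1)) :
    weight n (Function.update u (n + 1) l) = weight n u := by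
  unfold weight
  congr 1
  refine propext (forall₂_congr fun m hm => ?_)
  rw [Function.update_of_ne (by omega), Function.update_of_ne (by omega)]

variable {z}

open Classical in
-- Decreasing induction from the top level, where the determinant is the path probability: split the
-- cylinder by the next level, absorb its site weights through `geDet_eq`, and sum with
-- `hasSum_geDet`.
theorem setIntegral_cylinder {ω : Param} (h : ω.β 0 < 1) {P : Measure Seqs}
    (hP : IsPlancherelLaw ω P) (hz : Function.Injective z) {ρ : ℝ} (hρ : 1 < ρ)
    (hE : DifferentiableOn ℂ (E ω) (Metric.ball 0 ρ)) {N : ℕ} (hN : Even N)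
    (hzN : ∀ a, ((z a).2 : ℕ) ≤ N) (t : ℂ) {B : Matrix (Fin k) (Fin (r N)) ℂ}
    (hB : ∀ a j, B a j = coef (z a).2 (z a).1 (gtFun (baseFun ω (r N)) z t B (z a).2 j))
    {n : ℕ} (hn : n ≤ N) (u : Seqs) :
    ∫ s in cylinder n u, ∏ m ∈ Finset.Ioc n N, levelWeight z t m s ∂P =
      weight n u * gtDet (baseFun ω (r N)) z t B n (u n) := by
  have := hP.isProbabilityMeasure
  induction hn using Nat.decreasingInduction generalizing u with
  | self =>
    rw [gtDet_eq_pathProb h z t B rfl hN hzN]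
    simp only [Finset.Ioc_self, Finset.prod_empty, setIntegral_const, Complex.real_smul, mul_one]
    rw [cylinder_eq_pathProb h hP]
    push_cast
    rfl
  | of_succ n hn ih =>
    rw [cylinder_eq_iUnion]
    have h1 := hasSum_integral_iUnion (μ := P)
      (f := fun s => ∏ m ∈ Finset.Ioc n N, levelWeight z t m s)
      (fun l => measurableSet_cylinder (n + 1) (Function.update u (n + 1) l))
      (pairwise_disjoint_cylinder n u) (integrable_prod_levelWeight z P t _).integrableOn
    have hterm : ∀ l : Part (n + 1), ∫ s in cylinder (n + 1) (Function.update u (n + 1) l),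
        ∏ m ∈ Finset.Ioc n N, levelWeight z t m s ∂P =
        weight n u * if Interlaces (u n) l then geDet (baseFun ω (r N)) z t B (n + 1) l else 0 := by
      intro l
      have h2 : ∫ s in cylinder (n + 1) (Function.update u (n + 1) l),
          ∏ m ∈ Finset.Ioc n N, levelWeight z t m s ∂P =
          ∫ s in cylinder (n + 1) (Function.update u (n + 1) l),
            (∏ i, siteWeight z t (n + 1) (tilde l i)) *
              ∏ m ∈ Finset.Ioc (n + 1) N, levelWeight z t m s ∂P := by
        refine setIntegral_congr_fun (measurableSet_cylinder _ _) fun s hs => ?_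
        have hs1 := hs (n + 1) le_rfl
        rw [Function.update_self] at hs1
        rw [← Finset.insert_Ioc_add_one_left_eq_Ioc hn]
        simp only [Finset.prod_insert (show n + 1 ∉ Finset.Ioc (n + 1) N by simp)]
        rw [levelWeight, hs1]
      rw [h2, integral_const_mul, ih, weight_succ, weight_update, Function.update_self,
        Function.update_of_ne (by omega),
        geDet_eq z t B hρ (baseFun_differentiableOn hE _) hz hB (r_mono hn)]
      split_ifs <;> push_cast <;> ring
    simp only [hterm] at h1
    have h3 := hasSum_geDet z t B hρ (baseFun_differentiableOn hE _) (r_mono hn) (u n)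
    have h4 : HasSum (fun l => if Interlaces (u n) l then
        geDet (baseFun ω (r N)) z t B (n + 1) l else 0)
        (gtDet (baseFun ω (r N)) z t B n (u n)) := by
      convert (hasSum_subtype_iff_indicator (s := {m | Interlaces (u n) m})
        (f := fun l => geDet (baseFun ω (r N)) z t B (n + 1) l)).1 h3 using 1
      funext m
      simp [Set.indicator]
    exact h1.unique (h4.mul_left _)

variable (z)

theorem siteWeight_eq_prod (hz : Function.Injective z) (t : ℂ) (n x : ℕ) :
    siteWeight z t n x = ∏ a, if ((z a).2 : ℕ) = n ∧ (z a).1 = x then 1 + t else 1 := by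
  unfold siteWeight
  split_ifs with h
  · obtain ⟨a, ha⟩ := h
    rw [Finset.prod_eq_single a, if_pos ha]
    · intro b _ hba
      rw [if_neg]
      rintro ⟨hb1, hb2⟩
      exact hba (hz (Prod.ext (hb2.trans ha.2.symm) (PNat.eq (hb1.trans ha.1.symm))))
    · exact fun h => absurd (Finset.mem_univ _) h
  · exact (Finset.prod_eq_one fun a _ => if_neg fun h' => h ⟨a, h'⟩).symm

open Classical in
theorem prod_levelWeight (hz : Function.Injective z) (t : ℂ) {N : ℕ}
    (hzN : ∀ a, ((z a).2 : ℕ) ≤ N) (u : Seqs) :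
    ∏ m ∈ Finset.Ioc 0 N, levelWeight z t m u = ∏ a, if z a ∈ config u then 1 + t else 1 := by
  simp only [levelWeight, siteWeight_eq_prod z hz]
  simp only [Finset.prod_comm (t := Finset.univ (α := Fin k))]
  refine Finset.prod_congr rfl fun a _ => ?_
  have hmem : ((z a).2 : ℕ) ∈ Finset.Ioc 0 N := Finset.mem_Ioc.2 ⟨(z a).2.pos, hzN a⟩
  rw [Finset.prod_eq_single ((z a).2 : ℕ)]
  · split_ifs with h
    · obtain ⟨i, hi⟩ := h
      rw [Finset.prod_eq_single i, if_pos ⟨rfl, hi.symm⟩]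
      · intro j _ hji
        exact if_neg fun h' => hji ((tilde_strictAnti (u (z a).2)).injective (h'.2.symm.trans hi.symm))
      · exact fun h => absurd (Finset.mem_univ _) h
    · exact Finset.prod_eq_one fun i _ => if_neg fun h' => h ⟨i, h'.2.symm⟩
  · intro m _ hm
    exact Finset.prod_eq_one fun i _ => if_neg fun h' => hm h'.1.symm
  · exact fun h => absurd hmem h

variable {z}

open Classical in
-- The cylinder at level 0 is the whole space, so the expectation equals the determinant formed by
-- virtual rows alone, which has been evaluated.
theorem integral_prod_ite {ω : Param} (h : ω.β 0 < 1) {P : Measure Seqs}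
    (hP : IsPlancherelLaw ω P) (hz : Function.Injective z) (t : ℂ) :
    ∫ u, ∏ a, (if z a ∈ config u then 1 + t else 1) ∂P =
      (1 + t • Matrix.of fun a b => coefKernel ω (z a) (z b)).det := by
  obtain ⟨ρ, hρ, hE, h0⟩ := exists_E_differentiableOn h
  -- The top level must be even, because only there is the path probability directly given by
  -- characters.
  obtain ⟨N, hN, hzN⟩ : ∃ N, Even N ∧ ∀ a, ((z a).2 : ℕ) ≤ N :=
    ⟨2 * ∑ a, ((z a).2 : ℕ), even_two_mul _, fun a =>
      (Finset.single_le_sum (f := fun a => ((z a).2 : ℕ)) (fun _ _ => Nat.zero_le _)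
        (Finset.mem_univ a)).trans (by omega)⟩
  obtain ⟨B, hB, hdet⟩ := exists_compatible_det_virtualRow z hρ hE h0 (fun a => r_mono (hzN a)) t
  have h1 := setIntegral_cylinder h hP hz hρ hE hN hzN t hB (Nat.zero_le N)
    fun _ => Classical.arbitrary _
  have hcyl : ∀ u, cylinder 0 u = Set.univ := by
    refine fun u => Set.eq_univ_of_forall fun t m hm => ?_
    obtain rfl : m = 0 := by simpa using hm
    exact Subsingleton.elim _ _
  have hg := geDet_eq z t B hρ (baseFun_differentiableOn hE _) hz hB (r_mono (Nat.zero_le N))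
    (Classical.arbitrary (Part 0))
  have hr : IsEmpty (Fin (r 0)) := by simp [r]; infer_instance
  rw [Finset.univ_eq_empty, Finset.prod_empty, one_mul, geDet_zero, hdet] at hg
  rw [hcyl, setIntegral_univ, ← hg] at h1
  simp only [prod_levelWeight z hz t hzN] at h1
  rw [h1]
  simp [weight]

theorem measurableSet_mem_config (w : ℕ × ℕ+) : MeasurableSet {u | w ∈ config u} := by
  have : {u | w ∈ config u} = (fun u : Seqs => u w.2) ⁻¹'
      {l | ∃ i : Fin (r w.2), tilde l i = w.1} := rfl
  rw [this]
  exact measurable_pi_apply _ (Set.to_countable _).measurableSet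

theorem measurable_config : Measurable config :=
  measurable_set_iff.2 fun w => measurableSet_setOfPred.1 (measurableSet_mem_config w)

theorem correlation_eq (P : Measure Seqs) :
    correlation P z = P.real {u | ∀ a, z a ∈ config u} := by
  have hm : MeasurableSet {S : Set (ℕ × ℕ+) | Set.range z ⊆ S} := by
    have : {S : Set (ℕ × ℕ+) | Set.range z ⊆ S} = ⋂ a, {S | z a ∈ S} := by
      ext S; simp [Set.range_subset_iff]
    rw [this]
    exact MeasurableSet.iInter fun a => measurableSet_setOfPred.2 (measurable_set_mem _)
  rw [correlation, map_measureReal_apply measurable_config hm]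
  congr 1
  ext u
  simp [Set.range_subset_iff]

open Classical in
-- Take t = 1/s in the generating function and multiply by s^k; along s = 1/(n + 1) → 0 the
-- integrand tends to the indicator that all sites are occupied.
theorem correlation_eq_det {ω : Param} (h : ω.β 0 < 1) {P : Measure Seqs}
    (hP : IsPlancherelLaw ω P) (hz : Function.Injective z) :
    (correlation P z : ℂ) = (Matrix.of fun a b => coefKernel ω (z a) (z b)).det := by
  have := hP.isProbabilityMeasure
  have hms : MeasurableSet {u | ∀ a, z a ∈ config u} := by
    simp only [Set.ofPred_forall]
    exact MeasurableSet.iInter fun a => measurableSet_mem_config _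
  set K : Matrix (Fin k) (Fin k) ℂ := Matrix.of fun a b => coefKernel ω (z a) (z b)
  have hscaled : ∀ s : ℂ, s ≠ 0 →
      ∫ u, ∏ a, (if z a ∈ config u then s + 1 else s) ∂P = (s • 1 + K).det := by
    intro s hs
    have h1 := integral_prod_ite h hP hz s⁻¹
    have h2 : ∀ u, ∏ a, (if z a ∈ config u then s + 1 else s) =
        s ^ k * ∏ a, (if z a ∈ config u then 1 + s⁻¹ else 1) := by
      intro u
      rw [← Fin.prod_const, ← Finset.prod_mul_distrib]
      refine Finset.prod_congr rfl fun a _ => ?_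
      split_ifs
      · rw [mul_add, mul_inv_cancel₀ hs, mul_one]
      · rw [mul_one]
    simp only [h2]
    rw [integral_const_mul, h1]
    have h3 := Matrix.det_smul (1 + s⁻¹ • K) s
    rw [Fintype.card_fin] at h3
    rw [← h3, smul_add, smul_smul, mul_inv_cancel₀ hs, one_smul]
  have hseq : ∀ n : ℕ, (1 / ((n : ℂ) + 1)) ≠ 0 := fun n => by
    have : (n : ℂ) + 1 ≠ 0 := by exact_mod_cast n.succ_ne_zero
    exact one_div_ne_zero this
  have hlim0 : Filter.Tendsto (fun n : ℕ => 1 / ((n : ℂ) + 1)) Filter.atTop (nhds 0) :=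
    tendsto_one_div_add_atTop_nhds_zero_nat
  have hlim1 : Filter.Tendsto (fun n : ℕ => ((1 / ((n : ℂ) + 1)) • (1 : Matrix (Fin k) (Fin k) ℂ)
      + K).det) Filter.atTop (nhds K.det) := by
    refine tendsto_det fun i j => ?_
    simp only [Matrix.add_apply, Matrix.smul_apply, smul_eq_mul]
    simpa using (hlim0.mul_const ((1 : Matrix (Fin k) (Fin k) ℂ) i j)).add_const (K i j)
  have hmeas : ∀ s : ℂ, Measurable fun u => ∏ a, (if z a ∈ config u then s + 1 else s) :=
    fun s => Finset.measurable_prod _ fun a _ =>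
      Measurable.ite (measurableSet_mem_config (z a)) measurable_const measurable_const
  have hlim2 : Filter.Tendsto (fun n : ℕ => ∫ u, ∏ a, (if z a ∈ config u then
      1 / ((n : ℂ) + 1) + 1 else 1 / ((n : ℂ) + 1)) ∂P) Filter.atTop
      (nhds (∫ u, ∏ a, (if z a ∈ config u then 1 else 0) ∂P)) := by
    refine tendsto_integral_of_dominated_convergence (fun _ => (2 : ℝ) ^ k)
      (fun n => (hmeas _).aestronglyMeasurable) (integrable_const _)
      (fun n => Filter.Eventually.of_forall fun u => ?_) (Filter.Eventually.of_forall fun u => ?_)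
    · have hn : ‖(1 : ℂ) / ((n : ℂ) + 1)‖ ≤ 1 := by
        rw [norm_div, norm_one, show ((n : ℂ) + 1) = ((n + 1 : ℕ) : ℂ) by push_cast; rfl,
          Complex.norm_natCast, div_le_one (by positivity)]
        simp
      rw [norm_prod, ← Fin.prod_const]
      refine Finset.prod_le_prod (fun _ _ => norm_nonneg _) fun a _ => ?_
      split_ifs
      · exact (norm_add_le _ _).trans (by rw [norm_one]; linarith)
      · linarith
    · refine tendsto_finsetProd _ fun a _ => ?_
      split_ifs
      · simpa using hlim0.add_const 1
      · exact hlim0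
  simp only [hscaled _ (hseq _)] at hlim2
  rw [tendsto_nhds_unique hlim1 hlim2, correlation_eq]
  have hind : ∀ u, ∏ a, (if z a ∈ config u then (1 : ℂ) else 0) =
      Set.indicator {u | ∀ a, z a ∈ config u} (fun _ => 1) u := by
    intro u
    rw [Finset.prod_ite_zero]
    simp [Set.indicator]
  simp only [hind]
  rw [integral_indicator_const _ hms]
  simp

end Correlation

end SymplecticPlancherel

end

noncomputable section

namespace SymplecticPlancherel

/-! ### Integrals along piecewise smooth loops -/

section Contour

variable {Γ : ℝ → ℂ}

theorem IsSimpleLoop.continuousOn (hΓ : IsSimpleLoop Γ) : ContinuousOn Γ (Set.Icc 0 1) := by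
  obtain ⟨N, τ, hτ, h0, h1, hC⟩ := hΓ.piecewise
  have key : ∀ i ≤ N, ContinuousOn Γ (Set.Icc 0 (τ i)) := by
    intro i
    induction i with
    | zero => intro _; rw [h0, Set.Icc_self]; exact continuousOn_singleton _ _
    | succ i ih =>
      intro hi
      rw [← Set.Icc_union_Icc_eq_Icc (h0 ▸ hτ (Nat.zero_le i)) (hτ i.le_succ)]
      exact (ih (by omega)).union_of_isClosed (hC i (by omega)).continuousOn isClosed_Icc
        isClosed_Icc
  exact h1 ▸ key N le_rfl

theorem IsSimpleLoop.intervalIntegrable_piece {a b : ℝ} (hab : a ≤ b)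
    (hC : ContDiffOn ℝ 1 Γ (Set.Icc a b)) {f : ℂ → ℂ}
    (hf : ContinuousOn (fun t => f (Γ t)) (Set.Icc a b)) :
    IntervalIntegrable (fun t => f (Γ t) * deriv Γ t) volume a b := by
  rcases hab.eq_or_lt with rfl | hlt
  · simp
  have h1 : ContinuousOn (fun t => f (Γ t) * derivWithin Γ (Set.Icc a b) t) (Set.Icc a b) :=
    hf.mul (hC.continuousOn_derivWithin (uniqueDiffOn_Icc hlt) le_rfl)
  -- At the corners `deriv Γ` may be a default value; it agrees with the one-sided derivative inside
  -- each piece, which suffices for integrals.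
  refine IntervalIntegrable.congr_uIoo (h1.intervalIntegrable_of_Icc hab) fun t ht => ?_
  rw [Set.uIoo_of_le hab] at ht
  rw [derivWithin_of_mem_nhds (Icc_mem_nhds ht.1 ht.2)]

theorem continuousOn_comp_trace (hΓ : IsSimpleLoop Γ) {f : ℂ → ℂ}
    (hf : ContinuousOn f (Γ '' Set.Icc 0 1)) : ContinuousOn (fun t => f (Γ t)) (Set.Icc 0 1) :=
  hf.comp hΓ.continuousOn (Set.mapsTo_image _ _)

theorem IsSimpleLoop.intervalIntegrable (hΓ : IsSimpleLoop Γ) {f : ℂ → ℂ}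
    (hf : ContinuousOn f (Γ '' Set.Icc 0 1)) :
    IntervalIntegrable (fun t => f (Γ t) * deriv Γ t) volume 0 1 := by
  obtain ⟨N, τ, hτ, h0, h1, hC⟩ := hΓ.piecewise
  rw [← h0, ← h1]
  refine IntervalIntegrable.trans_iterate fun i hi => ?_
  refine IsSimpleLoop.intervalIntegrable_piece (hτ i.le_succ) (hC i hi)
    ((continuousOn_comp_trace hΓ hf).mono (Set.Icc_subset_Icc ?_ ?_))
  · exact h0 ▸ hτ (Nat.zero_le i)
  · exact h1 ▸ hτ hi

theorem contourIntegral_add (hΓ : IsSimpleLoop Γ) {f g : ℂ → ℂ}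
    (hf : ContinuousOn f (Γ '' Set.Icc 0 1)) (hg : ContinuousOn g (Γ '' Set.Icc 0 1)) :
    contourIntegral Γ (fun u => f u + g u) = contourIntegral Γ f + contourIntegral Γ g := by
  unfold contourIntegral
  rw [← intervalIntegral.integral_add (hΓ.intervalIntegrable hf) (hΓ.intervalIntegrable hg)]
  simp only [add_mul]

theorem contourIntegral_const_mul (c : ℂ) (f : ℂ → ℂ) :
    contourIntegral Γ (fun u => c * f u) = c * contourIntegral Γ f := by
  unfold contourIntegral
  rw [← intervalIntegral.integral_const_mul]
  simp only [mul_assoc]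

theorem contourIntegral_sub (hΓ : IsSimpleLoop Γ) {f g : ℂ → ℂ}
    (hf : ContinuousOn f (Γ '' Set.Icc 0 1)) (hg : ContinuousOn g (Γ '' Set.Icc 0 1)) :
    contourIntegral Γ (fun u => f u - g u) = contourIntegral Γ f - contourIntegral Γ g := by
  unfold contourIntegral
  rw [← intervalIntegral.integral_sub (hΓ.intervalIntegrable hf) (hΓ.intervalIntegrable hg)]
  simp only [sub_mul]

theorem contourIntegral_sum (hΓ : IsSimpleLoop Γ) {ι : Type*} (s : Finset ι) {f : ι → ℂ → ℂ}
    (hf : ∀ i ∈ s, ContinuousOn (f i) (Γ '' Set.Icc 0 1)) :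
    contourIntegral Γ (fun u => ∑ i ∈ s, f i u) = ∑ i ∈ s, contourIntegral Γ (f i) := by
  unfold contourIntegral
  rw [← intervalIntegral.integral_finsetSum fun i hi => hΓ.intervalIntegrable (hf i hi)]
  simp only [Finset.sum_mul]

theorem contourIntegral_congr {f g : ℂ → ℂ} (h : ∀ u ∈ Γ '' Set.Icc 0 1, f u = g u) :
    contourIntegral Γ f = contourIntegral Γ g := by
  unfold contourIntegral
  refine intervalIntegral.integral_congr fun t ht => ?_
  rw [Set.uIcc_of_le zero_le_one] at ht
  rw [h _ (Set.mem_image_of_mem _ ht)]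

/-- The fundamental theorem of calculus on each smooth piece; the increments telescope around the
closed curve. -/
theorem contourIntegral_eq_zero_of_hasDerivAt (hΓ : IsSimpleLoop Γ) {F f : ℂ → ℂ}
    (hF : ∀ u ∈ Γ '' Set.Icc 0 1, HasDerivAt F (f u) u)
    (hf : ContinuousOn f (Γ '' Set.Icc 0 1)) : contourIntegral Γ f = 0 := by
  have hFc : ContinuousOn (fun t => F (Γ t)) (Set.Icc 0 1) :=
    continuousOn_comp_trace hΓ fun u hu => (hF u hu).continuousAt.continuousWithinAt
  have hfc := continuousOn_comp_trace hΓ hf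
  obtain ⟨N, τ, hτ, h0, h1, hC⟩ := hΓ.piecewise
  have hsub : ∀ i < N, Set.Icc (τ i) (τ (i + 1)) ⊆ Set.Icc 0 1 := fun i hi =>
    Set.Icc_subset_Icc (h0 ▸ hτ (Nat.zero_le i)) (h1 ▸ hτ hi)
  have hint : ∀ i < N, IntervalIntegrable (fun t => f (Γ t) * deriv Γ t) volume (τ i) (τ (i + 1)) :=
    fun i hi => IsSimpleLoop.intervalIntegrable_piece (hτ i.le_succ) (hC i hi)
      (hfc.mono (hsub i hi))
  have hpiece : ∀ i < N, ∫ t in τ i..τ (i + 1), f (Γ t) * deriv Γ t =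
      F (Γ (τ (i + 1))) - F (Γ (τ i)) := by
    intro i hi
    refine intervalIntegral.integral_eq_sub_of_hasDerivAt_of_le (f := fun t => F (Γ t))
      (hτ i.le_succ) (hFc.mono (hsub i hi)) (fun t ht => ?_) (hint i hi)
    have hd : DifferentiableAt ℝ Γ t :=
      ((hC i hi).differentiableOn one_ne_zero).differentiableAt (Icc_mem_nhds ht.1 ht.2)
    exact (hF _ (Set.mem_image_of_mem _ (hsub i hi (Set.Ioo_subset_Icc_self ht)))).comp_of_eq t
      hd.hasDerivAt rfl
  have h2 := intervalIntegral.sum_integral_adjacent_intervals hint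
  rw [Finset.sum_congr rfl fun i hi => hpiece i (Finset.mem_range.1 hi),
    Finset.sum_range_sub (fun i => F (Γ (τ i))), h0, h1, hΓ.closed, sub_self] at h2
  exact h2.symm

theorem contourIntegral_eq_zero_of_differentiableOn (hΓ : IsSimpleLoop Γ) {M : ℝ} {h : ℂ → ℂ}
    (hh : DifferentiableOn ℂ h (Metric.ball 0 M)) (hM : Γ '' Set.Icc 0 1 ⊆ Metric.ball 0 M) :
    contourIntegral Γ h = 0 := by
  obtain ⟨F, hF⟩ := hh.isExactOn_ball
  exact contourIntegral_eq_zero_of_hasDerivAt hΓ (fun u hu => hF u (hM hu))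
    (hh.continuousOn.mono hM)

theorem contourIntegral_inv_sub (Γ : ℝ → ℂ) (a : ℂ) :
    contourIntegral Γ (fun u => 1 / (u - a)) = 2 * Real.pi * Complex.I * winding Γ a := by
  rw [winding, ← mul_assoc, mul_one_div_cancel Complex.two_pi_I_ne_zero, one_mul]

theorem contourIntegral_inv_sub_pow (hΓ : IsSimpleLoop Γ) {a : ℂ} (ha : a ∉ Γ '' Set.Icc 0 1)
    (p : ℕ) : contourIntegral Γ (fun u => 1 / (u - a) ^ (p + 2)) = 0 := by
  have hne : ∀ u ∈ Γ '' Set.Icc 0 1, u - a ≠ 0 := fun u hu h0 => ha (sub_eq_zero.1 h0 ▸ hu)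
  refine contourIntegral_eq_zero_of_hasDerivAt hΓ
    (F := fun u => -(1 / ((p : ℂ) + 1)) * (1 / (u - a) ^ (p + 1))) (fun u hu => ?_) ?_
  · have h1 : HasDerivAt (fun u : ℂ => (u - a) ^ (p + 1)) (((p + 1 : ℕ) : ℂ) * (u - a) ^ p * 1) u :=
      ((hasDerivAt_id u).sub_const a).fun_pow (p + 1)
    have h2 := (h1.fun_inv (pow_ne_zero _ (hne u hu))).const_mul (-(1 / ((p : ℂ) + 1)))
    have hp : (p : ℂ) + 1 ≠ 0 := by exact_mod_cast p.succ_ne_zero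
    have h0 := hne u hu
    simp only [one_div] at h2 ⊢
    refine h2.congr_deriv ?_
    push_cast
    field_simp
    ring
  · exact continuousOn_const.div (by fun_prop) fun u hu => pow_ne_zero _ (hne u hu)

/-- Cauchy's theorem with poles of winding number 0, by induction on their number. Two distinct
poles are separated by partial fractions. For a single repeated pole in the disk the value h(a) is
split off: a simple pole gives the winding number, a higher one has a primitive. A pole outside the
disk is absorbed into `h`. -/
theorem contourIntegral_div_prod_eq_zero (hΓ : IsSimpleLoop Γ) {M : ℝ}
    (hM : Γ '' Set.Icc 0 1 ⊆ Metric.ball 0 M) (s : Multiset ℂ)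
    (hs : ∀ a ∈ s, a ∉ Γ '' Set.Icc 0 1 ∧ winding Γ a = 0) {h : ℂ → ℂ}
    (hh : DifferentiableOn ℂ h (Metric.ball 0 M)) :
    contourIntegral Γ (fun u => h u / (s.map fun a => u - a).prod) = 0 := by
  have hne : ∀ a ∈ s, ∀ u ∈ Γ '' Set.Icc 0 1, u - a ≠ 0 :=
    fun a ha u hu h0 => (hs a ha).1 (sub_eq_zero.1 h0 ▸ hu)
  have hcont : ∀ {g : ℂ → ℂ} {t : Multiset ℂ}, DifferentiableOn ℂ g (Metric.ball 0 M) → t ≤ s →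
      ContinuousOn (fun u => g u / (t.map fun a => u - a).prod) (Γ '' Set.Icc 0 1) := by
    intro g t hg ht
    refine (hg.continuousOn.mono hM).div ?_ fun u hu => ?_
    · exact (continuous_multiset_prod _ fun a _ => by fun_prop).continuousOn
    · rw [Ne, Multiset.prod_eq_zero_iff, Multiset.mem_map]
      rintro ⟨a, ha, h0⟩
      exact hne a (Multiset.subset_of_le ht ha) u hu h0
  induction hn : s.card using Nat.strong_induction_on generalizing s h with
  | _ n ih =>
    subst hn
    rcases s.empty_or_exists_mem with rfl | ⟨a, ha⟩
    · simpa using contourIntegral_eq_zero_of_differentiableOn hΓ hh hM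
    obtain ⟨s, rfl⟩ := Multiset.exists_cons_of_mem ha
    have hle : ∀ {t : Multiset ℂ}, t ≤ a ::ₘ s → t.card < (a ::ₘ s).card → ∀ {g : ℂ → ℂ},
        DifferentiableOn ℂ g (Metric.ball 0 M) →
        contourIntegral Γ (fun u => g u / (t.map fun a => u - a).prod) = 0 :=
      fun {t} ht hc {g} hg => ih _ hc t (fun b hb => hs b (Multiset.subset_of_le ht hb)) hg
        (fun b hb => hne b (Multiset.subset_of_le ht hb)) (fun hg' ht' => hcont hg' (ht'.trans ht))
        rfl
    by_cases hall : ∀ b ∈ s, b = a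
    · by_cases haM : a ∈ Metric.ball (0 : ℂ) M
      · have hd : DifferentiableOn ℂ (dslope h a) (Metric.ball 0 M) :=
          (Complex.differentiableOn_dslope (Metric.isOpen_ball.mem_nhds haM)).2 hh
        have h1 : contourIntegral Γ (fun u => h u / ((a ::ₘ s).map fun a => u - a).prod) =
            contourIntegral Γ (fun u => h a * (1 / (u - a) ^ (s.card + 1)) +
              dslope h a u / (s.map fun a => u - a).prod) := by
          refine contourIntegral_congr fun u hu => ?_
          have h0 := hne a (Multiset.mem_cons_self a s) u hu
          rw [Multiset.map_cons, Multiset.prod_cons, Multiset.eq_replicate_card.2 hall,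
            Multiset.map_replicate, Multiset.prod_replicate, Multiset.card_replicate]
          have h2 := sub_smul_dslope h a u
          rw [smul_eq_mul] at h2
          rw [show h u = h a + (u - a) * dslope h a u by rw [h2]; ring]
          field_simp
          ring
        have hc1 : ContinuousOn (fun u => h a * (1 / (u - a) ^ (s.card + 1))) (Γ '' Set.Icc 0 1) :=
          continuousOn_const.mul (continuousOn_const.div (by fun_prop) fun u hu =>
            pow_ne_zero _ (hne a (Multiset.mem_cons_self a s) u hu))
        rw [h1, contourIntegral_add hΓ hc1 (hcont hd (Multiset.le_cons_self s a)),
          contourIntegral_const_mul, hle (Multiset.le_cons_self s a) (by simp) hd, add_zero]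
        rcases Nat.eq_zero_or_pos s.card with h0 | h0
        · rw [h0]
          simp only [zero_add, pow_one]
          rw [contourIntegral_inv_sub, (hs a (Multiset.mem_cons_self a s)).2, mul_zero, mul_zero]
        · obtain ⟨p, hp⟩ := Nat.exists_eq_add_of_lt h0
          rw [hp, zero_add, contourIntegral_inv_sub_pow hΓ (hs a (Multiset.mem_cons_self a s)).1,
            mul_zero]
      · have h1 : contourIntegral Γ (fun u => h u / ((a ::ₘ s).map fun a => u - a).prod) =
            contourIntegral Γ (fun u => h u / (u - a) / (s.map fun a => u - a).prod) := by
          refine contourIntegral_congr fun u hu => ?_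
          rw [Multiset.map_cons, Multiset.prod_cons, div_div]
        rw [h1]
        refine hle (g := fun u => h u / (u - a)) (Multiset.le_cons_self s a) (by simp)
          (hh.div (by fun_prop) fun u hu h0 => haM (sub_eq_zero.1 h0 ▸ hu))
    · push Not at hall
      obtain ⟨b, hb, hba⟩ := hall
      obtain ⟨s, rfl⟩ := Multiset.exists_cons_of_mem hb
      have h1 : contourIntegral Γ (fun u => h u / ((a ::ₘ b ::ₘ s).map fun a => u - a).prod) =
          contourIntegral Γ (fun u => 1 / (b - a) * (h u / ((b ::ₘ s).map fun a => u - a).prod -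
            h u / ((a ::ₘ s).map fun a => u - a).prod)) := by
        refine contourIntegral_congr fun u hu => ?_
        have ha0 := hne a (by simp) u hu
        have hb0 := hne b (by simp) u hu
        have hab : b - a ≠ 0 := sub_ne_zero.2 hba
        have hp : (s.map fun a => u - a).prod ≠ 0 := by
          rw [Ne, Multiset.prod_eq_zero_iff, Multiset.mem_map]
          rintro ⟨c, hc, h0⟩
          exact hne c (by simp [hc]) u hu h0
        simp only [Multiset.map_cons, Multiset.prod_cons]
        field_simp
        ring
      have hl1 : b ::ₘ s ≤ a ::ₘ b ::ₘ s := Multiset.le_cons_self _ _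
      have hl2 : a ::ₘ s ≤ a ::ₘ b ::ₘ s := Multiset.cons_le_cons a (Multiset.le_cons_self _ _)
      rw [h1, contourIntegral_const_mul, contourIntegral_sub hΓ (hcont hh hl1) (hcont hh hl2),
        hle hl1 (by simp) hh, hle hl2 (by simp) hh, sub_zero, mul_zero]

end Contour

end SymplecticPlancherel

end

noncomputable section

namespace SymplecticPlancherel

/-! ### The contour integral in the kernel -/

section Residues

variable {Γ : ℝ → ℂ}

/-- The residues at `a` and `x` are opposite and are counted with equal winding numbers. -/
theorem contourIntegral_inv_pow_mul_inv (hΓ : IsSimpleLoop Γ) {a x : ℂ} (hax : x ≠ a)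
    (ha : a ∉ Γ '' Set.Icc 0 1) (hx : x ∉ Γ '' Set.Icc 0 1) (hw : winding Γ a = winding Γ x)
    (p : ℕ) : contourIntegral Γ (fun u => 1 / ((u - a) ^ (p + 1) * (u - x))) = 0 := by
  have hne : ∀ b, b ∉ Γ '' Set.Icc 0 1 → ∀ u ∈ Γ '' Set.Icc 0 1, u - b ≠ 0 :=
    fun b hb u hu h0 => hb (sub_eq_zero.1 h0 ▸ hu)
  have hc1 : ∀ b, b ∉ Γ '' Set.Icc 0 1 → ∀ q : ℕ,
      ContinuousOn (fun u => 1 / (u - b) ^ q) (Γ '' Set.Icc 0 1) := fun b hb q =>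
    continuousOn_const.div (by fun_prop) fun u hu => pow_ne_zero _ (hne b hb u hu)
  have hc2 : ∀ q : ℕ, ContinuousOn (fun u => 1 / ((u - a) ^ q * (u - x))) (Γ '' Set.Icc 0 1) :=
    fun q => continuousOn_const.div (by fun_prop) fun u hu =>
      mul_ne_zero (pow_ne_zero _ (hne a ha u hu)) (hne x hx u hu)
  have hxa : x - a ≠ 0 := sub_ne_zero.2 hax
  have hstep : ∀ q : ℕ, contourIntegral Γ (fun u => 1 / ((u - a) ^ (q + 1) * (u - x))) =
      1 / (x - a) * (contourIntegral Γ (fun u => 1 / ((u - a) ^ q * (u - x))) -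
        contourIntegral Γ (fun u => 1 / (u - a) ^ (q + 1))) := by
    intro q
    rw [← contourIntegral_sub hΓ (hc2 q) (hc1 a ha (q + 1)), ← contourIntegral_const_mul]
    refine contourIntegral_congr fun u hu => ?_
    have h1 := hne a ha u hu
    have h2 := hne x hx u hu
    field_simp
    ring
  induction p with
  | zero =>
    rw [hstep]
    simp only [pow_zero, one_mul, zero_add, pow_one]
    rw [contourIntegral_inv_sub, contourIntegral_inv_sub, hw, sub_self, mul_zero]
  | succ p ih => rw [hstep, ih, contourIntegral_inv_sub_pow hΓ ha, sub_self, mul_zero]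

/-- `F` is the quotient of a function holomorphic on a disk of radius `M` by `D`. -/
def RatioOn (D : ℂ → ℂ) (M : ℝ) (F : ℂ → ℂ) : Prop :=
  ∃ H : ℂ → ℂ, DifferentiableOn ℂ H (Metric.ball 0 M) ∧
    ∀ u ∈ Metric.ball (0 : ℂ) M, D u ≠ 0 → F u = H u / D u

variable {D F : ℂ → ℂ} {M : ℝ}

/-- The numerator of F - F(1) is H - F(1)D, which vanishes at 1, so dividing by 2(x - 1) keeps the
denominator `D`. At 1 itself the value comes from the derivative. -/
theorem RatioOn.Q (hM : 1 < M) (hD : Differentiable ℂ D) (hD1 : D 1 ≠ 0) (hF : RatioOn D M F) :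
    RatioOn D M (Q F) := by
  obtain ⟨H, hH, hFH⟩ := hF
  have h1M := one_mem_ball hM
  set G : ℂ → ℂ := fun u => H u - F 1 * D u
  have hG : DifferentiableOn ℂ G (Metric.ball 0 M) := hH.sub (hD.differentiableOn.const_mul _)
  have hG1 : G 1 = 0 := by
    simp only [G, hFH 1 h1M hD1]
    field_simp
    ring
  have hGQ : ∀ u, G u = 2 * (u - 1) * SymplecticPlancherel.Q G u := by
    intro u
    have := eq_add_Q G u
    rwa [hG1, zero_add] at this
  have hQG := Q_differentiableOn hM hG
  have heq : ∀ u ∈ Metric.ball (0 : ℂ) M, D u ≠ 0 →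
      F u = F 1 + 2 * (u - 1) * (SymplecticPlancherel.Q G u / D u) := by
    intro u hu hDu
    rw [hFH u hu hDu, mul_div_assoc', ← hGQ u]
    simp only [G]
    field_simp
    ring
  refine ⟨_, hQG, fun u hu hDu => ?_⟩
  rcases eq_or_ne u 1 with rfl | hu1
  · have hev : F =ᶠ[nhds 1] fun u => F 1 + 2 * (u - 1) * (SymplecticPlancherel.Q G u / D u) := by
      filter_upwards [Metric.isOpen_ball.mem_nhds hu, hD.continuous.continuousAt.eventually_ne hDu]
        with v hv hDv using heq v hv hDv
    have hK : DifferentiableAt ℂ (fun u => SymplecticPlancherel.Q G u / D u) 1 :=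
      (hQG.differentiableAt (Metric.isOpen_ball.mem_nhds hu)).div hD.differentiableAt hDu
    have hlin : HasDerivAt (fun u : ℂ => 2 * (u - 1)) (2 * 1) 1 :=
      ((hasDerivAt_id 1).sub_const 1).const_mul 2
    have hd := ((hlin.mul hK.hasDerivAt).const_add (F 1)).congr_of_eventuallyEq hev
    rw [SymplecticPlancherel.Q, dslope_same, hd.deriv]
    simp
  · have h2 := eq_add_Q F u
    rw [heq u hu hDu] at h2
    have h3 : 2 * (u - 1) ≠ 0 := mul_ne_zero two_ne_zero (sub_ne_zero.2 hu1)
    exact (mul_left_cancel₀ h3 (add_left_cancel h2)).symm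

theorem RatioOn.Q_iterate (hM : 1 < M) (hD : Differentiable ℂ D) (hD1 : D 1 ≠ 0)
    (hF : RatioOn D M F) (i : ℕ) : RatioOn D M (SymplecticPlancherel.Q^[i] F) := by
  induction i with
  | zero => exact hF
  | succ i ih => rw [Function.iterate_succ_apply']; exact ih.Q hM hD hD1

theorem RatioOn.continuousOn (hF : RatioOn D M F) (hD : Differentiable ℂ D)
    (hΓM : Γ '' Set.Icc 0 1 ⊆ Metric.ball 0 M) (hDΓ : ∀ u ∈ Γ '' Set.Icc 0 1, D u ≠ 0) :
    ContinuousOn F (Γ '' Set.Icc 0 1) := by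
  obtain ⟨H, hH, hFH⟩ := hF
  exact ((hH.continuousOn.mono hΓM).div hD.continuous.continuousOn hDΓ).congr
    fun u hu => hFH u (hΓM hu) (hDΓ u hu)

/-- Cauchy's integral formula for a meromorphic function: (F(u) - F(x))/(u - x) is again a
holomorphic function over `D`, so its integral is zero by `hnull`. -/
theorem RatioOn.contourIntegral_div_sub (hΓ : IsSimpleLoop Γ) (hF : RatioOn D M F)
    (hD : Differentiable ℂ D) (hΓM : Γ '' Set.Icc 0 1 ⊆ Metric.ball 0 M)
    (hDΓ : ∀ u ∈ Γ '' Set.Icc 0 1, D u ≠ 0)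
    (hnull : ∀ h : ℂ → ℂ, DifferentiableOn ℂ h (Metric.ball 0 M) →
      contourIntegral Γ (fun u => h u / D u) = 0)
    {x : ℂ} (hxM : x ∈ Metric.ball (0 : ℂ) M) (hDx : D x ≠ 0) (hx : x ∉ Γ '' Set.Icc 0 1) :
    contourIntegral Γ (fun u => F u / (u - x)) = F x * (2 * Real.pi * Complex.I * winding Γ x) := by
  obtain ⟨H, hH, hFH⟩ := hF
  have hne : ∀ u ∈ Γ '' Set.Icc 0 1, u - x ≠ 0 := fun u hu h0 => hx (sub_eq_zero.1 h0 ▸ hu)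
  set G : ℂ → ℂ := fun u => H u - F x * D u
  have hG : DifferentiableOn ℂ G (Metric.ball 0 M) := hH.sub (hD.differentiableOn.const_mul _)
  have hGx : G x = 0 := by
    simp only [G, hFH x hxM hDx]
    field_simp
    ring
  have hd : DifferentiableOn ℂ (dslope G x) (Metric.ball 0 M) :=
    (Complex.differentiableOn_dslope (Metric.isOpen_ball.mem_nhds hxM)).2 hG
  have h1 : contourIntegral Γ (fun u => F u / (u - x)) =
      contourIntegral Γ (fun u => F x * (1 / (u - x)) + dslope G x u / D u) := by
    refine contourIntegral_congr fun u hu => ?_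
    have h2 := sub_smul_dslope G x u
    rw [hGx, sub_zero, smul_eq_mul] at h2
    have h3 : H u = F x * D u + (u - x) * dslope G x u := by
      rw [h2]; simp only [G]; ring
    have h4 := hne u hu
    have h5 := hDΓ u hu
    rw [hFH u (hΓM hu) h5, h3]
    field_simp
  rw [h1, contourIntegral_add hΓ, contourIntegral_const_mul, contourIntegral_inv_sub, hnull _ hd,
    add_zero]
  · exact continuousOn_const.mul (continuousOn_const.div (by fun_prop) hne)
  · exact (hd.continuousOn.mono hΓM).div hD.continuous.continuousOn hDΓ

/-- Expand F at 1 to order m. The Taylor terms give integrals of 1/((u-1)^p (u-x)) with p ≥ 1, which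
vanish since 1 and x have the same winding number; the remainder is treated by Cauchy's formula. -/
theorem RatioOn.contourIntegral_div_pow_mul (hΓ : IsSimpleLoop Γ) (hF : RatioOn D M F)
    (hM : 1 < M) (hD : Differentiable ℂ D) (hΓM : Γ '' Set.Icc 0 1 ⊆ Metric.ball 0 M)
    (hDΓ : ∀ u ∈ Γ '' Set.Icc 0 1, D u ≠ 0)
    (hnull : ∀ h : ℂ → ℂ, DifferentiableOn ℂ h (Metric.ball 0 M) →
      contourIntegral Γ (fun u => h u / D u) = 0)
    (hD1 : D 1 ≠ 0) (h1Γ : 1 ∉ Γ '' Set.Icc 0 1) (h1w : winding Γ 1 = 1)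
    {x : ℂ} (hxM : x ∈ Metric.ball (0 : ℂ) M) (hDx : D x ≠ 0) (hx : x ∉ Γ '' Set.Icc 0 1)
    (hxw : winding Γ x = 1) (hx1 : x ≠ 1) (m : ℕ) :
    contourIntegral Γ (fun u => F u / ((1 - u) ^ m * (x - u))) =
      -((-2) ^ m * (2 * Real.pi * Complex.I * SymplecticPlancherel.Q^[m] F x)) := by
  have hne : ∀ b, b ∉ Γ '' Set.Icc 0 1 → ∀ u ∈ Γ '' Set.Icc 0 1, u - b ≠ 0 :=
    fun b hb u hu h0 => hb (sub_eq_zero.1 h0 ▸ hu)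
  have hQ := hF.Q_iterate hM hD hD1 m
  have hpt : ∀ u ∈ Γ '' Set.Icc 0 1, F u / ((1 - u) ^ m * (x - u)) =
      (-1) ^ (m + 1) * (∑ j ∈ Finset.range m, SymplecticPlancherel.Q^[j] F 1 * 2 ^ j *
        (1 / ((u - 1) ^ (m - 1 - j + 1) * (u - x))) +
        2 ^ m * (SymplecticPlancherel.Q^[m] F u / (u - x))) := by
    intro u hu
    have h1 := hne 1 h1Γ u hu
    have h2 := hne x hx u hu
    have h3 : (1 - u) ^ m * (x - u) = (-1) ^ (m + 1) * ((u - 1) ^ m * (u - x)) := by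
      rw [← neg_sub u 1, ← neg_sub u x, neg_pow]
      ring
    have h4 : ((-1 : ℂ) ^ (m + 1))⁻¹ = (-1) ^ (m + 1) := by
      rw [← inv_pow, inv_neg, inv_one]
    rw [h3, div_mul_eq_div_div, div_eq_mul_inv (F u), h4, mul_comm (F u), mul_div_assoc]
    congr 1
    rw [eq_sum_add_Q_iterate F m u, add_div, Finset.sum_div]
    congr 1
    · refine Finset.sum_congr rfl fun j hj => ?_
      have hj := Finset.mem_range.1 hj
      have h5 : (u - 1) ^ m = (u - 1) ^ j * (u - 1) ^ (m - 1 - j + 1) := by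
        rw [← pow_add]; congr 1; omega
      rw [h5, mul_pow]
      field_simp
    · rw [mul_pow]
      field_simp
  have hc1 : ∀ p : ℕ, ContinuousOn (fun u => 1 / ((u - 1) ^ p * (u - x))) (Γ '' Set.Icc 0 1) :=
    fun p => continuousOn_const.div (by fun_prop) fun u hu =>
      mul_ne_zero (pow_ne_zero _ (hne 1 h1Γ u hu)) (hne x hx u hu)
  have hc2 : ContinuousOn (fun u => SymplecticPlancherel.Q^[m] F u / (u - x)) (Γ '' Set.Icc 0 1) :=
    (hQ.continuousOn hD hΓM hDΓ).div (by fun_prop) (hne x hx)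
  have hc3 : ∀ j : ℕ, ContinuousOn (fun u => SymplecticPlancherel.Q^[j] F 1 * 2 ^ j *
      (1 / ((u - 1) ^ (m - 1 - j + 1) * (u - x)))) (Γ '' Set.Icc 0 1) :=
    fun j => continuousOn_const.mul (hc1 _)
  have hc4 : ContinuousOn (fun u => 2 ^ m * (SymplecticPlancherel.Q^[m] F u / (u - x)))
      (Γ '' Set.Icc 0 1) := continuousOn_const.mul hc2
  rw [contourIntegral_congr hpt, contourIntegral_const_mul, contourIntegral_add hΓ
    (continuousOn_finsetSum _ fun j _ => hc3 j) hc4, contourIntegral_sum hΓ _ fun j _ => hc3 j,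
    contourIntegral_const_mul,
    hQ.contourIntegral_div_sub hΓ hD hΓM hDΓ hnull hxM hDx hx, hxw]
  simp only [contourIntegral_const_mul,
    contourIntegral_inv_pow_mul_inv hΓ hx1 h1Γ hx (h1w.trans hxw.symm), mul_zero,
    Finset.sum_const_zero, zero_add, mul_one]
  rw [show (-2 : ℂ) = -1 * 2 by ring, mul_pow]
  ring

/-! ### Reduction of the zeros of `E` in a disk to a finite product. -/

theorem exists_prod_linear_eq (c : ℕ → ℝ) (N : ℕ) : ∃ (C : ℂ) (s : Multiset ℂ), C ≠ 0 ∧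
    (∀ a ∈ s, ∃ i, 1 + (c i : ℂ) * (a - 1) = 0) ∧
    ∀ u, ∏ i ∈ Finset.range N, (1 + (c i : ℂ) * (u - 1)) = C * (s.map fun a => u - a).prod := by
  induction N with
  | zero => exact ⟨1, 0, one_ne_zero, by simp, by simp⟩
  | succ N ih =>
    obtain ⟨C, s, hC, hs, hp⟩ := ih
    by_cases hc : (c N : ℂ) = 0
    · exact ⟨C, s, hC, hs, fun u => by rw [Finset.prod_range_succ, hp, hc]; ring⟩
    · refine ⟨C * c N, (1 - 1 / (c N : ℂ)) ::ₘ s, mul_ne_zero hC hc, fun a ha => ?_, fun u => ?_⟩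
      · rcases Multiset.mem_cons.1 ha with rfl | ha
        · refine ⟨N, ?_⟩
          field_simp
          ring
        · exact hs a ha
      · rw [Finset.prod_range_succ, hp, Multiset.map_cons, Multiset.prod_cons]
        field_simp
        ring

/-- The coefficients tend to 0, so the zeros 1 - 1/cᵢ of the nonconstant factors leave every disk.
-/
theorem exists_forall_linProd_tail_ne_zero {c : ℕ → ℝ} (hc : Summable fun i => |c i|) (M : ℝ) :
    ∃ N, ∀ u ∈ Metric.ball (0 : ℂ) M, linProd (fun i => c (i + N)) u ≠ 0 := by
  have h0 : Filter.Tendsto (fun i => |c i| * (|M| + 1)) Filter.atTop (nhds 0) := by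
    simpa using hc.tendsto_atTop_zero.mul_const (|M| + 1)
  obtain ⟨N, hN⟩ := Filter.eventually_atTop.1 (h0.eventually_lt_const one_pos)
  refine ⟨N, fun u hu => linProd_ne_zero ((summable_nat_add_iff N).2 hc) fun i h => ?_⟩
  have h1 := hN (i + N) (Nat.le_add_left _ _)
  have h2 : ‖(c (i + N) : ℂ) * (u - 1)‖ = 1 := by
    rw [← norm_neg, ← neg_eq_of_add_eq_zero_right (G := ℂ) h, neg_neg, norm_one]
  rw [norm_mul, Complex.norm_real, Real.norm_eq_abs] at h2
  have h3 : ‖u - 1‖ ≤ |M| + 1 := by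
    refine (norm_sub_le _ _).trans ?_
    rw [norm_one]
    have := mem_ball_zero_iff.1 hu
    linarith [le_abs_self M]
  nlinarith [abs_nonneg (c (i + N))]

theorem contourIntegral_siteQuot {ω : Param} (hΓ : IsAdmissible ω Γ) (w : ℕ × ℕ+) {x : ℝ}
    (hx : x ∈ Set.Icc (-1 : ℝ) 1) (hx1 : x ≠ 1) (m : ℕ) :
    contourIntegral Γ (fun u => siteQuot ω w u / ((1 - u) ^ m * (x - u))) =
      -((-2) ^ m * (2 * Real.pi * Complex.I * SymplecticPlancherel.Q^[m] (siteQuot ω w) x)) := by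
  have hloop := hΓ.isSimpleLoop
  obtain ⟨M, hM1, hΓM⟩ : ∃ M : ℝ, 1 < M ∧ Γ '' Set.Icc 0 1 ⊆ Metric.ball 0 M := by
    obtain ⟨M, hM⟩ := (isCompact_Icc.image_of_continuousOn hloop.continuousOn).isBounded.subset_ball 0
    exact ⟨max M 2, lt_max_of_lt_right one_lt_two, hM.trans (Metric.ball_subset_ball (le_max_left _ _))⟩
  have hc := numCoeff_summable ω
  obtain ⟨N, hN⟩ := exists_forall_linProd_tail_ne_zero hc M
  obtain ⟨C, s, hC, hs, hp⟩ := exists_prod_linear_eq (numCoeff ω) N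
  set D : ℂ → ℂ := fun u => ∏ i ∈ Finset.range N, (1 + (numCoeff ω i : ℂ) * (u - 1))
  have hD : Differentiable ℂ D := by fun_prop
  have hzero : ∀ {a : ℂ} {i : ℕ}, 1 + (numCoeff ω i : ℂ) * (a - 1) = 0 →
      a ∉ Γ '' Set.Icc 0 1 ∧ winding Γ a = 0 := fun {a i} h =>
    hΓ.zero_outside a (isZero_iff.2 ⟨i, (factor_β ω i a).trans h⟩)
  have hDΓ : ∀ u ∈ Γ '' Set.Icc 0 1, D u ≠ 0 := fun u hu =>
    Finset.prod_ne_zero_iff.2 fun i _ h0 => (hzero h0).1 hu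
  -- Points of the segment have winding number 1, zeros of `E` have winding number 0.
  have hDx : ∀ x ∈ Set.Icc (-1 : ℝ) 1, D x ≠ 0 := fun x hx =>
    Finset.prod_ne_zero_iff.2 fun i _ h0 => by
      have h1 := (hzero h0).2
      rw [(hΓ.around x hx).2] at h1
      exact one_ne_zero h1
  have hnull : ∀ h : ℂ → ℂ, DifferentiableOn ℂ h (Metric.ball 0 M) →
      contourIntegral Γ (fun u => h u / D u) = 0 := by
    intro h hh
    have h1 := contourIntegral_div_prod_eq_zero hloop hΓM s
      (fun a ha => by obtain ⟨i, hi⟩ := hs a ha; exact hzero hi) (hh.const_mul C⁻¹)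
    rw [← h1]
    refine contourIntegral_congr fun u _ => ?_
    rw [show D u = _ from hp u, div_mul_eq_div_div, div_eq_inv_mul (h u)]
  have hR : RatioOn D M (siteQuot ω w) := by
    refine ⟨fun u => siteJ w u * Complex.exp (-(ω.γ * (u - 1))) *
      linProd (fun i => -denCoeff ω i) u / linProd (fun i => numCoeff ω (i + N)) u, ?_, ?_⟩
    · have h1 : Differentiable ℂ fun u => Complex.exp (-(ω.γ * (u - 1))) := by fun_prop
      exact (((siteJ_differentiableOn w).mul h1.differentiableOn).mul
        (linProd_differentiable (denCoeff_summable ω)).differentiableOn).div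
        (linProd_differentiable ((summable_nat_add_iff N).2 hc)).differentiableOn hN
    · intro u _ _
      have hE : (E ω u)⁻¹ = Complex.exp (-(ω.γ * (u - 1))) * linProd (fun i => -denCoeff ω i) u /
          (D u * linProd (fun i => numCoeff ω (i + N)) u) := by
        rw [E_inv, linProd_eq_prod_mul hc N u]
      rw [siteQuot, div_eq_mul_inv, hE]
      beta_reduce
      generalize D u = d
      generalize linProd (fun i => numCoeff ω (i + N)) u = e
      ring
  have hmem : ∀ x ∈ Set.Icc (-1 : ℝ) 1, (x : ℂ) ∈ Metric.ball (0 : ℂ) M := by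
    intro x hx
    rw [mem_ball_zero_iff, Complex.norm_real]
    exact (abs_le.2 hx).trans_lt hM1
  have h1 : (1 : ℝ) ∈ Set.Icc (-1 : ℝ) 1 := ⟨by norm_num, le_rfl⟩
  have h1a := hΓ.around 1 h1
  have h1D := hDx 1 h1
  rw [Complex.ofReal_one] at h1a h1D
  exact hR.contourIntegral_div_pow_mul hloop hM1 hD hΓM hDΓ hnull h1D h1a.1 h1a.2 (hmem x hx)
    (hDx x hx) (hΓ.around x hx).1 (hΓ.around x hx).2 (by exact_mod_cast hx1) m

end Residues

end SymplecticPlancherel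

end

noncomputable section

namespace SymplecticPlancherel

/-! ### The kernel -/

theorem integral_congr_of_lt_one {f g : ℝ → ℂ} (h : ∀ x ∈ Set.Ioo (-1 : ℝ) 1, f x = g x) :
    ∫ x in (-1 : ℝ)..1, f x = ∫ x in (-1 : ℝ)..1, g x :=
  intervalIntegral.integral_congr_Ioo_of_le (by norm_num) h

theorem rpow_natCast_add {y : ℝ} (hy : 0 < y) (k : ℕ) (e : ℝ) : y ^ ((k : ℝ) + e) = y ^ k * y ^ e := by
  rw [Real.rpow_add hy, Real.rpow_natCast]

theorem integral_contourIntegral_eq {ω : Param} {Γ : ℝ → ℂ} (hΓ : IsAdmissible ω Γ)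
    (a b : ℕ × ℕ+) :
    (((2 : ℝ) ^ (expo a.2 + 1 / 2) / Real.pi : ℝ) : ℂ) * (1 / (2 * Real.pi * Complex.I)) *
      (∫ x in (-1 : ℝ)..1, contourIntegral Γ fun u =>
        E ω x / E ω u * J a.1 a.2 x * J b.1 b.2 u *
          (((1 - x) ^ ((r a.2 : ℝ) + expo a.2) * (1 + x) ^ (1 / 2 : ℝ) : ℝ) : ℂ) /
          ((1 - u) ^ r b.2 * (x - u))) =
    -((-2) ^ r b.2 / (-2) ^ r a.2) * coef a.2 a.1 fun x =>
      (2 * (x - 1)) ^ r a.2 * (E ω x * Q^[r b.2] (siteQuot ω b) x) := by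
  have hI := Complex.two_pi_I_ne_zero
  have hpow : ((-2 : ℂ)) ^ r a.2 ≠ 0 := pow_ne_zero _ (by norm_num)
  have h1 : ∀ x ∈ Set.Ioo (-1 : ℝ) 1, (contourIntegral Γ fun u =>
        E ω x / E ω u * J a.1 a.2 x * J b.1 b.2 u *
          (((1 - x) ^ ((r a.2 : ℝ) + expo a.2) * (1 + x) ^ (1 / 2 : ℝ) : ℝ) : ℂ) /
          ((1 - u) ^ r b.2 * (x - u))) =
      -((-2) ^ r b.2 / (-2) ^ r a.2) * (2 * Real.pi * Complex.I) *
        ((2 * ((x : ℂ) - 1)) ^ r a.2 * (E ω x * Q^[r b.2] (siteQuot ω b) x) * J a.1 a.2 x *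
          (((1 - x) ^ expo a.2 * (1 + x) ^ (1 / 2 : ℝ) : ℝ) : ℂ)) := by
    intro x hx
    have h2 := contourIntegral_siteQuot hΓ b (Set.Ioo_subset_Icc_self hx) hx.2.ne (r b.2)
    have h3 : (contourIntegral Γ fun u =>
        E ω x / E ω u * J a.1 a.2 x * J b.1 b.2 u *
          (((1 - x) ^ ((r a.2 : ℝ) + expo a.2) * (1 + x) ^ (1 / 2 : ℝ) : ℝ) : ℂ) /
          ((1 - u) ^ r b.2 * (x - u))) = (E ω x * J a.1 a.2 x *
          (((1 - x) ^ ((r a.2 : ℝ) + expo a.2) * (1 + x) ^ (1 / 2 : ℝ) : ℝ) : ℂ)) *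
        contourIntegral Γ (fun u => siteQuot ω b u / ((1 - u) ^ r b.2 * (x - u))) := by
      rw [← contourIntegral_const_mul]
      refine contourIntegral_congr fun u _ => ?_
      rw [siteQuot, siteJ]
      ring
    rw [h3, h2, rpow_natCast_add (sub_pos.2 hx.2)]
    have h4 : (2 * ((x : ℂ) - 1)) ^ r a.2 = (-2) ^ r a.2 * (1 - (x : ℂ)) ^ r a.2 := by
      rw [← mul_pow]; congr 1; ring
    rw [h4]
    push_cast
    field_simp
  rw [integral_congr_of_lt_one h1, intervalIntegral.integral_const_mul, coef]
  field_simp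

theorem integral_siteJ_mul_siteJ_eq {a b : ℕ × ℕ+} (hab : b.2 ≤ a.2) :
    (((2 : ℝ) ^ (expo a.2 + 1 / 2) / Real.pi : ℝ) : ℂ) *
      (∫ x in (-1 : ℝ)..1, J a.1 a.2 x * J b.1 b.2 x *
        (((1 - x) ^ ((r a.2 : ℝ) - (r b.2 : ℝ) + expo a.2) * (1 + x) ^ (1 / 2 : ℝ) : ℝ) : ℂ)) =
    (-2) ^ r b.2 / (-2) ^ r a.2 * coef a.2 a.1 fun x =>
      (2 * (x - 1)) ^ (r a.2 - r b.2) * siteJ b x := by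
  have hr : r b.2 ≤ r a.2 := r_mono hab
  have hpow : ((-2 : ℂ)) ^ r a.2 ≠ 0 := pow_ne_zero _ (by norm_num)
  have h1 : ∀ x ∈ Set.Ioo (-1 : ℝ) 1, J a.1 a.2 x * J b.1 b.2 x *
        (((1 - x) ^ ((r a.2 : ℝ) - (r b.2 : ℝ) + expo a.2) * (1 + x) ^ (1 / 2 : ℝ) : ℝ) : ℂ) =
      (-2) ^ r b.2 / (-2) ^ r a.2 * ((2 * ((x : ℂ) - 1)) ^ (r a.2 - r b.2) * siteJ b x *
        J a.1 a.2 x * (((1 - x) ^ expo a.2 * (1 + x) ^ (1 / 2 : ℝ) : ℝ) : ℂ)) := by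
    intro x hx
    have h4 : (2 * ((x : ℂ) - 1)) ^ (r a.2 - r b.2) =
        (-2) ^ (r a.2 - r b.2) * (1 - (x : ℂ)) ^ (r a.2 - r b.2) := by
      rw [← mul_pow]; congr 1; ring
    have h5 : (-2 : ℂ) ^ r a.2 = (-2) ^ (r a.2 - r b.2) * (-2) ^ r b.2 := by
      rw [← pow_add]; congr 1; omega
    rw [← Nat.cast_sub hr, rpow_natCast_add (sub_pos.2 hx.2), h4, h5, siteJ]
    push_cast
    field_simp
  rw [integral_congr_of_lt_one h1, intervalIntegral.integral_const_mul, coef]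
  ring

/-- The powers of -2 come from comparing 1 - x with 2(x - 1). They form a conjugation, which does
not change determinants; the right-hand side also shows that the contour does not matter. -/
theorem kernel_eq_coefKernel {ω : Param} {Γ : ℝ → ℂ} (hΓ : IsAdmissible ω Γ) (a b : ℕ × ℕ+) :
    kernel ω Γ a b = (-2) ^ r b.2 / (-2) ^ r a.2 * coefKernel ω a b := by
  have h1 := integral_contourIntegral_eq hΓ a b
  unfold kernel coefKernel
  by_cases hab : b.2 ≤ a.2
  · have hab' : (b.2 : ℕ) ≤ a.2 := hab
    simp only [if_pos hab, if_pos hab']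
    rw [h1, integral_siteJ_mul_siteJ_eq hab]
    ring
  · have hab' : ¬ (b.2 : ℕ) ≤ a.2 := hab
    simp only [if_neg hab, if_neg hab']
    rw [h1]
    ring

theorem det_kernel_eq {ω : Param} {Γ : ℝ → ℂ} (hΓ : IsAdmissible ω Γ) {k : ℕ}
    (z : Fin k → ℕ × ℕ+) :
    (Matrix.of fun i j => kernel ω Γ (z i) (z j)).det =
      (Matrix.of fun i j => coefKernel ω (z i) (z j)).det := by
  have h2 : ∀ i, ((-2 : ℂ)) ^ r (z i).2 ≠ 0 := fun i => pow_ne_zero _ (by norm_num)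
  have h1 : (Matrix.of fun i j => kernel ω Γ (z i) (z j)) =
      Matrix.diagonal (fun i => ((-2 : ℂ) ^ r (z i).2)⁻¹) *
        (Matrix.of fun i j => coefKernel ω (z i) (z j)) *
        Matrix.diagonal (fun i => (-2 : ℂ) ^ r (z i).2) := by
    ext i j
    rw [Matrix.mul_diagonal, Matrix.diagonal_mul, Matrix.of_apply, Matrix.of_apply,
      kernel_eq_coefKernel hΓ]
    ring
  rw [h1, Matrix.det_mul, Matrix.det_mul, Matrix.det_diagonal, Matrix.det_diagonal,
    Finset.prod_inv_distrib]
  have h3 := Finset.prod_ne_zero_iff.2 fun i (_ : i ∈ Finset.univ) => h2 i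
  field_simp

end SymplecticPlancherel

theorem mainTheorem3 (ω : SymplecticPlancherel.Param) :
    (ω.β 0 < 1 → ∃ Γ : ℝ → ℂ, SymplecticPlancherel.IsAdmissible ω Γ) ∧
    ((∃ Γ : ℝ → ℂ, SymplecticPlancherel.IsAdmissible ω Γ) →
      (∃! ℙ : MeasureTheory.Measure SymplecticPlancherel.Seqs,
        SymplecticPlancherel.IsPlancherelLaw ω ℙ) ∧
      ∀ ℙ : MeasureTheory.Measure SymplecticPlancherel.Seqs,
        SymplecticPlancherel.IsPlancherelLaw ω ℙ →
        ∀ Γ : ℝ → ℂ, SymplecticPlancherel.IsAdmissible ω Γ →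
        ∀ (k : ℕ) (z : Fin k → ℕ × ℕ+), Function.Injective z →
          (SymplecticPlancherel.correlation ℙ z : ℂ) =
            Matrix.det (Matrix.of fun i j : Fin k =>
              SymplecticPlancherel.kernel ω Γ (z i) (z j))) := by
  refine ⟨SymplecticPlancherel.exists_isAdmissible, fun ⟨Γ₀, hΓ₀⟩ => ?_⟩
  -- The only use of the given loop: the law and its correlations depend on it just through β₁ < 1.
  have h := SymplecticPlancherel.β_zero_lt_one_of_isAdmissible hΓ₀
  have hlaw := SymplecticPlancherel.isPlancherelLaw_plancherelLaw h
  refine ⟨⟨_, hlaw, fun P hP => hP.unique hlaw⟩, fun P hP Γ hΓ k z hz => ?_⟩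
  rw [SymplecticPlancherel.det_kernel_eq hΓ, SymplecticPlancherel.correlation_eq_det h hP hz]

end
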